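/- **Conventions.** Everything is over $\mathbb C$; $p(\cdot)\in\mathbb Z/2$ denotes parity, and tensor products of superalgebras have the multiplication $(a\otimes b)(a'\otimes b')=(-1)^{p(b)p(a')}aa'\otimes bb'$. Let $l\ge 1$ divide $n$ and put $N=n/l$. $Q(n)$ is the Lie superalgebra of block matrices $\begin{pmatrix}A&B\\B&A\end{pmatrix}$ with $A,B\in\mathrm{Mat}_n(\mathbb C)$, with basis $e_{i,j}$ ($A=E_{ij}$, $B=0$; even) and $f_{i,j}$ ($A=0$, $B=E_{ij}$; odd), and the supercommutator as bracket. In $U(Q(N))$ put $e^{(0)}_{i,j}=\delta_{i,j}$, $f^{(0)}_{i,j}=0$ and, for $m\ge1$, $$e^{(m)}_{i,j}=\sum_{k=1}^N e_{i,k}e^{(m-1)}_{k,j}+(-1)^{m+1}\sum_{k=1}^N f_{i,k}f^{(m-1)}_{k,j},\qquad f^{(m)}_{i,j}=\sum_{k=1}^N e_{i,k}f^{(m-1)}_{k,j}+(-1)^{m+1}\sum_{k=1}^N f_{i,k}e^{(m-1)}_{k,j}.$$ Let $h=\sum_{p=1}^{N}\sum_{i=1}^{l}(l-2i+1)\,e_{l(p-1)+i,\,l(p-1)+i}\in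 Q(n)$ and $\mathfrak g_0=\{X\in Q(n): [h,X]=0\}$. In $U(\mathfrak g_0)$ put, for $1\le p,q\le N$ and $1\le i\le l$, $$x^i_{p,q}=e_{l(p-1)+i,\,l(q-1)+i},\qquad \xi^i_{p,q}=(-1)^{i+1}f_{l(p-1)+i,\,l(q-1)+i}.$$ The super-Yangian $Y(Q(N))$ is the associative unital superalgebra with generators $T^{(m)}_{i,j}$, $m\ge1$, $i,j\in\{\pm1,\dots,\pm N\}$, of parity $p(i)+p(j)$, where $p(i)=0$ for $i>0$ and $p(i)=1$ for $i<0$, subject to the following relations for $T_{i,j}(u)=\sum_{m\ge0}T^{(m)}_{i,j}u^{-m}$, $T^{(0)}_{i,j}=\delta_{i,j}$: $$(u^2-v^2)[T_{i,j}(u),T_{k,s}(v)](-1)^{p(i)p(k)+p(i)p(s)+p(k)p(s)}=(u+v)\big(T_{k,j}(u)T_{i,s}(v)-T_{k,j}(v)T_{i,s}(u)\big)-(u-v)\big(T_{-k,j}(u)T_{-i,s}(v)-T_{k,-j}(v)T_{i,-s}(u)\big)(-1)^{p(k)+p(s)},$$ $$T_{-i,-j}(u)=T_{i,j}(-u),$$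 where $[\cdot,\cdot]$ is the supercommutator. **Theorem.** (a) There are a unique superalgebra homomorphism $\Delta^{op}:Y(Q(N))\to Y(Q(N))^{\otimes2}$ with $$\Delta^{op}(T^{(r)}_{i,j})=\sum_{s=0}^r\sum_{k\in\{\pm1,\dots,\pm N\}}T^{(r-s)}_{k,j}\otimes T^{(s)}_{i,k}\qquad(r\ge 0),$$ a unique superalgebra homomorphism $U:Y(Q(N))\to U(Q(N))$ with $U(T^{(r)}_{i,j})=(-1)^re^{(r)}_{j,i}$ and $U(T^{(r)}_{-i,j})=(-1)^rf^{(r)}_{j,i}$ for $1\le i,j\le N$ and $r\ge1$, and a unique superalgebra isomorphism $U(\mathfrak g_0)\cong U(Q(N))^{\otimes l}$ with $$x^i_{p,q}\mapsto1^{\otimes(l-i)}\otimes e_{p,q}\otimes1^{\otimes(i-1)},\qquad \xi^i_{p,q}\mapsto1^{\otimes(l-i)}\otimes f_{p,q}\otimes1^{\otimes(i-1)}.$$ (b) Let $\Delta^{op}_l:Y(Q(N))\to Y(Q(N))^{\otimes l}$ be the iteration of $\Delta^{op}$, obtained by starting with the identity $\Delta_1^{op}$ and applying $\Delta^{op}$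 to the last tensor factor $l-1$ times. Under the identification $U(\mathfrak g_0)\cong U(Q(N))^{\otimes l}$ of (a), for all $1\le p,q\le N$ and $r\ge1$, $$U^{\otimes l}\circ\Delta_l^{op}(T^{(r)}_{q,p})=(-1)^r\,[S^{(r)}_{p,q}]_{even},\qquad U^{\otimes l}\circ\Delta_l^{op}(T^{(r)}_{-q,p})=(-1)^r\,[S^{(r)}_{p,q}]_{odd},$$ where $[\cdot]_{even}$ and $[\cdot]_{odd}$ are the even and odd components and $$S^{(r)}_{p,q}=\sum_{1\le p_1,\dots,p_{r-1}\le N}\ \sum_{l\ge i_1\ge i_2\ge\dots\ge i_r\ge1}\big(x^{i_1}_{p,p_1}+(-1)^{r+1}\xi^{i_1}_{p,p_1}\big)\big(x^{i_2}_{p_1,p_2}+(-1)^{r}\xi^{i_2}_{p_1,p_2}\big)\cdots\big(x^{i_r}_{p_{r-1},q}+\xi^{i_r}_{p_{r-1},q}\big).$$ -/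

import Mathlib

open scoped TensorProduct

noncomputable section

namespace QueerYangian

/-! ## Superalgebras over `ℂ` -/

/-- The sign `(-1)^a` for `a ∈ ℤ/2`. -/
def sgn (a : ZMod 2) : ℂ := (-1) ^ a.val

theorem sgn_zero : sgn 0 = 1 := by simp [sgn]

theorem sgn_one : sgn 1 = -1 := by simp [sgn, ZMod.val_one]

theorem zmod2_cases (a : ZMod 2) : a = 0 ∨ a = 1 := by
  revert a; decide

theorem sgn_add (a b : ZMod 2) : sgn (a + b) = sgn a * sgn b := by
  rcases zmod2_cases a with rfl | rfl <;> rcases zmod2_cases b with rfl | rfl <;>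
    simp [sgn_zero, sgn_one, show (1 + 1 : ZMod 2) = 0 from rfl]

theorem sgn_mul_self (a : ZMod 2) : sgn a * sgn a = 1 := by
  rcases zmod2_cases a with rfl | rfl <;> simp [sgn_zero, sgn_one]

/-- An associative unital superalgebra over `ℂ`.  The `ℤ/2`-grading is recorded by its parity
automorphism, which is `+1` on the even part and `-1` on the odd part; since `2` is invertible,
`ℤ/2`-gradings of a `ℂ`-algebra and involutive algebra automorphisms are the same thing. -/
structure SuperAlgebra where
  /-- the underlying algebra -/
  carrier : Type
  [ring : Ring carrier]
  [algebra : Algebra ℂ carrier]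
  /-- the parity automorphism -/
  parity : carrier →ₐ[ℂ] carrier
  parity_parity : ∀ x, parity (parity x) = x

instance : CoeSort SuperAlgebra Type := ⟨SuperAlgebra.carrier⟩

attribute [instance] SuperAlgebra.ring SuperAlgebra.algebra

namespace SuperAlgebra

variable (A B : SuperAlgebra)

/-- The component of parity `a` of a superalgebra. -/
def grading (a : ZMod 2) : Submodule ℂ A where
  carrier := {x | A.parity x = sgn a • x}
  add_mem' := by
    intro x y hx hy
    simp only [Set.mem_ofPred_eq] at hx hy ⊢
    rw [map_add, hx, hy, smul_add]
  zero_mem' := by simp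
  smul_mem' := by
    intro c x hx
    simp only [Set.mem_ofPred_eq] at hx ⊢
    rw [map_smul, hx, smul_comm]

variable {A} in
theorem mem_grading {a : ZMod 2} {x : A} : x ∈ A.grading a ↔ A.parity x = sgn a • x := Iff.rfl

variable {A} in
/-- The even part of an element. -/
def evenPart (x : A) : A := (2⁻¹ : ℂ) • (x + A.parity x)

variable {A} in
/-- The odd part of an element. -/
def oddPart (x : A) : A := (2⁻¹ : ℂ) • (x - A.parity x)

theorem evenPart_mem (x : A) : evenPart x ∈ A.grading 0 := by
  rw [mem_grading, sgn_zero, one_smul, evenPart, map_smul, map_add, A.parity_parity, add_comm]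

theorem oddPart_mem (x : A) : oddPart x ∈ A.grading 1 := by
  rw [mem_grading, sgn_one, oddPart, map_smul, map_sub, A.parity_parity]
  module

theorem evenPart_add_oddPart (x : A) : evenPart x + oddPart x = x := by
  rw [evenPart, oddPart]
  module

/-- The decomposition of an element into its even and odd parts. -/
def decomposeAux : A →ₗ[ℂ] DirectSum (ZMod 2) fun a => A.grading a where
  toFun x := DirectSum.of (fun a => A.grading a) 0 ⟨evenPart x, A.evenPart_mem x⟩ +
    DirectSum.of (fun a => A.grading a) 1 ⟨oddPart x, A.oddPart_mem x⟩
  map_add' x y := by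
    have h0 : (⟨evenPart (x + y), A.evenPart_mem _⟩ : A.grading 0) =
        ⟨evenPart x, A.evenPart_mem x⟩ + ⟨evenPart y, A.evenPart_mem y⟩ := by
      apply Subtype.ext
      simp only [evenPart, map_add, Submodule.coe_add]
      module
    have h1 : (⟨oddPart (x + y), A.oddPart_mem _⟩ : A.grading 1) =
        ⟨oddPart x, A.oddPart_mem x⟩ + ⟨oddPart y, A.oddPart_mem y⟩ := by
      apply Subtype.ext
      simp only [oddPart, map_add, Submodule.coe_add]
      module
    rw [h0, h1, map_add, map_add]
    abel
  map_smul' c x := by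
    have h0 : (⟨evenPart (c • x), A.evenPart_mem _⟩ : A.grading 0) =
        c • ⟨evenPart x, A.evenPart_mem x⟩ := by
      apply Subtype.ext
      simp only [evenPart, map_smul, Submodule.coe_smul]
      module
    have h1 : (⟨oddPart (c • x), A.oddPart_mem _⟩ : A.grading 1) =
        c • ⟨oddPart x, A.oddPart_mem x⟩ := by
      apply Subtype.ext
      simp only [oddPart, map_smul, Submodule.coe_smul]
      module
    rw [h0, h1]
    simp only [← DirectSum.lof_eq_of ℂ, map_smul, smul_add, RingHom.id_apply]

instance gradedAlgebra : GradedAlgebra A.grading where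
  one_mem := by rw [mem_grading, map_one, sgn_zero, one_smul]
  mul_mem := by
    intro a b x y hx hy
    rw [mem_grading] at hx hy ⊢
    rw [map_mul, hx, hy, sgn_add, smul_mul_smul_comm]
  toDecomposition := DirectSum.Decomposition.ofLinearMap A.grading A.decomposeAux
    (by
      apply LinearMap.ext
      intro x
      simp only [decomposeAux, LinearMap.comp_apply, LinearMap.coe_mk, AddHom.coe_mk, map_add,
        DirectSum.coeLinearMap_of, LinearMap.id_apply]
      exact A.evenPart_add_oddPart x)
    (by
      apply DirectSum.linearMap_ext
      intro a
      apply LinearMap.ext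
      rintro ⟨x, hx⟩
      rw [mem_grading] at hx
      simp only [decomposeAux, LinearMap.comp_apply, LinearMap.coe_mk, AddHom.coe_mk,
        DirectSum.lof_eq_of, DirectSum.coeLinearMap_of, LinearMap.id_apply]
      rcases zmod2_cases a with rfl | rfl
      · have h0 : (⟨evenPart x, A.evenPart_mem x⟩ : A.grading 0) = ⟨x, hx⟩ := by
          apply Subtype.ext
          simp only [evenPart, hx, sgn_zero]
          module
        have h1 : (⟨oddPart x, A.oddPart_mem x⟩ : A.grading 1) = 0 := by
          apply Subtype.ext
          simp [oddPart, hx, sgn_zero]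
        rw [h0, h1, map_zero, add_zero]
      · have h0 : (⟨evenPart x, A.evenPart_mem x⟩ : A.grading 0) = 0 := by
          apply Subtype.ext
          simp [evenPart, hx, sgn_one]
        have h1 : (⟨oddPart x, A.oddPart_mem x⟩ : A.grading 1) = ⟨x, hx⟩ := by
          apply Subtype.ext
          simp only [oddPart, hx, sgn_one]
          module
        rw [h0, h1, map_zero, zero_add])

/-- Homomorphisms of superalgebras: parity-preserving algebra homomorphisms. -/
structure Hom where
  /-- the underlying algebra homomorphism -/
  toAlgHom : A →ₐ[ℂ] B
  map_parity : ∀ x, toAlgHom (A.parity x) = B.parity (toAlgHom x)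

variable {A B} in
instance : CoeFun (Hom A B) fun _ => A → B := ⟨fun f => f.toAlgHom⟩

variable {A B} in
theorem Hom.map_mem (f : Hom A B) {a : ZMod 2} {x : A} (hx : x ∈ A.grading a) :
    f x ∈ B.grading a := by
  rw [mem_grading] at hx ⊢
  rw [← f.map_parity, hx, map_smul]

/-- The identity homomorphism. -/
def Hom.id : Hom A A := ⟨AlgHom.id ℂ A, fun _ => rfl⟩

variable {A B} in
/-- Composition of homomorphisms. -/
def Hom.comp {C : SuperAlgebra} (g : Hom B C) (f : Hom A B) : Hom A C :=
  ⟨g.toAlgHom.comp f.toAlgHom, fun x => by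
    simp only [AlgHom.comp_apply, f.map_parity, g.map_parity]⟩

/-! ### Tensor products of superalgebras -/

/-- The carrier of the tensor product of superalgebras, with the multiplication
`(a ⊗ b)(a' ⊗ b') = (-1)^{p(b)p(a')} aa' ⊗ bb'`. -/
abbrev TensorCarrier : Type := GradedTensorProduct ℂ A.grading B.grading

theorem include_anticomm {a b : ZMod 2} (x : A) (hx : x ∈ A.grading a) (y : B)
    (hy : y ∈ B.grading b) :
    (GradedTensorProduct.includeLeft A.grading B.grading x : TensorCarrier A B) *
        GradedTensorProduct.includeRight A.grading B.grading y =
      (-1 : ℤˣ) ^ (b * a) • ((GradedTensorProduct.includeRight A.grading B.grading y :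
        TensorCarrier A B) * GradedTensorProduct.includeLeft A.grading B.grading x) := by
  have h := GradedTensorProduct.tmul_coe_mul_coe_tmul A.grading B.grading (1 : A) ⟨y, hy⟩
    ⟨x, hx⟩ (1 : B)
  have h2 := GradedTensorProduct.tmul_one_mul_one_tmul A.grading B.grading x y
  simp only [one_mul, mul_one] at h
  change (GradedTensorProduct.tmul ℂ x 1 : TensorCarrier A B) * GradedTensorProduct.tmul ℂ 1 y =
      (-1 : ℤˣ) ^ (b * a) • ((GradedTensorProduct.tmul ℂ 1 y : TensorCarrier A B) *
        GradedTensorProduct.tmul ℂ x 1)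
  rw [h, h2, smul_smul, Int.units_mul_self, one_smul]


variable {A B} in
/-- The tensor product `f ⊗ g` of two homomorphisms of superalgebras, as an algebra
homomorphism. -/
def mapAux {A' B' : SuperAlgebra} (f : Hom A A') (g : Hom B B') :
    TensorCarrier A B →ₐ[ℂ] TensorCarrier A' B' :=
  GradedTensorProduct.lift A.grading B.grading
    ((GradedTensorProduct.includeLeft A'.grading B'.grading).comp f.toAlgHom)
    ((GradedTensorProduct.includeRight A'.grading B'.grading).comp g.toAlgHom)
    (by
      intro _ _ x y
      exact include_anticomm A' B' _ (f.map_mem x.2) _ (g.map_mem y.2))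

variable {A B} in
theorem mapAux_tmul {A' B' : SuperAlgebra} (f : Hom A A') (g : Hom B B') (a : A) (b : B) :
    mapAux f g (GradedTensorProduct.tmul ℂ a b) = GradedTensorProduct.tmul ℂ (f a) (g b) :=
  GradedTensorProduct.tmul_one_mul_one_tmul A'.grading B'.grading (f a) (g b)

/-- The parity automorphism, as a homomorphism of superalgebras. -/
def parityHom : Hom A A := ⟨A.parity, fun _ => rfl⟩

/-- The parity automorphism of the tensor product, `a ⊗ b ↦ p(a) ⊗ p(b)`. -/
def tensorParity : TensorCarrier A B →ₐ[ℂ] TensorCarrier A B :=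
  mapAux (parityHom A) (parityHom B)

theorem tensorParity_tmul (a : A) (b : B) :
    tensorParity A B (GradedTensorProduct.tmul ℂ a b) =
      GradedTensorProduct.tmul ℂ (A.parity a) (B.parity b) :=
  mapAux_tmul _ _ a b

variable {A B} in
theorem tensor_induction {P : TensorCarrier A B → Prop} (x : TensorCarrier A B) (h0 : P 0)
    (ht : ∀ a b, P (GradedTensorProduct.tmul ℂ a b)) (ha : ∀ x y, P x → P y → P (x + y)) : P x :=
  TensorProduct.induction_on (motive := fun z => P (GradedTensorProduct.of ℂ A.grading B.grading z))
    x h0 ht (fun x y hx hy => ha _ _ hx hy)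

/-- The tensor product of two superalgebras. -/
def tensor : SuperAlgebra where
  carrier := TensorCarrier A B
  parity := tensorParity A B
  parity_parity x := by
    induction x using tensor_induction with
    | h0 => simp
    | ht a b => rw [tensorParity_tmul, tensorParity_tmul, A.parity_parity, B.parity_parity]
    | ha x y hx hy => rw [map_add, map_add, hx, hy]

variable {A B} in
/-- The pure tensor `a ⊗ b`. -/
def tmul (a : A) (b : B) : tensor A B :=
  (GradedTensorProduct.tmul ℂ a b : TensorCarrier A B)

/-- The homomorphism `a ↦ a ⊗ 1`. -/
def inclLeft : Hom A (tensor A B) where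
  toAlgHom := GradedTensorProduct.includeLeft A.grading B.grading
  map_parity x := by
    have h := tensorParity_tmul A B x 1
    rw [map_one] at h
    exact h.symm

/-- The homomorphism `b ↦ 1 ⊗ b`. -/
def inclRight : Hom B (tensor A B) where
  toAlgHom := GradedTensorProduct.includeRight A.grading B.grading
  map_parity x := by
    have h := tensorParity_tmul A B 1 x
    rw [map_one] at h
    exact h.symm

variable {A B} in
/-- The tensor product `f ⊗ g` of two homomorphisms of superalgebras, `a ⊗ b ↦ f(a) ⊗ g(b)`. -/
def map {A' B' : SuperAlgebra} (f : Hom A A') (g : Hom B B') :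
    Hom (tensor A B) (tensor A' B') where
  toAlgHom := mapAux f g
  map_parity x := by
    change mapAux f g (tensorParity A B x) = tensorParity A' B' (mapAux f g x)
    induction x using tensor_induction with
    | h0 => simp
    | ht a b =>
      rw [tensorParity_tmul, mapAux_tmul, mapAux_tmul, tensorParity_tmul, f.map_parity,
        g.map_parity]
    | ha x y hx hy => rw [map_add, map_add, map_add, map_add, hx, hy]

/-- The tensor power `A^{⊗(m+1)} = A ⊗ (A ⊗ (⋯ ⊗ A))`, with `m + 1 ≥ 1` factors. -/
def tensorPow : ℕ → SuperAlgebra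
  | 0 => A
  | m + 1 => tensor A (tensorPow m)

/-- The embedding `a ↦ 1^{⊗ j} ⊗ a ⊗ 1^{⊗ (m - j)}` of `A` into `A^{⊗(m+1)}` as the factor with
index `j ∈ {0, …, m}`. -/
def factor : (m : ℕ) → Fin (m + 1) → Hom A (tensorPow A m)
  | 0, _ => Hom.id A
  | m + 1, j => Fin.cases (inclLeft A (tensorPow A m))
      (fun j' => (inclRight A (tensorPow A m)).comp (factor m j')) j

variable {A B} in
/-- The homomorphism `f^{⊗(m+1)}`. -/
def mapPow (f : Hom A B) : (m : ℕ) → Hom (tensorPow A m) (tensorPow B m)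
  | 0 => f
  | m + 1 => map f (mapPow f m)

variable {A} in
/-- The iteration `Δ_{m+1} = Δ_{m,m+1} ∘ ⋯ ∘ Δ_{2,3} ∘ Δ : A → A^{⊗(m+1)}` of a homomorphism
`Δ : A → A ⊗ A`; it applies `Δ` to the last tensor factor again and again, and `Δ_1 = id`. -/
def iterate (Δ : Hom A (tensor A A)) : (m : ℕ) → Hom A (tensorPow A m)
  | 0 => Hom.id A
  | m + 1 => (map (Hom.id A) (iterate Δ m)).comp Δ

/-! ### Lie superalgebras inside associative superalgebras, enveloping superalgebras -/

/-- A Lie sub-superalgebra of an associative superalgebra, the bracket being the supercommutator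
`[x, y] = xy - (-1)^{p(x)p(y)} yx` of homogeneous elements. -/
structure LieSub where
  /-- the underlying subspace -/
  toSubmodule : Submodule ℂ A
  parity_mem : ∀ x ∈ toSubmodule, A.parity x ∈ toSubmodule
  bracket_mem : ∀ (a b : ZMod 2) (x y : A), x ∈ toSubmodule → y ∈ toSubmodule →
    x ∈ A.grading a → y ∈ A.grading b → x * y - sgn (a * b) • (y * x) ∈ toSubmodule

variable {A} in
/-- The defining relations of the universal enveloping superalgebra:
`x y - (-1)^{p(x)p(y)} y x = [x, y]` for homogeneous `x`, `y`. -/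
inductive EnvRel (L : LieSub A) :
    TensorAlgebra ℂ L.toSubmodule → TensorAlgebra ℂ L.toSubmodule → Prop
  | bracket (a b : ZMod 2) (x y z : L.toSubmodule) (hx : (x : A) ∈ A.grading a)
      (hy : (y : A) ∈ A.grading b) (hz : (z : A) = (x : A) * y - sgn (a * b) • ((y : A) * x)) :
      EnvRel L (TensorAlgebra.ι ℂ x * TensorAlgebra.ι ℂ y -
        sgn (a * b) • (TensorAlgebra.ι ℂ y * TensorAlgebra.ι ℂ x)) (TensorAlgebra.ι ℂ z)

variable {A} in
/-- The parity automorphism of a Lie sub-superalgebra. -/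
def LieSub.parity (L : LieSub A) : L.toSubmodule →ₗ[ℂ] L.toSubmodule :=
  A.parity.toLinearMap.restrict L.parity_mem

variable {A} in
/-- The parity automorphism of the enveloping superalgebra. -/
def envParity (L : LieSub A) : RingQuot (EnvRel L) →ₐ[ℂ] RingQuot (EnvRel L) :=
  RingQuot.liftAlgHom ℂ ⟨TensorAlgebra.lift ℂ
    ((RingQuot.mkAlgHom ℂ (EnvRel L)).toLinearMap ∘ₗ TensorAlgebra.ι ℂ ∘ₗ L.parity), by
      intro u v h
      obtain ⟨a, b, x, y, z, hx, hy, hz⟩ := h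
      have key := RingQuot.mkAlgHom_rel ℂ (EnvRel.bracket (L := L) a b x y z hx hy hz)
      have ex : L.parity x = sgn a • x := Subtype.ext (mem_grading.mp hx)
      have ey : L.parity y = sgn b • y := Subtype.ext (mem_grading.mp hy)
      have ez : L.parity z = (sgn a * sgn b) • z := by
        apply Subtype.ext
        change A.parity z = (sgn a * sgn b) • (z : A)
        rw [hz, map_sub, map_smul, map_mul, map_mul, mem_grading.mp hx, mem_grading.mp hy,
          smul_mul_smul_comm, smul_mul_smul_comm, smul_sub, mul_comm (sgn b), smul_comm]
      simp only [map_sub, map_smul, map_mul, TensorAlgebra.lift_ι_apply, LinearMap.comp_apply,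
        AlgHom.toLinearMap_apply, ex, ey, ez] at key ⊢
      rw [← key, smul_mul_smul_comm, smul_mul_smul_comm, smul_sub, mul_comm (sgn b),
        smul_comm (sgn (a * b))]⟩

variable {A} in
/-- The universal enveloping superalgebra of a Lie superalgebra. -/
def envelope (L : LieSub A) : SuperAlgebra where
  carrier := RingQuot (EnvRel L)
  parity := envParity L
  parity_parity x := by
    have h : (envParity L).comp (envParity L) = AlgHom.id ℂ _ := by
      apply RingQuot.ringQuot_ext'
      apply TensorAlgebra.hom_ext
      apply LinearMap.ext
      intro x
      have e : L.parity (L.parity x) = x := Subtype.ext (A.parity_parity x)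
      simp [envParity, e]
    exact DFunLike.congr_fun h x

variable {A} in
/-- The canonical map from a Lie superalgebra to its enveloping superalgebra. -/
def envι (L : LieSub A) : L.toSubmodule →ₗ[ℂ] envelope L :=
  (RingQuot.mkAlgHom ℂ (EnvRel L)).toLinearMap ∘ₗ TensorAlgebra.ι ℂ

end SuperAlgebra

open SuperAlgebra

/-! ## The queer Lie superalgebra -/

section Queer

variable (I : Type) [Fintype I] [DecidableEq I]

/-- The associative superalgebra `Mat(I|I)` of block matrices `(A B; C D)`, with `A`, `D` even and
`B`, `C` odd. -/
def matSuper : SuperAlgebra where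
  carrier := Matrix (I ⊕ I) (I ⊕ I) ℂ
  parity := AlgHom.ofLinearMap
    { toFun := fun X => Matrix.fromBlocks X.toBlocks₁₁ (-X.toBlocks₁₂) (-X.toBlocks₂₁) X.toBlocks₂₂
      map_add' := by
        intro X Y
        ext (i | i) (j | j) <;>
          simp [Matrix.toBlocks₁₁, Matrix.toBlocks₁₂, Matrix.toBlocks₂₁, Matrix.toBlocks₂₂] <;> ring
      map_smul' := by
        intro c X
        ext (i | i) (j | j) <;>
          simp [Matrix.toBlocks₁₁, Matrix.toBlocks₁₂, Matrix.toBlocks₂₁, Matrix.toBlocks₂₂] }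
    (by
      ext (i | i) (j | j) <;>
        simp [Matrix.toBlocks₁₁, Matrix.toBlocks₁₂, Matrix.toBlocks₂₁, Matrix.toBlocks₂₂,
          Matrix.one_apply])
    (by
      intro X Y
      ext (i | i) (j | j) <;>
        simp [Matrix.toBlocks₁₁, Matrix.toBlocks₁₂, Matrix.toBlocks₂₁, Matrix.toBlocks₂₂,
          Matrix.mul_apply, Finset.sum_neg_distrib] <;> ring)
  parity_parity X := by
    ext (i | i) (j | j) <;>
      simp [Matrix.toBlocks₁₁, Matrix.toBlocks₁₂, Matrix.toBlocks₂₁, Matrix.toBlocks₂₂]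

variable {I} in
/-- The matrix `(A B; B A)`. -/
def qMat (A B : Matrix I I ℂ) : matSuper I :=
  (Matrix.fromBlocks A B B A : Matrix (I ⊕ I) (I ⊕ I) ℂ)

theorem parity_qMat (A B : Matrix I I ℂ) : (matSuper I).parity (qMat A B) = qMat A (-B) := rfl

theorem qMat_mul (A B C D : Matrix I I ℂ) :
    qMat A B * qMat C D = qMat (A * C + B * D) (A * D + B * C) := by
  change (Matrix.fromBlocks A B B A : Matrix (I ⊕ I) (I ⊕ I) ℂ) * Matrix.fromBlocks C D D C =
    Matrix.fromBlocks _ _ _ _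
  rw [Matrix.fromBlocks_multiply, add_comm (B * C), add_comm (B * D)]

/-- The space of matrices `(A B; B A)`. -/
def queerSubmodule : Submodule ℂ (matSuper I) where
  carrier := {X | ∃ A B : Matrix I I ℂ, X = qMat A B}
  add_mem' := by
    rintro _ _ ⟨A, B, rfl⟩ ⟨C, D, rfl⟩
    exact ⟨A + C, B + D, Matrix.fromBlocks_add A B B A C D D C⟩
  zero_mem' := ⟨0, 0, Matrix.fromBlocks_zero.symm⟩
  smul_mem' := by
    rintro c _ ⟨A, B, rfl⟩
    exact ⟨c • A, c • B, Matrix.fromBlocks_smul c A B B A⟩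

theorem queerSubmodule_mul_mem {X Y : matSuper I} (hX : X ∈ queerSubmodule I)
    (hY : Y ∈ queerSubmodule I) : X * Y ∈ queerSubmodule I := by
  obtain ⟨A, B, rfl⟩ := hX
  obtain ⟨C, D, rfl⟩ := hY
  exact ⟨_, _, qMat_mul I A B C D⟩

/-- The queer Lie superalgebra `Q(I)`; for `I = Fin n` this is `Q(n)`. -/
def queer : LieSub (matSuper I) where
  toSubmodule := queerSubmodule I
  parity_mem := by
    rintro _ ⟨A, B, rfl⟩
    exact ⟨A, -B, rfl⟩
  bracket_mem _ _ _ _ hx hy _ _ :=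
    Submodule.sub_mem _ (queerSubmodule_mul_mem I hx hy)
      (Submodule.smul_mem _ _ (queerSubmodule_mul_mem I hy hx))

variable {I}

/-- The basis element `e_{i,j}` of `Q(I)`, as a matrix. -/
def eMat (i j : I) : matSuper I := qMat (Matrix.single i j 1) 0

/-- The basis element `f_{i,j}` of `Q(I)`, as a matrix. -/
def fMat (i j : I) : matSuper I := qMat 0 (Matrix.single i j 1)

/-- The element `e_{i,j}` of `U(Q(I))`. -/
def e (i j : I) : envelope (queer I) := envι (queer I) ⟨eMat i j, _, _, rfl⟩

/-- The element `f_{i,j}` of `U(Q(I))`. -/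
def f (i j : I) : envelope (queer I) := envι (queer I) ⟨fMat i j, _, _, rfl⟩

/-- Sergeev's elements `(e_{i,j}^{(m)}, f_{i,j}^{(m)})` of `U(Q(I))`. -/
def sergeev : ℕ → I → I → envelope (queer I) × envelope (queer I)
  | 0, i, j => (if i = j then 1 else 0, 0)
  | m + 1, i, j =>
    (∑ k, e i k * (sergeev m k j).1 + (-1 : ℂ) ^ (m + 2) • ∑ k, f i k * (sergeev m k j).2,
     ∑ k, e i k * (sergeev m k j).2 + (-1 : ℂ) ^ (m + 2) • ∑ k, f i k * (sergeev m k j).1)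

end Queer

/-! ## The Levi subalgebra of the Dynkin grading -/

section Levi

variable (N l : ℕ)

/-- The position `l(p-1)+i` in `{1, …, Nl}` of `p ∈ {1, …, N}` and `i ∈ {1, …, l}`; here all
indices are counted from `0`. -/
def pos (p : Fin N) (i : Fin l) : Fin (N * l) := finProdFinEquiv (p, i)

/-- The diagonal matrix `h = ∑_{p,i} (l - 2i + 1) e_{l(p-1)+i, l(p-1)+i}`, whose adjoint action
defines the Dynkin grading; below, the index `i` of a position is counted from `0`. -/
def dynkinH : matSuper (Fin (N * l)) :=
  qMat (Matrix.diagonal fun a =>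
    (l : ℂ) - 2 * (((finProdFinEquiv.symm a).2 : ℕ) + 1) + 1) 0

/-- The degree zero part `g_0 = {X ∈ Q(Nl) | [h, X] = 0}` of `Q(Nl)`. -/
def levi : LieSub (matSuper (Fin (N * l))) where
  toSubmodule :=
    { carrier := {X | X ∈ queerSubmodule (Fin (N * l)) ∧ dynkinH N l * X = X * dynkinH N l}
      add_mem' := by
        rintro X Y ⟨hX, hX'⟩ ⟨hY, hY'⟩
        exact ⟨add_mem hX hY, by rw [mul_add, add_mul, hX', hY']⟩
      zero_mem' := ⟨zero_mem _, by rw [mul_zero, zero_mul]⟩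
      smul_mem' := by
        rintro c X ⟨hX, hX'⟩
        exact ⟨Submodule.smul_mem _ c hX, by rw [mul_smul_comm, smul_mul_assoc, hX']⟩ }
  parity_mem := by
    rintro X ⟨hX, hX'⟩
    refine ⟨(queer _).parity_mem X hX, ?_⟩
    have hh : (matSuper (Fin (N * l))).parity (dynkinH N l) = dynkinH N l := by
      simp only [dynkinH, parity_qMat, neg_zero]
    have := congrArg (matSuper (Fin (N * l))).parity hX'
    rwa [map_mul, map_mul, hh] at this
  bracket_mem a b X Y hX hY hXa hYb := by
    obtain ⟨hX, hX'⟩ := hX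
    obtain ⟨hY, hY'⟩ := hY
    have hc : Commute (dynkinH N l) X := hX'
    have hd : Commute (dynkinH N l) Y := hY'
    refine ⟨(queer _).bracket_mem a b X Y hX hY hXa hYb, ?_⟩
    exact (hc.mul_right hd).sub_right ((hd.mul_right hc).smul_right _)

variable {N l}

theorem diagonal_mul_single (p q : Fin N) (i : Fin l) :
    Matrix.diagonal (fun a : Fin (N * l) =>
        (l : ℂ) - 2 * (((finProdFinEquiv.symm a).2 : ℕ) + 1) + 1) *
          Matrix.single (pos N l p i) (pos N l q i) 1 =
      Matrix.single (pos N l p i) (pos N l q i) 1 * Matrix.diagonal (fun a : Fin (N * l) =>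
        (l : ℂ) - 2 * (((finProdFinEquiv.symm a).2 : ℕ) + 1) + 1) := by
  ext a b
  rw [Matrix.diagonal_mul, Matrix.mul_diagonal, Matrix.single_apply]
  split_ifs with h
  · obtain ⟨rfl, rfl⟩ := h
    simp [pos]
  · simp

/-- The element `x^i_{p,q} = e_{l(p-1)+i, l(q-1)+i}` of `U(g_0)`. -/
def x (i : Fin l) (p q : Fin N) : envelope (levi N l) :=
  envι (levi N l) ⟨eMat (pos N l p i) (pos N l q i), ⟨_, _, rfl⟩, by
    rw [dynkinH, eMat, qMat_mul, qMat_mul, diagonal_mul_single]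
    simp⟩

/-- The element `ξ^i_{p,q} = (-1)^{i+1} f_{l(p-1)+i, l(q-1)+i}` of `U(g_0)`, where `i` is counted
from `1`; the index of type `Fin l` is counted from `0`. -/
def ξ (i : Fin l) (p q : Fin N) : envelope (levi N l) :=
  (-1 : ℂ) ^ (((i : ℕ) + 1) + 1) •
    envι (levi N l) ⟨fMat (pos N l p i) (pos N l q i), ⟨_, _, rfl⟩, by
      rw [dynkinH, fMat, qMat_mul, qMat_mul, diagonal_mul_single]
      simp⟩

/-- The sum, over `p_1, …, p_{r-1} ∈ {1, …, N}` and `l ≥ i_1 ≥ ⋯ ≥ i_r ≥ 1`, of the ordered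
products
`(x^{i_1}_{p,p_1} + (-1)^{r+1} ξ^{i_1}_{p,p_1}) (x^{i_2}_{p_1,p_2} + (-1)^r ξ^{i_2}_{p_1,p_2}) ⋯
(x^{i_r}_{p_{r-1},q} + ξ^{i_r}_{p_{r-1},q})`; the sum over `P` runs over the sequences
`p = p_0, p_1, …, p_r = q`. -/
def orderedSum (r : ℕ) (p q : Fin N) : envelope (levi N l) :=
  ∑ P : Fin (r + 1) → Fin N with P 0 = p ∧ P (Fin.last r) = q,
    ∑ i : Fin r → Fin l with ∀ s t, s ≤ t → i t ≤ i s,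
      (List.ofFn fun t : Fin r =>
        x (i t) (P t.castSucc) (P t.succ) +
          (-1 : ℂ) ^ (r + 1 - (t : ℕ)) • ξ (i t) (P t.castSucc) (P t.succ)).prod

end Levi

/-! ## The super-Yangian -/

section Yangian

variable (N : ℕ)

/-- The index set `{±1, …, ±N}`; `Sum.inl i` stands for `i` and `Sum.inr i` for `-i`. -/
abbrev SignedIndex : Type := Fin N ⊕ Fin N

variable {N}

/-- The index `-i`. -/
def neg (i : SignedIndex N) : SignedIndex N := i.swap

/-- The parity of an index: `0` for a positive and `1` for a negative index. -/
def par : SignedIndex N → ZMod 2 := Sum.elim (fun _ => 0) (fun _ => 1)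

theorem par_neg (i : SignedIndex N) : par (neg i) = par i + 1 := by
  rcases i with i | i <;> simp [par, neg, show (1 + 1 : ZMod 2) = 0 from rfl]

variable (N) in
/-- The free algebra on symbols `T_{i,j}^{(m)}`, `m ≥ 1`; the generator with label `(m, i, j)`
stands for `T_{i,j}^{(m+1)}`. -/
abbrev FreeYangian : Type := FreeAlgebra ℂ (ℕ × SignedIndex N × SignedIndex N)

/-- The symbols `T_{i,j}^{(m)}` for all integers `m`: `T_{i,j}^{(0)} = δ_{i,j}`, and
`T_{i,j}^{(m)} = 0` for `m < 0`. -/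
def freeT : ℤ → SignedIndex N → SignedIndex N → FreeYangian N
  | .negSucc _, _, _ => 0
  | .ofNat 0, i, j => if i = j then 1 else 0
  | .ofNat (m + 1), i, j => FreeAlgebra.ι ℂ (m, i, j)

/-- The supercommutator `[T_{i,j}^{(a)}, T_{k,l}^{(b)}]`. -/
def freeBracket (a : ℤ) (i j : SignedIndex N) (b : ℤ) (k l : SignedIndex N) : FreeYangian N :=
  freeT a i j * freeT b k l -
    sgn ((par i + par j) * (par k + par l)) • (freeT b k l * freeT a i j)

/-- The defining relations of the super-Yangian.  The relation `rtt m r i j k l` is the equality of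
the coefficients of `u^{1-m} v^{1-r}` in
`(u² - v²) [T_{i,j}(u), T_{k,l}(v)] (-1)^{p(i)p(k) + p(i)p(l) + p(k)p(l)}
  = (u + v) (T_{k,j}(u) T_{i,l}(v) - T_{k,j}(v) T_{i,l}(u))
  - (u - v) (T_{-k,j}(u) T_{-i,l}(v) - T_{k,-j}(v) T_{i,-l}(u)) (-1)^{p(k) + p(l)}`,
where `T_{i,j}(u) = ∑_{m ≥ 0} T_{i,j}^{(m)} u^{-m}`; it is imposed for all integers `m`, `r`.
The relation `symm m i j` is the equality of the coefficients of `u^{-m}` in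
`T_{-i,-j}(u) = T_{i,j}(-u)`. -/
inductive YangianRel : FreeYangian N → FreeYangian N → Prop
  | rtt (m r : ℤ) (i j k l : SignedIndex N) :
    YangianRel
      (sgn (par i * par k + par i * par l + par k * par l) •
        (freeBracket (m + 1) i j (r - 1) k l - freeBracket (m - 1) i j (r + 1) k l))
      (freeT m k j * freeT (r - 1) i l + freeT (m - 1) k j * freeT r i l
        - freeT (r - 1) k j * freeT m i l - freeT r k j * freeT (m - 1) i l
        + sgn (par k + par l) •
          (-(freeT m (neg k) j * freeT (r - 1) (neg i) l)
            + freeT (m - 1) (neg k) j * freeT r (neg i) l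
            + freeT (r - 1) k (neg j) * freeT m i (neg l)
            - freeT r k (neg j) * freeT (m - 1) i (neg l)))
  | symm (m : ℕ) (i j : SignedIndex N) :
    YangianRel (freeT m (neg i) (neg j)) ((-1 : ℂ) ^ m • freeT m i j)

/-- The parity automorphism of the free algebra. -/
def freeParity : FreeYangian N →ₐ[ℂ] FreeYangian N :=
  FreeAlgebra.lift ℂ fun g => sgn (par g.2.1 + par g.2.2) • FreeAlgebra.ι ℂ g

theorem freeParity_freeT (m : ℤ) (i j : SignedIndex N) :
    freeParity (freeT m i j) = sgn (par i + par j) • freeT m i j := by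
  rcases m with (_ | m) | m
  · by_cases h : i = j
    · subst h
      simp [freeT, sgn_add, sgn_mul_self]
    · simp [freeT, h]
  · simp [freeT, freeParity]
  · simp [freeT]

theorem freeParity_mul (a b : ℤ) (i j k l : SignedIndex N) (s : ℂ)
    (h : sgn (par i + par j) * sgn (par k + par l) = s) :
    freeParity (freeT a i j * freeT b k l) = s • (freeT a i j * freeT b k l) := by
  rw [map_mul, freeParity_freeT, freeParity_freeT, smul_mul_smul_comm, h]

theorem freeParity_rel {u v : FreeYangian N} (h : YangianRel u v) :
    ∃ s : ℂ, freeParity u = s • u ∧ freeParity v = s • v := by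
  cases h with
  | rtt m r i j k l =>
    refine ⟨sgn (par i) * sgn (par j) * sgn (par k) * sgn (par l), ?_, ?_⟩
    · simp only [freeBracket, map_smul, map_sub]
      rw [freeParity_mul (m + 1) (r - 1) i j k l _ rfl, freeParity_mul (r - 1) (m + 1) k l i j _ rfl,
        freeParity_mul (m - 1) (r + 1) i j k l _ rfl, freeParity_mul (r + 1) (m - 1) k l i j _ rfl]
      simp only [sgn_add]
      module
    · simp only [map_add, map_sub, map_smul, map_neg]
      simp only [map_mul, freeParity_freeT, smul_mul_smul_comm, sgn_add, par_neg, sgn_one]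
      module
  | symm m i j =>
    refine ⟨sgn (par i + par j), ?_, ?_⟩
    · rw [freeParity_freeT, par_neg, par_neg]
      simp only [sgn_add, sgn_one]
      module
    · rw [map_smul, freeParity_freeT, smul_comm]

/-- The parity automorphism of the super-Yangian. -/
def yangianParity : RingQuot (YangianRel (N := N)) →ₐ[ℂ] RingQuot (YangianRel (N := N)) :=
  RingQuot.liftAlgHom ℂ ⟨(RingQuot.mkAlgHom ℂ YangianRel).comp freeParity, by
    intro u v h
    obtain ⟨s, hu, hv⟩ := freeParity_rel h
    rw [AlgHom.comp_apply, AlgHom.comp_apply, hu, hv, map_smul, map_smul,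
      RingQuot.mkAlgHom_rel ℂ h]⟩

variable (N) in
/-- The super-Yangian `Y(Q(N))`. -/
def yangian : SuperAlgebra where
  carrier := RingQuot (YangianRel (N := N))
  parity := yangianParity
  parity_parity y := by
    have h : (yangianParity (N := N)).comp yangianParity = AlgHom.id ℂ _ := by
      apply RingQuot.ringQuot_ext'
      apply FreeAlgebra.hom_ext
      funext g
      simp [yangianParity, freeParity, smul_smul, sgn_mul_self]
    exact DFunLike.congr_fun h y

/-- The element `T_{i,j}^{(m)}` of the super-Yangian. -/
def T (m : ℤ) (i j : SignedIndex N) : yangian N :=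
  RingQuot.mkAlgHom ℂ YangianRel (freeT m i j)

/-! ## The maps -/

/-- `Δ` is the opposite comultiplication of `Y(Q(N))`:
`Δ^op(T_{i,j}^{(r)}) = ∑_{s=0}^{r} ∑_k T_{k,j}^{(r-s)} ⊗ T_{i,k}^{(s)}`. -/
def IsOppositeComultiplication (Δ : Hom (yangian N) (tensor (yangian N) (yangian N))) : Prop :=
  ∀ (r : ℕ) (i j : SignedIndex N),
    Δ (T r i j) = ∑ s ∈ Finset.range (r + 1), ∑ k : SignedIndex N,
      tmul (T ((r : ℤ) - s) k j) (T s i k)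

/-- `U` is the homomorphism `Y(Q(N)) → U(Q(N))` with `T_{i,j}^{(r)} ↦ (-1)^r e_{j,i}^{(r)}` and
`T_{-i,j}^{(r)} ↦ (-1)^r f_{j,i}^{(r)}` for `i, j > 0` and `r > 0`. -/
def IsSergeevHom (U : Hom (yangian N) (envelope (queer (Fin N)))) : Prop :=
  ∀ (r : ℕ) (i j : Fin N), 0 < r →
    U (T r (Sum.inl i) (Sum.inl j)) = (-1 : ℂ) ^ r • (sergeev r j i).1 ∧
    U (T r (Sum.inr i) (Sum.inl j)) = (-1 : ℂ) ^ r • (sergeev r j i).2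

/-- `Φ` is the identification of the superalgebra `U(g_0)`, for `g_0 ⊆ Q(Nl)` and `l = m + 1`, with
`U(Q(N))^{⊗ l}`:
`x^i_{p,q} ↦ 1^{⊗ l-i} ⊗ e_{p,q} ⊗ 1^{⊗ i-1}` and `ξ^i_{p,q} ↦ 1^{⊗ l-i} ⊗ f_{p,q} ⊗ 1^{⊗ i-1}`. -/
def IsLeviIdentification {m : ℕ}
    (Φ : envelope (levi N (m + 1)) ≃ₐ[ℂ] tensorPow (envelope (queer (Fin N))) m) : Prop :=
  (∀ y, Φ ((envelope (levi N (m + 1))).parity y) =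
    (tensorPow (envelope (queer (Fin N))) m).parity (Φ y)) ∧
  ∀ (i : Fin (m + 1)) (p q : Fin N),
    Φ (x i p q) = factor (envelope (queer (Fin N))) m i.rev (e p q) ∧
    Φ (ξ i p q) = factor (envelope (queer (Fin N))) m i.rev (f p q)

end Yangian

end QueerYangian
end

/-!
Write `T(u)` for the matrix of generating series. With the terms that contain products of entries
of `T(u)` and `T(v)` in this order on one side, and the other terms on the other side, the defining
relations of the super-Yangian say that an operator acting on the row indices of the products `T(u)
T(v)` gives the same as an operator acting on the column indices of the products `T(v) T(u)`; this
is the exchange relation `IsExchange`. In this form the relations are stable under the opposite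
product `∑_a P_{a,j} Q_{i,a}` of two solutions with supercommuting entries: the exchange relation
for `Q` moves the operators from the rows to the summation indices, and the one for `P` moves them
on to the columns (`isExchange_oppositeMul`, and `isRTT_convolution` for the coefficients). Applied
to `T(u) ⊗ 1` and `1 ⊗ T(u)`, this gives the opposite comultiplication.

The images of `T^{(1)}_{i,j}` in `U(Q(N))` form a matrix `M`, up to signs that of the `e_{j,i}` and
`f_{j,i}`, and its powers consist, up to signs, of Sergeev's elements. The supercommutation
relations of the entries of `M` extend to the powers of `M` by the derivation property of the
supercommutator (`firstOrderRelation_oppositePow`), and an induction on the order of the first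
argument then yields the defining relations for the geometric series of `M` (`isRTT_oppositePow`).
This gives the homomorphism `U`.

The eigenvalues of `h` for the `l` different indices `i` are different, so the degree zero part of
`Q(Nl)` consists of block diagonal matrices and is a direct sum of `l` copies of `Q(N)`
(`sum_queerToLevi_leviToQueer`). The sign in `ξ^i_{p,q}` amounts to the `i`-th power of the parity
automorphism on the `i`-th block (for `i` counted from `0`). The universal properties of enveloping
superalgebras and of tensor powers turn this decomposition into the isomorphism `U(g_0) ≅
U(Q(N))^{⊗ l}` (`existsUnique_leviIdentification`).

Finally, `U^{⊗ l} ∘ Δ_l^op` maps `T(u)` to the opposite product of the geometric series of the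
matrices `M` in the `l` tensor factors. Its coefficients are the ordered sums `orderedPow`, for
which a product either starts with a letter of the largest index or does not contain it
(`mapPow_iterate_T`). The sums `S^{(r)}_{p,q}` obey the same recursion: the two summands `x` and
`ξ` of each factor belong to the positive and the negative values of a summation index, and the
alternating signs come from `T_{-i,-j}(u) = T_{i,j}(-u)` (`partialOrderedSum_eq`). Hence
`S^{(r)}_{p,q}` is the sum of the entries corresponding to `T_{q,p}` and `T_{-q,p}`, which have
different parities (`orderedSum_parts`).
-/

noncomputable section

namespace QueerYangian

/-! ### Homomorphisms of superalgebras -/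

theorem negOnePow_smul_eq_sgn_smul {M : Type*} [AddCommGroup M] [Module ℂ M] (a : ZMod 2) (v : M) :
    ((-1 : ℤˣ) ^ a) • v = sgn a • v := by
  rcases zmod2_cases a with rfl | rfl
  · rw [sgn_zero, one_smul, uzpow_zero, one_smul]
  · rw [sgn_one, uzpow_one, Units.neg_smul, one_smul, neg_smul, one_smul]

namespace SuperAlgebra

variable {A B C : SuperAlgebra}

theorem Hom.ext {f g : Hom A B} (h : f.toAlgHom = g.toAlgHom) : f = g := by
  cases f; cases g; cases h; rfl

theorem Hom.comp_apply (g : Hom B C) (f : Hom A B) (x : A) : (g.comp f) x = g (f x) := rfl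

theorem mul_mem_grading {a b : ZMod 2} {x y : A} (hx : x ∈ A.grading a) (hy : y ∈ A.grading b) :
    x * y ∈ A.grading (a + b) := SetLike.GradedMul.mul_mem hx hy

/-- The parity automorphism raised to the power `a`. -/
def twist (A : SuperAlgebra) (a : ZMod 2) : A →ₐ[ℂ] A :=
  if a = 0 then AlgHom.id ℂ A else A.parity

theorem twist_of_mem {a b : ZMod 2} {x : A} (hx : x ∈ A.grading a) :
    A.twist b x = sgn (a * b) • x := by
  rcases zmod2_cases b with rfl | rfl
  · simp [twist, sgn_zero]
  · rw [twist, if_neg (by decide), mul_one, mem_grading.mp hx]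

/-- Two homomorphisms to the same superalgebra have supercommuting images. -/
def SuperCommute (f : Hom A C) (g : Hom B C) : Prop :=
  ∀ a b x y, x ∈ A.grading a → y ∈ B.grading b → f x * g y = sgn (a * b) • (g y * f x)

theorem SuperCommute.symm {f : Hom A C} {g : Hom B C} (h : SuperCommute f g) :
    SuperCommute g f := by
  intro a b x y hx hy
  rw [h b a y x hy hx, smul_smul, mul_comm b a, sgn_mul_self, one_smul]

theorem SuperCommute.comp {D A' B' : SuperAlgebra} {f : Hom A C} {g : Hom B C}
    (h : SuperCommute f g) (k : Hom C D) (f' : Hom A' A) (g' : Hom B' B) :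
    SuperCommute ((k.comp f).comp f') ((k.comp g).comp g') := by
  intro a b x y hx hy
  simp only [Hom.comp_apply]
  rw [← map_mul, h a b _ _ (f'.map_mem hx) (g'.map_mem hy), map_smul, map_mul]

/-- The elements of `B` whose image under `g` supercommutes with an element `c` of parity `a`. -/
def superCentralizer (c : C) (a : ZMod 2) (g : Hom B C) : Subalgebra ℂ B where
  carrier := {y | c * g y = g (B.twist a y) * c}
  mul_mem' := by
    intro v w (hv : _ = _) (hw : _ = _)
    change _ = _
    rw [map_mul, map_mul, map_mul, ← mul_assoc, hv, mul_assoc, hw, mul_assoc]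
  add_mem' := by
    intro v w (hv : _ = _) (hw : _ = _)
    change _ = _
    rw [map_add, map_add, map_add, add_mul, mul_add, hv, hw]
  algebraMap_mem' := by
    intro r
    change _ = _
    rw [AlgHom.commutes, AlgHom.commutes, AlgHom.commutes]
    exact (Algebra.commutes r c).symm

theorem mem_superCentralizer_iff {c : C} {a b : ZMod 2} {g : Hom B C} {y : B}
    (hy : y ∈ B.grading b) :
    y ∈ superCentralizer c a g ↔ c * g y = sgn (a * b) • (g y * c) := by
  change _ = _ ↔ _
  rw [twist_of_mem hy, map_smul, smul_mul_assoc, mul_comm b a]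

theorem SuperCommute.mem_superCentralizer {f : Hom A C} {g : Hom B C} (h : SuperCommute f g)
    {a : ZMod 2} {x : A} (hx : x ∈ A.grading a) (y : B) : y ∈ superCentralizer (f x) a g := by
  rw [← B.evenPart_add_oddPart y]
  exact add_mem
    ((mem_superCentralizer_iff (B.evenPart_mem y)).mpr (h a 0 x _ hx (B.evenPart_mem y)))
    ((mem_superCentralizer_iff (B.oddPart_mem y)).mpr (h a 1 x _ hx (B.oddPart_mem y)))

/-! ### The universal property of the tensor product of superalgebras -/

theorem superCommute_inclLeft_inclRight : SuperCommute (inclLeft A B) (inclRight A B) := by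
  intro a b x y hx hy
  have h := include_anticomm A B x hx y hy
  rw [negOnePow_smul_eq_sgn_smul, mul_comm b a] at h
  exact h

theorem tmul_eq (a : A) (b : B) : tmul a b = inclLeft A B a * inclRight A B b :=
  (GradedTensorProduct.tmul_one_mul_one_tmul A.grading B.grading a b).symm

theorem tensor_algHom_ext {R : Type} [Ring R] [Algebra ℂ R] {f g : tensor A B →ₐ[ℂ] R}
    (hl : ∀ a, f (inclLeft A B a) = g (inclLeft A B a))
    (hr : ∀ b, f (inclRight A B b) = g (inclRight A B b)) : f = g :=
  GradedTensorProduct.algHom_ext (𝒜 := A.grading) (ℬ := B.grading) (AlgHom.ext hl) (AlgHom.ext hr)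

/-- The homomorphism on a tensor product assembled from two homomorphisms with supercommuting
images, as an algebra homomorphism. -/
def tensorLiftAux (f : Hom A C) (g : Hom B C) (h : SuperCommute f g) : tensor A B →ₐ[ℂ] C :=
  GradedTensorProduct.lift A.grading B.grading f.toAlgHom g.toAlgHom (by
    intro i j a b
    rw [negOnePow_smul_eq_sgn_smul, mul_comm j i]
    exact h i j a b a.2 b.2)

theorem tensorLiftAux_inclLeft (f : Hom A C) (g : Hom B C) (h : SuperCommute f g) (a : A) :
    tensorLiftAux f g h (inclLeft A B a) = f a := by
  change f a * g 1 = f a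
  rw [map_one, mul_one]

theorem tensorLiftAux_inclRight (f : Hom A C) (g : Hom B C) (h : SuperCommute f g) (b : B) :
    tensorLiftAux f g h (inclRight A B b) = g b := by
  change f 1 * g b = g b
  rw [map_one, one_mul]

/-- The homomorphism on a tensor product assembled from two homomorphisms with supercommuting
images. -/
def tensorLift (f : Hom A C) (g : Hom B C) (h : SuperCommute f g) : Hom (tensor A B) C where
  toAlgHom := tensorLiftAux f g h
  map_parity x := by
    have key : (tensorLiftAux f g h).comp (tensor A B).parity =
        C.parity.comp (tensorLiftAux f g h) := by
      apply tensor_algHom_ext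
      · intro a
        rw [AlgHom.comp_apply, AlgHom.comp_apply, ← Hom.map_parity, tensorLiftAux_inclLeft,
          tensorLiftAux_inclLeft, f.map_parity]
      · intro a
        rw [AlgHom.comp_apply, AlgHom.comp_apply, ← Hom.map_parity, tensorLiftAux_inclRight,
          tensorLiftAux_inclRight, g.map_parity]
    exact DFunLike.congr_fun key x

theorem tensorLift_inclLeft (f : Hom A C) (g : Hom B C) (h : SuperCommute f g) (a : A) :
    tensorLift f g h (inclLeft A B a) = f a := tensorLiftAux_inclLeft f g h a

theorem tensorLift_inclRight (f : Hom A C) (g : Hom B C) (h : SuperCommute f g) (b : B) :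
    tensorLift f g h (inclRight A B b) = g b := tensorLiftAux_inclRight f g h b

theorem map_inclLeft {A' B' : SuperAlgebra} (f : Hom A A') (g : Hom B B') (a : A) :
    map f g (inclLeft A B a) = inclLeft A' B' (f a) := by
  have h := mapAux_tmul f g a 1
  rw [map_one] at h
  exact h

theorem map_inclRight {A' B' : SuperAlgebra} (f : Hom A A') (g : Hom B B') (b : B) :
    map f g (inclRight A B b) = inclRight A' B' (g b) := by
  have h := mapAux_tmul f g 1 b
  rw [map_one] at h
  exact h

theorem tensor_subalgebra_eq_top (S : Subalgebra ℂ (tensor A B))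
    (hl : ∀ a, inclLeft A B a ∈ S) (hr : ∀ b, inclRight A B b ∈ S) (y : tensor A B) : y ∈ S := by
  refine tensor_induction (P := fun z => (show tensor A B from z) ∈ S) y S.zero_mem
    (fun a b => ?_) (fun _ _ => S.add_mem)
  have h := S.mul_mem (hl a) (hr b)
  rwa [← tmul_eq] at h

/-- A homomorphism that supercommutes with two supercommuting homomorphisms supercommutes with the
homomorphism assembled from them. -/
theorem SuperCommute.tensorLift {D : SuperAlgebra} {k : Hom D C} {f : Hom A C} {g : Hom B C}
    (h : SuperCommute f g) (hf : SuperCommute k f) (hg : SuperCommute k g) :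
    SuperCommute k (tensorLift f g h) := by
  intro a b x y hx hy
  refine (mem_superCentralizer_iff hy).mp (tensor_subalgebra_eq_top _ (fun u => ?_) (fun u => ?_) y)
  · change _ = _
    rw [tensorLift_inclLeft, hf.mem_superCentralizer hx u, ← tensorLift_inclLeft f g h]
    congr 2
    unfold twist
    split_ifs
    · rfl
    · exact (inclLeft A B).map_parity u
  · change _ = _
    rw [tensorLift_inclRight, hg.mem_superCentralizer hx u, ← tensorLift_inclRight f g h]
    congr 2
    unfold twist
    split_ifs
    · rfl
    · exact (inclRight A B).map_parity u

/-! ### Tensor powers -/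

theorem superCommute_factor (m : ℕ) :
    ∀ {i j : Fin (m + 1)}, i ≠ j → SuperCommute (factor A m i) (factor A m j) := by
  induction m with
  | zero => intro i j h; exact absurd (Subsingleton.elim (α := Fin 1) i j) h
  | succ m ih =>
    intro i j h
    induction i using Fin.cases with
    | zero =>
      induction j using Fin.cases with
      | zero => exact absurd rfl h
      | succ j =>
        exact superCommute_inclLeft_inclRight.comp (Hom.id _) (Hom.id _) (factor A m j)
    | succ i =>
      induction j using Fin.cases with
      | zero =>
        exact superCommute_inclLeft_inclRight.symm.comp (Hom.id _) (factor A m i) (Hom.id _)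
      | succ j =>
        exact (ih (fun e => h (congrArg Fin.succ e))).comp (inclRight A (tensorPow A m))
          (Hom.id _) (Hom.id _)

theorem tensorPow_algHom_ext {R : Type} [Ring R] [Algebra ℂ R] (m : ℕ)
    {f g : tensorPow A m →ₐ[ℂ] R} (h : ∀ j a, f (factor A m j a) = g (factor A m j a)) :
    f = g := by
  induction m with
  | zero => exact AlgHom.ext (h 0)
  | succ m ih =>
    refine tensor_algHom_ext (h 0) (fun b => ?_)
    have e : f.comp (inclRight A (tensorPow A m)).toAlgHom =
        g.comp (inclRight A (tensorPow A m)).toAlgHom := ih (fun j a => h j.succ a)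
    exact DFunLike.congr_fun e b

/-- The universal property of the tensor power: pairwise supercommuting homomorphisms from `A`
assemble to a homomorphism on `A^{⊗(m+1)}`. -/
theorem exists_tensorPow_lift (m : ℕ) (φ : Fin (m + 1) → Hom A C)
    (h : ∀ i j, i ≠ j → SuperCommute (φ i) (φ j)) :
    ∃ F : Hom (tensorPow A m) C, ∀ j a, F (factor A m j a) = φ j a := by
  -- the image of a lift supercommutes with everything that supercommutes with all the `φ j`
  suffices H : ∃ F : Hom (tensorPow A m) C, (∀ j a, F (factor A m j a) = φ j a) ∧
      ∀ (B : SuperAlgebra) (g : Hom B C), (∀ j, SuperCommute g (φ j)) → SuperCommute g F by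
    obtain ⟨F, hF, -⟩ := H
    exact ⟨F, hF⟩
  induction m with
  | zero =>
    refine ⟨φ 0, fun j a => ?_, fun B g hg => hg 0⟩
    rw [Subsingleton.elim (α := Fin 1) j 0]
    rfl
  | succ m ih =>
    obtain ⟨F, hF, hc⟩ := ih (fun j => φ j.succ)
      (fun i j hij => h _ _ (fun e => hij (Fin.succ_injective _ e)))
    have h0 : SuperCommute (φ 0) F := hc A (φ 0) (fun j => h _ _ (Fin.succ_ne_zero j).symm)
    refine ⟨tensorLift (φ 0) F h0, fun j a => ?_, fun B g hg => ?_⟩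
    · induction j using Fin.cases with
      | zero => exact tensorLift_inclLeft (φ 0) F h0 a
      | succ j =>
        rw [← hF j a]
        exact tensorLift_inclRight (φ 0) F h0 (factor A m j a)
    · exact h0.tensorLift (hg 0) (hc B g (fun j => hg j.succ))

/-! ### Enveloping superalgebras -/

theorem envι_mul_sub (L : LieSub A) {a b : ZMod 2} (x y z : L.toSubmodule)
    (hx : (x : A) ∈ A.grading a) (hy : (y : A) ∈ A.grading b)
    (hz : (z : A) = (x : A) * y - sgn (a * b) • ((y : A) * x)) :
    envι L x * envι L y - sgn (a * b) • (envι L y * envι L x) = envι L z := by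
  have h := RingQuot.mkAlgHom_rel ℂ (EnvRel.bracket (L := L) a b x y z hx hy hz)
  rw [map_sub, map_smul, map_mul, map_mul] at h
  exact h

theorem parity_envι (L : LieSub A) (x : L.toSubmodule) :
    (envelope L).parity (envι L x) = envι L (L.parity x) := by
  change envParity L (RingQuot.mkAlgHom ℂ (EnvRel L) (TensorAlgebra.ι ℂ x)) = _
  rw [envParity, RingQuot.liftAlgHom_mkAlgHom_apply, TensorAlgebra.lift_ι_apply]
  rfl

theorem envι_mem (L : LieSub A) {a : ZMod 2} {x : L.toSubmodule} (hx : (x : A) ∈ A.grading a) :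
    envι L x ∈ (envelope L).grading a := by
  rw [mem_grading, parity_envι, ← map_smul]
  exact congrArg _ (Subtype.ext (mem_grading.mp hx))

theorem envelope_algHom_ext (L : LieSub A) {R : Type} [Ring R] [Algebra ℂ R]
    {f g : envelope L →ₐ[ℂ] R} (h : ∀ x, f (envι L x) = g (envι L x)) : f = g := by
  apply RingQuot.ringQuot_ext'
  exact TensorAlgebra.hom_ext (LinearMap.ext h)

/-- The universal property of the enveloping superalgebra. -/
theorem exists_envelope_lift (L : LieSub A) (φ : L.toSubmodule →ₗ[ℂ] C)
    (hp : ∀ x, φ (L.parity x) = C.parity (φ x))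
    (hb : ∀ (a b : ZMod 2) (x y z : L.toSubmodule), (x : A) ∈ A.grading a → (y : A) ∈ A.grading b →
      (z : A) = (x : A) * y - sgn (a * b) • ((y : A) * x) →
      φ x * φ y - sgn (a * b) • (φ y * φ x) = φ z) :
    ∃ F : Hom (envelope L) C, ∀ x, F (envι L x) = φ x := by
  let F : envelope L →ₐ[ℂ] C := RingQuot.liftAlgHom ℂ (s := EnvRel L) ⟨TensorAlgebra.lift ℂ φ, by
    intro u v h
    obtain ⟨a, b, x, y, z, hx, hy, hz⟩ := h
    simp only [map_sub, map_smul, map_mul, TensorAlgebra.lift_ι_apply]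
    exact hb a b x y z hx hy hz⟩
  have hF : ∀ x, F (envι L x) = φ x := by
    intro x
    change RingQuot.liftAlgHom ℂ _ (RingQuot.mkAlgHom ℂ (EnvRel L) (TensorAlgebra.ι ℂ x)) = _
    rw [RingQuot.liftAlgHom_mkAlgHom_apply, TensorAlgebra.lift_ι_apply]
  refine ⟨⟨F, fun x => ?_⟩, hF⟩
  have key : F.comp (envelope L).parity = C.parity.comp F := by
    apply envelope_algHom_ext
    intro x
    rw [AlgHom.comp_apply, AlgHom.comp_apply, parity_envι, hF, hF, hp]
  exact DFunLike.congr_fun key x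

/-- Every property of the elements of an enveloping superalgebra that defines a subalgebra can be
checked on the homogeneous elements of the Lie superalgebra. -/
theorem envelope_subalgebra_eq_top (L : LieSub A) (S : Subalgebra ℂ (envelope L))
    (h : ∀ (a : ZMod 2) (x : L.toSubmodule), (x : A) ∈ A.grading a → envι L x ∈ S) (y) : y ∈ S := by
  have hS : ∀ x, envι L x ∈ S := by
    intro x
    have ha : L.parity (L.parity x) = x := Subtype.ext (A.parity_parity x)
    have h0 := h 0 ((2⁻¹ : ℂ) • (x + L.parity x)) (A.evenPart_mem x)
    have h1 := h 1 ((2⁻¹ : ℂ) • (x - L.parity x)) (A.oddPart_mem x)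
    have := S.add_mem h0 h1
    rw [← map_add] at this
    convert this using 2
    module
  obtain ⟨t, rfl⟩ := RingQuot.mkAlgHom_surjective ℂ (EnvRel L) y
  induction t using TensorAlgebra.induction with
  | algebraMap r =>
    rw [AlgHom.commutes]
    exact S.algebraMap_mem r
  | ι x => exact hS x
  | mul a b ha hb => rw [map_mul]; exact S.mul_mem ha hb
  | add a b ha hb => rw [map_add]; exact S.add_mem ha hb

/-- Supercommutation of homomorphisms from enveloping superalgebras can be checked on the Lie
superalgebras. -/
theorem superCommute_envelope {D : SuperAlgebra} (L : LieSub A) (M : LieSub D)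
    (f : Hom (envelope L) C) (g : Hom (envelope M) C)
    (h : ∀ (a b : ZMod 2) (x : L.toSubmodule) (y : M.toSubmodule), (x : A) ∈ A.grading a →
      (y : D) ∈ D.grading b →
      f (envι L x) * g (envι M y) = sgn (a * b) • (g (envι M y) * f (envι L x))) :
    SuperCommute f g := by
  intro a b u v hu hv
  refine (mem_superCentralizer_iff hv).mp (envelope_subalgebra_eq_top M _ (fun b y hy => ?_) v)
  rw [mem_superCentralizer_iff (envι_mem M hy)]
  have key : u ∈ superCentralizer (g (envι M y)) b f := by
    refine envelope_subalgebra_eq_top L _ (fun a x hx => ?_) u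
    rw [mem_superCentralizer_iff (envι_mem L hx), h a b x y hx hy, smul_smul, mul_comm b a,
      sgn_mul_self, one_smul]
  rw [(mem_superCentralizer_iff hu).mp key, smul_smul, mul_comm b a, sgn_mul_self, one_smul]

end SuperAlgebra

/-! ### The block decomposition of the Levi subalgebra -/

open SuperAlgebra

theorem qMat_inj {I : Type} [Fintype I] [DecidableEq I] {A B C D : Matrix I I ℂ} :
    qMat A B = qMat C D ↔ A = C ∧ B = D := by
  refine ⟨fun h => ?_, fun h => by rw [h.1, h.2]⟩
  have h' := Matrix.fromBlocks_inj.mp h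
  exact ⟨h'.1, h'.2.1⟩

theorem qMat_add {I : Type} [Fintype I] [DecidableEq I] (A B C D : Matrix I I ℂ) :
    qMat A B + qMat C D = qMat (A + C) (B + D) :=
  Matrix.fromBlocks_add A B B A C D D C

theorem qMat_smul {I : Type} [Fintype I] [DecidableEq I] (c : ℂ) (A B : Matrix I I ℂ) :
    c • qMat A B = qMat (c • A) (c • B) :=
  Matrix.fromBlocks_smul c A B B A

theorem qMat_zero {I : Type} [Fintype I] [DecidableEq I] : (qMat 0 0 : matSuper I) = 0 :=
  Matrix.fromBlocks_zero

theorem qMat_sum {I ι : Type} [Fintype I] [DecidableEq I] (s : Finset ι) (A B : ι → Matrix I I ℂ) :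
    ∑ i ∈ s, qMat (A i) (B i) = qMat (∑ i ∈ s, A i) (∑ i ∈ s, B i) := by
  classical
  induction s using Finset.induction_on with
  | empty => simp [qMat_zero]
  | insert i s hi ih => rw [Finset.sum_insert hi, Finset.sum_insert hi, Finset.sum_insert hi, ih,
      qMat_add]

theorem twist_qMat {I : Type} [Fintype I] [DecidableEq I] (a : ZMod 2) (A B : Matrix I I ℂ) :
    (matSuper I).twist a (qMat A B) = qMat A (sgn a • B) := by
  rcases zmod2_cases a with rfl | rfl
  · rw [sgn_zero, one_smul]
    rfl
  · rw [sgn_one, neg_smul, one_smul]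
    rfl

/-- A linear map between spaces of matrices, applied to the four blocks. -/
def blockwise {I J : Type} [Fintype I] [DecidableEq I] [Fintype J] [DecidableEq J]
    (φ : Matrix I I ℂ →ₗ[ℂ] Matrix J J ℂ) : matSuper I →ₗ[ℂ] matSuper J where
  toFun := fun X : Matrix (I ⊕ I) (I ⊕ I) ℂ =>
    (Matrix.fromBlocks (φ X.toBlocks₁₁) (φ X.toBlocks₁₂) (φ X.toBlocks₂₁) (φ X.toBlocks₂₂) :
      Matrix (J ⊕ J) (J ⊕ J) ℂ)
  map_add' := by
    intro (X : Matrix (I ⊕ I) (I ⊕ I) ℂ) (Y : Matrix (I ⊕ I) (I ⊕ I) ℂ)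
    refine Eq.trans ?_ (Matrix.fromBlocks_add _ _ _ _ _ _ _ _).symm
    simp only [← map_add]
    rfl
  map_smul' := by
    intro c (X : Matrix (I ⊕ I) (I ⊕ I) ℂ)
    refine Eq.trans ?_ (Matrix.fromBlocks_smul _ _ _ _ _).symm
    simp only [← map_smul]
    rfl

theorem blockwise_qMat {I J : Type} [Fintype I] [DecidableEq I] [Fintype J] [DecidableEq J]
    (φ : Matrix I I ℂ →ₗ[ℂ] Matrix J J ℂ) (A B : Matrix I I ℂ) :
    blockwise φ (qMat A B) = qMat (φ A) (φ B) := rfl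

variable {N l : ℕ}

/-- The eigenvalue of `h` on the positions with index `i`. -/
def dynkinWeight (i : Fin l) : ℂ := (l : ℂ) - 2 * ((i : ℕ) + 1) + 1

theorem dynkinWeight_injective : Function.Injective (dynkinWeight (l := l)) := by
  intro i j h
  have h' : ((i : ℕ) : ℂ) = (j : ℕ) := by
    simp only [dynkinWeight] at h
    linear_combination -h / 2
  exact Fin.ext (by exact_mod_cast h')

/-- The diagonal matrix whose adjoint action defines the Dynkin grading. -/
def dynkinDiag (N l : ℕ) : Matrix (Fin (N * l)) (Fin (N * l)) ℂ :=
  Matrix.diagonal fun a => dynkinWeight (finProdFinEquiv.symm a).2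

theorem dynkinH_eq : dynkinH N l = qMat (dynkinDiag N l) 0 := rfl

/-- The inclusion of `ℂ^N` into `ℂ^{Nl}` along the positions with index `i`. -/
def incl (N : ℕ) (i : Fin l) : Matrix (Fin (N * l)) (Fin N) ℂ :=
  Matrix.of fun a p => if a = pos N l p i then 1 else 0

theorem pos_inj {p q : Fin N} {i j : Fin l} : pos N l p i = pos N l q j ↔ p = q ∧ i = j := by
  simp [pos]

theorem incl_transpose_mul_incl (i j : Fin l) :
    (incl N i).transpose * incl N j = if i = j then 1 else 0 := by
  ext p q
  simp only [incl, Matrix.mul_apply, Matrix.transpose_apply, Matrix.of_apply, ite_mul, one_mul,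
    zero_mul, Finset.sum_ite_eq', Finset.mem_univ, if_true, pos_inj]
  by_cases h : i = j
  · subst h
    simp [Matrix.one_apply]
  · simp [h]

theorem incl_mul_transpose (i : Fin l) :
    incl N i * (incl N i).transpose =
      Matrix.diagonal fun a => if (finProdFinEquiv.symm a).2 = i then 1 else 0 := by
  ext a b
  obtain ⟨⟨p, j⟩, rfl⟩ := finProdFinEquiv.surjective a
  obtain ⟨⟨q, k⟩, rfl⟩ := finProdFinEquiv.surjective b
  simp only [incl, pos, Matrix.mul_apply, Matrix.transpose_apply, Matrix.of_apply,
    Matrix.diagonal_apply, EmbeddingLike.apply_eq_iff_eq, Prod.mk.injEq, Equiv.symm_apply_apply]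
  by_cases hj : j = i
  · subst hj
    by_cases hk : k = j
    · subst hk
      simp
    · simp [hk, Ne.symm hk]
  · simp [hj]

theorem sum_incl_mul_transpose :
    ∑ i : Fin l, incl N i * (incl N i).transpose = 1 := by
  ext a b
  simp only [incl_mul_transpose, Matrix.sum_apply, Matrix.diagonal_apply, Matrix.one_apply]
  by_cases h : a = b <;> simp [h]

theorem dynkinDiag_mul_incl (i : Fin l) :
    dynkinDiag N l * incl N i = dynkinWeight i • incl N i := by
  ext a p
  rw [dynkinDiag, Matrix.diagonal_mul, Matrix.smul_apply, incl, Matrix.of_apply]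
  split_ifs with h
  · rw [h, pos, Equiv.symm_apply_apply, smul_eq_mul]
  · simp

theorem incl_transpose_mul_dynkinDiag (i : Fin l) :
    (incl N i).transpose * dynkinDiag N l = dynkinWeight i • (incl N i).transpose := by
  rw [← Matrix.transpose_smul, ← dynkinDiag_mul_incl, Matrix.transpose_mul, dynkinDiag,
    Matrix.diagonal_transpose]

/-- The spectral projections of `h` commute with everything that commutes with `h`, because the
eigenvalues of `h` for different indices are different. -/
theorem incl_mul_transpose_comm {A : Matrix (Fin (N * l)) (Fin (N * l)) ℂ}
    (hA : dynkinDiag N l * A = A * dynkinDiag N l) (i : Fin l) :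
    A * (incl N i * (incl N i).transpose) = incl N i * (incl N i).transpose * A := by
  rw [incl_mul_transpose]
  ext a b
  have h := congrFun (congrFun hA a) b
  rw [dynkinDiag, Matrix.diagonal_mul, Matrix.mul_diagonal] at h
  rw [Matrix.diagonal_mul, Matrix.mul_diagonal]
  by_cases hab : A a b = 0
  · rw [hab, mul_zero, zero_mul]
  · have e := dynkinWeight_injective (mul_right_cancel₀ hab (h.trans (mul_comm _ _)))
    rw [e, mul_comm]

theorem incl_mul_single_mul_transpose (i : Fin l) (p q : Fin N) :
    incl N i * Matrix.single p q (1 : ℂ) * (incl N i).transpose =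
      Matrix.single (pos N l p i) (pos N l q i) 1 := by
  ext a b
  rw [Matrix.mul_apply, Finset.sum_eq_single q]
  · rw [Matrix.mul_single_apply_same, Matrix.transpose_apply]
    simp only [incl, Matrix.of_apply, Matrix.single_apply, mul_one, @eq_comm _ (pos N l _ _)]
    split_ifs <;> simp_all
  · intro k _ hk
    rw [Matrix.mul_single_apply_of_ne _ _ _ _ _ hk, zero_mul]
  · simp

/-- Restriction of a matrix to the positions with index `i`. -/
def restrictBlock (N : ℕ) (i : Fin l) :
    Matrix (Fin (N * l)) (Fin (N * l)) ℂ →ₗ[ℂ] Matrix (Fin N) (Fin N) ℂ where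
  toFun A := (incl N i).transpose * A * incl N i
  map_add' A B := by rw [Matrix.mul_add, Matrix.add_mul]
  map_smul' c A := by simp

/-- Extension by zero of a matrix on the positions with index `i`. -/
def extendBlock (N : ℕ) (i : Fin l) :
    Matrix (Fin N) (Fin N) ℂ →ₗ[ℂ] Matrix (Fin (N * l)) (Fin (N * l)) ℂ where
  toFun A := incl N i * A * (incl N i).transpose
  map_add' A B := by rw [Matrix.mul_add, Matrix.add_mul]
  map_smul' c A := by simp

theorem restrictBlock_extendBlock (i j : Fin l) (A : Matrix (Fin N) (Fin N) ℂ) :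
    restrictBlock N i (extendBlock N j A) = if i = j then A else 0 := by
  change (incl N i).transpose * (incl N j * A * (incl N j).transpose) * incl N i = _
  rw [show (incl N i).transpose * (incl N j * A * (incl N j).transpose) * incl N i =
    ((incl N i).transpose * incl N j) * A * ((incl N j).transpose * incl N i) by
      simp only [Matrix.mul_assoc], incl_transpose_mul_incl, incl_transpose_mul_incl]
  by_cases h : i = j
  · simp [h]
  · simp [h]

theorem extendBlock_mul_extendBlock (i j : Fin l) (A B : Matrix (Fin N) (Fin N) ℂ) :
    extendBlock N i A * extendBlock N j B = if i = j then extendBlock N i (A * B) else 0 := by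
  change (incl N i * A * (incl N i).transpose) * (incl N j * B * (incl N j).transpose) = _
  rw [show (incl N i * A * (incl N i).transpose) * (incl N j * B * (incl N j).transpose) =
    incl N i * A * ((incl N i).transpose * incl N j) * B * (incl N j).transpose by
      simp only [Matrix.mul_assoc], incl_transpose_mul_incl]
  by_cases h : i = j
  · subst h
    simp [extendBlock, Matrix.mul_assoc]
  · simp [h]

theorem dynkinDiag_mul_extendBlock (i : Fin l) (A : Matrix (Fin N) (Fin N) ℂ) :
    dynkinDiag N l * extendBlock N i A = extendBlock N i A * dynkinDiag N l := by
  change dynkinDiag N l * (incl N i * A * (incl N i).transpose) =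
    (incl N i * A * (incl N i).transpose) * dynkinDiag N l
  rw [Matrix.mul_assoc _ _ (dynkinDiag N l), incl_transpose_mul_dynkinDiag, ← Matrix.mul_assoc,
    ← Matrix.mul_assoc, dynkinDiag_mul_incl]
  simp

theorem restrictBlock_mul {A : Matrix (Fin (N * l)) (Fin (N * l)) ℂ}
    (hA : dynkinDiag N l * A = A * dynkinDiag N l) (B : Matrix (Fin (N * l)) (Fin (N * l)) ℂ)
    (i : Fin l) : restrictBlock N i (A * B) = restrictBlock N i A * restrictBlock N i B := by
  change (incl N i).transpose * (A * B) * incl N i =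
    ((incl N i).transpose * A * incl N i) * ((incl N i).transpose * B * incl N i)
  have h : (incl N i).transpose * A =
      (incl N i).transpose * A * (incl N i * (incl N i).transpose) := by
    rw [Matrix.mul_assoc _ A, incl_mul_transpose_comm hA, ← Matrix.mul_assoc, ← Matrix.mul_assoc,
      incl_transpose_mul_incl, if_pos rfl, Matrix.one_mul]
  rw [← Matrix.mul_assoc, Matrix.mul_assoc _ B, Matrix.mul_assoc _ B]
  nth_rw 1 [h]
  simp only [Matrix.mul_assoc]

theorem sum_extendBlock_restrictBlock {A : Matrix (Fin (N * l)) (Fin (N * l)) ℂ}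
    (hA : dynkinDiag N l * A = A * dynkinDiag N l) :
    ∑ i, extendBlock N i (restrictBlock N i A) = A := by
  have h : ∀ i, extendBlock N i (restrictBlock N i A) =
      incl N i * (incl N i).transpose * A := by
    intro i
    change incl N i * ((incl N i).transpose * A * incl N i) * (incl N i).transpose = _
    rw [show incl N i * ((incl N i).transpose * A * incl N i) * (incl N i).transpose =
      incl N i * (incl N i).transpose * (A * (incl N i * (incl N i).transpose)) by
        simp only [Matrix.mul_assoc], incl_mul_transpose_comm hA, ← Matrix.mul_assoc,
      Matrix.mul_assoc (incl N i), ← Matrix.mul_assoc _ (incl N i), incl_transpose_mul_incl,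
      if_pos rfl, Matrix.one_mul]
  rw [Finset.sum_congr rfl fun i _ => h i, ← Finset.sum_mul, sum_incl_mul_transpose,
    Matrix.one_mul]

theorem qMat_mem_levi {A B : Matrix (Fin (N * l)) (Fin (N * l)) ℂ} :
    qMat A B ∈ (levi N l).toSubmodule ↔
      dynkinDiag N l * A = A * dynkinDiag N l ∧ dynkinDiag N l * B = B * dynkinDiag N l := by
  have h : dynkinH N l * qMat A B = qMat A B * dynkinH N l ↔
      dynkinDiag N l * A = A * dynkinDiag N l ∧ dynkinDiag N l * B = B * dynkinDiag N l := by
    rw [dynkinH_eq, qMat_mul, qMat_mul, qMat_inj]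
    simp
  exact ⟨fun hX => h.mp hX.2, fun hX => ⟨⟨A, B, rfl⟩, h.mpr hX⟩⟩

theorem exists_of_mem_levi {X : matSuper (Fin (N * l))} (hX : X ∈ (levi N l).toSubmodule) :
    ∃ A B, X = qMat A B ∧ dynkinDiag N l * A = A * dynkinDiag N l ∧
      dynkinDiag N l * B = B * dynkinDiag N l := by
  obtain ⟨A, B, rfl⟩ := hX.1
  exact ⟨A, B, rfl, qMat_mem_levi.mp hX⟩

/-- The projection of the Levi subalgebra to its `i`-th block `Q(N)`, composed with the `i`-th power
of the parity automorphism; the twist produces the sign in the definition of `ξ^i_{p,q}`. -/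
def leviToQueer (N : ℕ) (i : Fin l) :
    (levi N l).toSubmodule →ₗ[ℂ] (queer (Fin N)).toSubmodule :=
  (((matSuper (Fin N)).twist (i : ℕ)).toLinearMap ∘ₗ blockwise (restrictBlock N i)).restrict (by
    intro X hX
    obtain ⟨A, B, rfl, -, -⟩ := exists_of_mem_levi hX
    refine ⟨restrictBlock N i A, sgn (i : ℕ) • restrictBlock N i B, ?_⟩
    rw [LinearMap.comp_apply, blockwise_qMat, AlgHom.toLinearMap_apply, twist_qMat])

/-- The embedding of `Q(N)` as the `i`-th block of the Levi subalgebra, composed with the `i`-th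
power of the parity automorphism. -/
def queerToLevi (N : ℕ) (i : Fin l) :
    (queer (Fin N)).toSubmodule →ₗ[ℂ] (levi N l).toSubmodule :=
  (blockwise (extendBlock N i) ∘ₗ ((matSuper (Fin N)).twist (i : ℕ)).toLinearMap).restrict (by
    rintro _ ⟨A, B, rfl⟩
    rw [LinearMap.comp_apply, AlgHom.toLinearMap_apply, twist_qMat, blockwise_qMat]
    exact qMat_mem_levi.mpr ⟨dynkinDiag_mul_extendBlock i A, dynkinDiag_mul_extendBlock i _⟩)

theorem coe_leviToQueer (i : Fin l) (X : (levi N l).toSubmodule)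
    {A B : Matrix (Fin (N * l)) (Fin (N * l)) ℂ} (hX : X.1 = qMat A B) :
    (leviToQueer N i X : matSuper (Fin N)) =
      qMat (restrictBlock N i A) (sgn (i : ℕ) • restrictBlock N i B) := by
  change (matSuper (Fin N)).twist (i : ℕ) (blockwise (restrictBlock N i) X) = _
  rw [hX, blockwise_qMat, twist_qMat]

theorem coe_queerToLevi (i : Fin l) (Y : (queer (Fin N)).toSubmodule)
    {A B : Matrix (Fin N) (Fin N) ℂ} (hY : Y.1 = qMat A B) :
    (queerToLevi N i Y : matSuper (Fin (N * l))) =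
      qMat (extendBlock N i A) (sgn (i : ℕ) • extendBlock N i B) := by
  change blockwise (extendBlock N i) ((matSuper (Fin N)).twist (i : ℕ) Y) = _
  rw [hY, twist_qMat, blockwise_qMat, map_smul]

theorem leviToQueer_queerToLevi (i j : Fin l) (Y : (queer (Fin N)).toSubmodule) :
    leviToQueer N i (queerToLevi N j Y) = if i = j then Y else 0 := by
  obtain ⟨A, B, h⟩ := Y.2
  apply Subtype.ext
  rw [coe_leviToQueer i _ (coe_queerToLevi j Y h), map_smul, restrictBlock_extendBlock,
    restrictBlock_extendBlock]
  by_cases hij : i = j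
  · subst hij
    simp only [if_true, smul_smul, sgn_mul_self, one_smul, h]
  · simp only [if_neg hij, smul_zero, qMat_zero]
    rfl

/-- The Levi subalgebra is the sum of its blocks. -/
theorem sum_queerToLevi_leviToQueer (X : (levi N l).toSubmodule) :
    ∑ i, queerToLevi N i (leviToQueer N i X) = X := by
  obtain ⟨A, B, h, hA, hB⟩ := exists_of_mem_levi X.2
  apply Subtype.ext
  rw [Submodule.coe_sum, h]
  refine Eq.trans (Finset.sum_congr rfl fun i _ => ?_) ((qMat_sum Finset.univ _ _).trans
    (congrArg₂ qMat (sum_extendBlock_restrictBlock hA) (sum_extendBlock_restrictBlock hB)))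
  rw [coe_queerToLevi i _ (coe_leviToQueer i X h), map_smul, smul_smul, sgn_mul_self, one_smul]

/-- The projections to the blocks preserve supercommutators, since elements of the Levi subalgebra
are block diagonal. -/
theorem coe_leviToQueer_of_eq_mul (i : Fin l) (X Y Z : (levi N l).toSubmodule) (c : ℂ)
    (hZ : Z.1 = X.1 * Y.1 - c • (Y.1 * X.1)) :
    (leviToQueer N i Z : matSuper (Fin N)) = (leviToQueer N i X).1 * (leviToQueer N i Y).1 -
      c • ((leviToQueer N i Y).1 * (leviToQueer N i X).1) := by
  have key : ∀ X Y : (levi N l).toSubmodule,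
      (matSuper (Fin N)).twist (i : ℕ) (blockwise (restrictBlock N i) (X.1 * Y.1)) =
        (leviToQueer N i X).1 * (leviToQueer N i Y).1 := by
    intro X Y
    obtain ⟨A, B, h, hA, hB⟩ := exists_of_mem_levi X.2
    obtain ⟨C, D, h', -, -⟩ := exists_of_mem_levi Y.2
    rw [coe_leviToQueer i X h, coe_leviToQueer i Y h', h, h', qMat_mul, blockwise_qMat, twist_qMat,
      qMat_mul, map_add, map_add, restrictBlock_mul hA, restrictBlock_mul hA, restrictBlock_mul hB,
      restrictBlock_mul hB, smul_mul_smul_comm, sgn_mul_self, one_smul, smul_add,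
      Matrix.mul_smul, Matrix.smul_mul]
  change (matSuper (Fin N)).twist (i : ℕ) (blockwise (restrictBlock N i) Z.1) = _
  rw [hZ, map_sub, map_sub, map_smul, map_smul, key, key]

theorem queerToLevi_mul (i j : Fin l) (X Y : (queer (Fin N)).toSubmodule) :
    (queerToLevi N i X).1 * (queerToLevi N j Y).1 =
      if i = j then
        blockwise (extendBlock N i) ((matSuper (Fin N)).twist (i : ℕ) (X.1 * Y.1))
      else 0 := by
  obtain ⟨A, B, h⟩ := X.2
  obtain ⟨C, D, h'⟩ := Y.2
  rw [coe_queerToLevi i X h, coe_queerToLevi j Y h', qMat_mul]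
  simp only [Matrix.smul_mul, Matrix.mul_smul, extendBlock_mul_extendBlock]
  by_cases hij : i = j
  · subst hij
    simp only [if_true]
    rw [h, h', qMat_mul, twist_qMat, blockwise_qMat, smul_smul, sgn_mul_self, one_smul, map_add,
      map_smul, map_add, smul_add]
  · simp [if_neg hij, qMat_zero]

theorem leviToQueer_mem (i : Fin l) {a : ZMod 2} {X : (levi N l).toSubmodule}
    (hX : X.1 ∈ (matSuper (Fin (N * l))).grading a) :
    (leviToQueer N i X).1 ∈ (matSuper (Fin N)).grading a := by
  obtain ⟨A, B, h, -, -⟩ := exists_of_mem_levi X.2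
  rw [mem_grading, h, parity_qMat, qMat_smul, qMat_inj] at hX
  rw [mem_grading, coe_leviToQueer i X h, parity_qMat, qMat_smul, qMat_inj, ← smul_neg, ← map_neg,
    hX.2, map_smul, smul_comm, ← map_smul, ← hX.1]
  exact ⟨rfl, rfl⟩

theorem queerToLevi_mem (i : Fin l) {a : ZMod 2} {X : (queer (Fin N)).toSubmodule}
    (hX : X.1 ∈ (matSuper (Fin N)).grading a) :
    (queerToLevi N i X).1 ∈ (matSuper (Fin (N * l))).grading a := by
  obtain ⟨A, B, h⟩ := X.2
  rw [mem_grading, h, parity_qMat, qMat_smul, qMat_inj] at hX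
  rw [mem_grading, coe_queerToLevi i X h, parity_qMat, qMat_smul, qMat_inj, ← smul_neg, ← map_neg,
    hX.2, map_smul, smul_comm, ← map_smul, ← hX.1]
  exact ⟨rfl, rfl⟩

theorem leviToQueer_parity (i : Fin l) (X : (levi N l).toSubmodule) :
    leviToQueer N i ((levi N l).parity X) = (queer (Fin N)).parity (leviToQueer N i X) := by
  obtain ⟨A, B, h, -, -⟩ := exists_of_mem_levi X.2
  apply Subtype.ext
  have h' : ((levi N l).parity X : matSuper _) = qMat A (-B) := by
    change (matSuper _).parity X.1 = _
    rw [h, parity_qMat]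
  rw [coe_leviToQueer i _ h', map_neg, smul_neg]
  change _ = (matSuper _).parity (leviToQueer N i X).1
  rw [coe_leviToQueer i _ h, parity_qMat]

theorem queerToLevi_parity (i : Fin l) (X : (queer (Fin N)).toSubmodule) :
    queerToLevi N i ((queer (Fin N)).parity X) = (levi N l).parity (queerToLevi N i X) := by
  obtain ⟨A, B, h⟩ := X.2
  apply Subtype.ext
  have h' : ((queer (Fin N)).parity X : matSuper _) = qMat A (-B) := by
    change (matSuper _).parity X.1 = _
    rw [h, parity_qMat]
  rw [coe_queerToLevi i _ h', map_neg, smul_neg]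
  change _ = (matSuper _).parity (queerToLevi N i X).1
  rw [coe_queerToLevi i _ h, parity_qMat]

theorem envι_queerToLevi_eMat (i : Fin l) (p q : Fin N) :
    envι (levi N l) (queerToLevi N i ⟨eMat p q, _, _, rfl⟩) = x i p q := by
  rw [x]
  congr 1
  apply Subtype.ext
  rw [coe_queerToLevi i _ rfl, map_zero, smul_zero]
  change qMat (incl N i * Matrix.single p q (1 : ℂ) * (incl N i).transpose) 0 = _
  rw [incl_mul_single_mul_transpose]
  rfl

theorem sgn_natCast (n : ℕ) : sgn n = (-1) ^ n := by
  rw [sgn, ZMod.val_natCast, ← neg_one_pow_eq_pow_mod_two]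

theorem envι_queerToLevi_fMat (i : Fin l) (p q : Fin N) :
    envι (levi N l) (queerToLevi N i ⟨fMat p q, _, _, rfl⟩) = ξ i p q := by
  rw [ξ, ← map_smul]
  congr 1
  apply Subtype.ext
  rw [coe_queerToLevi i _ rfl, map_zero, sgn_natCast]
  change qMat 0 ((-1 : ℂ) ^ (i : ℕ) •
      (incl N i * Matrix.single p q (1 : ℂ) * (incl N i).transpose)) =
    (-1 : ℂ) ^ ((i : ℕ) + 1 + 1) • qMat 0 _
  rw [incl_mul_single_mul_transpose, qMat_smul, smul_zero, pow_add _ _ 1, pow_add _ _ 1]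
  simp

theorem queer_linearMap_ext {I : Type} [Fintype I] [DecidableEq I] {M : Type} [AddCommGroup M]
    [Module ℂ M] {φ ψ : (queer I).toSubmodule →ₗ[ℂ] M}
    (he : ∀ i j, φ ⟨eMat i j, _, _, rfl⟩ = ψ ⟨eMat i j, _, _, rfl⟩)
    (hf : ∀ i j, φ ⟨fMat i j, _, _, rfl⟩ = ψ ⟨fMat i j, _, _, rfl⟩) : φ = ψ := by
  apply LinearMap.ext
  rintro ⟨X, A, B, rfl⟩
  have h : (⟨qMat A B, A, B, rfl⟩ : (queer I).toSubmodule) =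
      ∑ i, ∑ j, (A i j • ⟨eMat i j, _, _, rfl⟩ + B i j • ⟨fMat i j, _, _, rfl⟩) := by
    apply Subtype.ext
    simp only [Submodule.coe_sum, Submodule.coe_add, Submodule.coe_smul]
    simp only [eMat, fMat, qMat_smul, qMat_add, qMat_sum, smul_zero, add_zero, zero_add,
      Matrix.smul_single, smul_eq_mul, mul_one]
    rw [← Matrix.matrix_eq_sum_single, ← Matrix.matrix_eq_sum_single]
  rw [h]
  simp only [map_sum, map_add, map_smul, he, hf]

/-! ### The enveloping superalgebra of the Levi subalgebra -/

/-- In one direction the identification is induced by the sum of the projections to the blocks,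
where each block goes to its own tensor factor.  In the other direction the embeddings of the blocks
induce pairwise supercommuting homomorphisms, since the product of two different blocks vanishes,
and these assemble to a homomorphism on the tensor power. -/
theorem exists_leviIdentification (N m : ℕ) :
    ∃ Φ : envelope (levi N (m + 1)) ≃ₐ[ℂ] tensorPow (envelope (queer (Fin N))) m,
      IsLeviIdentification Φ := by
  let 𝒰 := envelope (queer (Fin N))
  let φ : (levi N (m + 1)).toSubmodule →ₗ[ℂ] tensorPow 𝒰 m :=
    ∑ i : Fin (m + 1), (factor 𝒰 m i.rev).toAlgHom.toLinearMap ∘ₗ envι _ ∘ₗ leviToQueer N i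
  have hφ : ∀ X, φ X = ∑ i : Fin (m + 1), factor 𝒰 m i.rev (envι _ (leviToQueer N i X)) := by
    intro X
    simp [φ]
  obtain ⟨F, hF⟩ := exists_envelope_lift (C := tensorPow 𝒰 m) (levi N (m + 1)) φ
    (by
      intro X
      rw [hφ, hφ, map_sum]
      refine Finset.sum_congr rfl fun i _ => ?_
      rw [leviToQueer_parity, ← parity_envι, Hom.map_parity])
    (by
      intro a b X Y Z hX hY hZ
      -- only the diagonal terms survive, since different tensor factors supercommute
      rw [hφ, hφ, hφ, Finset.sum_mul_sum, Finset.sum_mul_sum]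
      conv_lhs =>
        arg 2
        rw [Finset.sum_comm]
      rw [Finset.smul_sum, ← Finset.sum_sub_distrib]
      refine Finset.sum_congr rfl fun i _ => ?_
      rw [Finset.smul_sum, ← Finset.sum_sub_distrib, Finset.sum_eq_single i]
      · rw [← map_mul (factor 𝒰 m i.rev).toAlgHom, ← map_mul (factor 𝒰 m i.rev).toAlgHom,
          ← map_smul, ← map_sub]
        congr 1
        exact envι_mul_sub _ _ _ _ (leviToQueer_mem i hX) (leviToQueer_mem i hY)
          (coe_leviToQueer_of_eq_mul i X Y Z _ hZ)
      · intro j _ hj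
        rw [sub_eq_zero]
        exact superCommute_factor m (fun h => hj (Fin.rev_injective h).symm) a b _ _
          (envι_mem _ (leviToQueer_mem i hX)) (envι_mem _ (leviToQueer_mem j hY))
      · simp)
  have hΛ : ∀ i : Fin (m + 1), ∃ Λ : Hom 𝒰 (envelope (levi N (m + 1))),
      ∀ Y, Λ (envι _ Y) = envι _ (queerToLevi N i Y) := by
    intro i
    refine exists_envelope_lift (queer (Fin N)) (envι _ ∘ₗ queerToLevi N i) ?_ ?_
    · intro X
      rw [LinearMap.comp_apply, LinearMap.comp_apply, queerToLevi_parity, parity_envι]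
    · intro a b X Y Z hX hY hZ
      refine envι_mul_sub _ _ _ _ (queerToLevi_mem i hX) (queerToLevi_mem i hY) ?_
      rw [queerToLevi_mul, queerToLevi_mul, if_pos rfl, if_pos rfl, ← map_smul, ← map_smul,
        ← map_sub, ← map_sub, ← hZ]
      rfl
  choose Λ hΛ using hΛ
  obtain ⟨G, hG⟩ := exists_tensorPow_lift (A := 𝒰) m (fun j => Λ j.rev) (by
    intro i j hij
    refine superCommute_envelope _ _ _ _ ?_
    intro a b X Y hX hY
    have hij' : i.rev ≠ j.rev := fun h => hij (Fin.rev_injective h)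
    have h := envι_mul_sub _ (queerToLevi N i.rev X) (queerToLevi N j.rev Y) 0
      (queerToLevi_mem i.rev hX) (queerToLevi_mem j.rev hY) (by
        rw [queerToLevi_mul, queerToLevi_mul, if_neg hij', if_neg hij'.symm]
        simp only [smul_zero, sub_zero]
        rfl)
    rw [map_zero, sub_eq_zero] at h
    rw [hΛ, hΛ, h])
  have hGF : G.toAlgHom.comp F.toAlgHom = AlgHom.id ℂ _ := by
    apply envelope_algHom_ext
    intro X
    rw [AlgHom.comp_apply, hF, hφ, map_sum]
    simp only [hG, Fin.rev_rev, hΛ]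
    rw [← map_sum, sum_queerToLevi_leviToQueer]
    rfl
  have hFΛ : ∀ i y, F (Λ i y) = factor 𝒰 m i.rev y := by
    intro i y
    have h : F.toAlgHom.comp (Λ i).toAlgHom = (factor 𝒰 m i.rev).toAlgHom := by
      apply envelope_algHom_ext
      intro Y
      rw [AlgHom.comp_apply, hΛ, hF, hφ, Finset.sum_eq_single i]
      · rw [leviToQueer_queerToLevi, if_pos rfl]
      · intro j _ hj
        rw [leviToQueer_queerToLevi, if_neg hj, map_zero, map_zero]
      · simp
    exact DFunLike.congr_fun h y
  have hFG : F.toAlgHom.comp G.toAlgHom = AlgHom.id ℂ _ := by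
    apply tensorPow_algHom_ext
    intro j y
    rw [AlgHom.comp_apply, hG, hFΛ, Fin.rev_rev]
    rfl
  refine ⟨AlgEquiv.ofAlgHom F.toAlgHom G.toAlgHom hFG hGF, F.map_parity, fun i p q => ⟨?_, ?_⟩⟩
  · change F (x i p q) = _
    rw [← envι_queerToLevi_eMat, ← hΛ, hFΛ]
    rfl
  · change F (ξ i p q) = _
    rw [← envι_queerToLevi_fMat, ← hΛ, hFΛ]
    rfl

/-- The Levi subalgebra is spanned by the elements `x^i_{p,q}` and `ξ^i_{p,q}`, so they generate its
enveloping superalgebra. -/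
theorem envelope_levi_algHom_ext {R : Type} [Ring R] [Algebra ℂ R]
    {F G : envelope (levi N l) →ₐ[ℂ] R} (hx : ∀ i p q, F (x i p q) = G (x i p q))
    (hξ : ∀ i p q, F (ξ i p q) = G (ξ i p q)) : F = G := by
  apply envelope_algHom_ext
  intro X
  rw [← sum_queerToLevi_leviToQueer X]
  simp only [map_sum]
  refine Finset.sum_congr rfl fun i _ => ?_
  have h : (F.toLinearMap ∘ₗ envι _) ∘ₗ queerToLevi N i =
      (G.toLinearMap ∘ₗ envι _) ∘ₗ queerToLevi N i := by
    apply queer_linearMap_ext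
    · intro p q
      simp only [LinearMap.comp_apply, envι_queerToLevi_eMat, AlgHom.toLinearMap_apply, hx]
    · intro p q
      simp only [LinearMap.comp_apply, envι_queerToLevi_fMat, AlgHom.toLinearMap_apply, hξ]
  exact LinearMap.congr_fun h _

theorem existsUnique_leviIdentification (N m : ℕ) :
    ∃! Φ : envelope (levi N (m + 1)) ≃ₐ[ℂ] tensorPow (envelope (queer (Fin N))) m,
      IsLeviIdentification Φ := by
  obtain ⟨Φ, hΦ⟩ := exists_leviIdentification N m
  refine ⟨Φ, hΦ, fun Ψ hΨ => ?_⟩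
  have h : Ψ.toAlgHom = Φ.toAlgHom := by
    apply envelope_levi_algHom_ext
    · intro i p q
      exact (hΨ.2 i p q).1.trans (hΦ.2 i p q).1.symm
    · intro i p q
      exact (hΨ.2 i p q).2.trans (hΦ.2 i p q).2.symm
  exact AlgEquiv.ext fun y => DFunLike.congr_fun h y

/-! ### Products of solutions of the exchange relation -/

theorem neg_neg (i : SignedIndex N) : neg (neg i) = i := Sum.swap_swap i

/-- The involution `i ↦ -i` of the index set. -/
def negEquiv (N : ℕ) : SignedIndex N ≃ SignedIndex N := Equiv.sumComm _ _

theorem sum_neg {M : Type*} [AddCommMonoid M] (φ : SignedIndex N → M) :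
    ∑ i, φ (neg i) = ∑ i, φ i := Equiv.sum_comp (negEquiv N) φ

/-- The sign `(-1)^a` as an element of a `ℂ`-algebra. -/
def sgnIn (K : Type*) [CommRing K] [Algebra ℂ K] (a : ZMod 2) : K := algebraMap ℂ K (sgn a)

section Exchange

variable {K R : Type*} [CommRing K] [Algebra ℂ K] [Ring R] [Algebra K R]

theorem sgnIn_add (a b : ZMod 2) : sgnIn K (a + b) = sgnIn K a * sgnIn K b := by
  rw [sgnIn, sgn_add, map_mul]; rfl

/-- The left-hand side of the exchange relation, in which the permutations act on the row
indices. -/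
def exchangeLeft (α β γ : K) (P P' : SignedIndex N → SignedIndex N → R)
    (i k j l : SignedIndex N) : R :=
  (α * sgnIn K (par i * par k + par i * par l + par k * par l)) • (P i j * P' k l)
    - β • (P k j * P' i l)
    + (γ * sgnIn K (par k + par l)) • (P (neg k) j * P' (neg i) l)

/-- The right-hand side of the exchange relation, in which the permutations act on the column
indices. -/
def exchangeRight (α β γ : K) (P P' : SignedIndex N → SignedIndex N → R)
    (i k j l : SignedIndex N) : R :=
  (α * sgnIn K (par i * par k + par i * par l + par k * par l +
      (par i + par j) * (par k + par l))) • (P' k l * P i j)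
    - β • (P' k j * P i l)
    + (γ * sgnIn K (par k + par l)) • (P' k (neg j) * P i (neg l))

/-- The exchange relation between two families; with `α = u² - v²`, `β = u + v`, `γ = u - v` and
`P = T(u)`, `P' = T(v)` it is the defining relation of the super-Yangian. -/
def IsExchange (α β γ : K) (P P' : SignedIndex N → SignedIndex N → R) : Prop :=
  ∀ i k j l, exchangeLeft α β γ P P' i k j l = exchangeRight α β γ P P' i k j l

/-- The two families have supercommuting entries. -/
def FamilySuperCommute (K : Type*) [CommRing K] [Algebra ℂ K] [Algebra K R]
    (P Q : SignedIndex N → SignedIndex N → R) : Prop :=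
  ∀ i j k l, P i j * Q k l = sgnIn K ((par i + par j) * (par k + par l)) • (Q k l * P i j)

/-- The opposite matrix product `∑_a P_{a,j} Q_{i,a}`. -/
def oppositeMul (P Q : SignedIndex N → SignedIndex N → R) (i j : SignedIndex N) : R :=
  ∑ a, P a j * Q i a

theorem oppositeMul_mul_oppositeMul {P Q P' Q' : SignedIndex N → SignedIndex N → R}
    (h : FamilySuperCommute K Q P') (i j k l : SignedIndex N) :
    oppositeMul P Q i j * oppositeMul P' Q' k l = ∑ a, ∑ b,
      sgnIn K ((par i + par a) * (par b + par l)) • (P a j * P' b l * (Q i a * Q' k b)) := by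
  rw [oppositeMul, oppositeMul, Finset.sum_mul_sum]
  refine Finset.sum_congr rfl fun a _ => Finset.sum_congr rfl fun b _ => ?_
  rw [mul_assoc, ← mul_assoc (Q i a), h, smul_mul_assoc, mul_smul_comm]
  simp only [mul_assoc]

/-- The opposite product of two solutions of the exchange relation is a solution, if the entries of
the first supercommute with those of the second: the operators on the left-hand side act on the row
indices, which belong to `Q`, and those on the right-hand side on the column indices, which belong
to `P`; the summation indices transport them from one factor to the other. -/
theorem isExchange_oppositeMul {α β γ : K} {P Q P' Q' : SignedIndex N → SignedIndex N → R}
    (hP : IsExchange α β γ P P') (hQ : IsExchange α β γ Q Q')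
    (hQP' : FamilySuperCommute K Q P') (hQ'P : FamilySuperCommute K Q' P) :
    IsExchange α β γ (oppositeMul P Q) (oppositeMul P' Q') := by
  intro i k j l
  -- the row permutations act on the second factors, where the relation for `Q` applies
  have h1 : exchangeLeft α β γ (oppositeMul P Q) (oppositeMul P' Q') i k j l =
      ∑ a, ∑ b, sgnIn K ((par k + par a) * (par b + par l)) •
        (P a j * P' b l * exchangeLeft α β γ Q Q' i k a b) := by
    simp only [exchangeLeft, oppositeMul_mul_oppositeMul hQP', Finset.smul_sum,
      ← Finset.sum_sub_distrib, ← Finset.sum_add_distrib]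
    refine Finset.sum_congr rfl fun a _ => Finset.sum_congr rfl fun b _ => ?_
    rw [mul_add (P a j * P' b l), mul_sub (P a j * P' b l), mul_smul_comm, mul_smul_comm,
      mul_smul_comm]
    have e1 : sgnIn K (par i * par k + par i * par l + par k * par l) *
        sgnIn K ((par i + par a) * (par b + par l)) =
        sgnIn K ((par k + par a) * (par b + par l)) *
          sgnIn K (par i * par k + par i * par b + par k * par b) := by
      rw [← sgnIn_add, ← sgnIn_add]
      congr 1
      generalize par i = i, par k = k, par a = a, par b = b, par l = l
      revert i k a b l
      decide
    have e2 : sgnIn K (par k + par l) * sgnIn K ((par (neg k) + par a) * (par b + par l)) =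
        sgnIn K ((par k + par a) * (par b + par l)) * sgnIn K (par k + par b) := by
      rw [← sgnIn_add, ← sgnIn_add, par_neg]
      congr 1
      generalize par k = k, par a = a, par b = b, par l = l
      revert k a b l
      decide
    linear_combination (norm := module) (α * e1) • (P a j * P' b l * (Q i a * Q' k b)) +
      (γ * e2) • (P a j * P' b l * (Q (neg k) a * Q' (neg i) b))
  -- after renaming the summation indices, the column permutations have become row permutations of
  -- the first factors
  have h2 : (∑ a, ∑ b, sgnIn K ((par k + par a) * (par b + par l)) •
        (P a j * P' b l * exchangeRight α β γ Q Q' i k a b)) =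
      ∑ a, ∑ b, sgnIn K ((par k + par b) * (par a + par l)) •
        (exchangeLeft α β γ P P' a b j l * (Q' k b * Q i a)) := by
    have e : ∀ φ : SignedIndex N → SignedIndex N → R,
        ∑ a, ∑ b, φ a b = ∑ a, ∑ b, φ (neg b) (neg a) := by
      intro φ
      rw [Finset.sum_comm]
      rw [← sum_neg]
      exact Finset.sum_congr rfl fun a _ => (sum_neg _).symm
    simp only [exchangeLeft, exchangeRight, mul_add, mul_sub, add_mul, sub_mul, smul_add, smul_sub,
      Finset.sum_add_distrib, Finset.sum_sub_distrib]
    congr 1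
    · congr 1
      · refine Finset.sum_congr rfl fun a _ => Finset.sum_congr rfl fun b _ => ?_
        rw [mul_smul_comm, smul_mul_assoc]
        have e1 : sgnIn K ((par k + par a) * (par b + par l)) *
            sgnIn K (par i * par k + par i * par b + par k * par b +
              (par i + par a) * (par k + par b)) =
            sgnIn K ((par k + par b) * (par a + par l)) *
              sgnIn K (par a * par b + par a * par l + par b * par l) := by
          rw [← sgnIn_add, ← sgnIn_add]
          congr 1
          generalize par i = i, par k = k, par a = a, par b = b, par l = l
          revert i k a b l
          decide
        simp only [mul_add, add_mul] at e1
        linear_combination (norm := module) (α * e1) • (P a j * P' b l * (Q' k b * Q i a))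
      · rw [Finset.sum_comm]
        refine Finset.sum_congr rfl fun a _ => Finset.sum_congr rfl fun b _ => ?_
        rw [mul_smul_comm, smul_mul_assoc]
    · rw [e]
      refine Finset.sum_congr rfl fun a _ => Finset.sum_congr rfl fun b _ => ?_
      rw [neg_neg, neg_neg, mul_smul_comm, smul_mul_assoc]
      have e1 : sgnIn K ((par k + par (neg b)) * (par (neg a) + par l)) *
          sgnIn K (par k + par (neg a)) =
          sgnIn K ((par k + par b) * (par a + par l)) * sgnIn K (par b + par l) := by
        rw [← sgnIn_add, ← sgnIn_add, par_neg, par_neg]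
        congr 1
        generalize par k = k, par a = a, par b = b, par l = l
        revert k a b l
        decide
      simp only [mul_add, add_mul] at e1
      linear_combination (norm := module) (γ * e1) • (P (neg b) j * P' (neg a) l * (Q' k b * Q i a))
  have h3 : exchangeRight α β γ (oppositeMul P Q) (oppositeMul P' Q') i k j l =
      ∑ a, ∑ b, sgnIn K ((par k + par b) * (par a + par l)) •
        (exchangeRight α β γ P P' a b j l * (Q' k b * Q i a)) := by
    rw [Finset.sum_comm]
    simp only [exchangeRight, oppositeMul_mul_oppositeMul hQ'P, Finset.smul_sum,
      ← Finset.sum_sub_distrib, ← Finset.sum_add_distrib]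
    refine Finset.sum_congr rfl fun b _ => Finset.sum_congr rfl fun a _ => ?_
    rw [add_mul _ _ (Q' k b * Q i a), sub_mul _ _ (Q' k b * Q i a), smul_mul_assoc,
      smul_mul_assoc, smul_mul_assoc]
    have e1 : sgnIn K (par i * par k + par i * par l + par k * par l +
          (par i + par j) * (par k + par l)) *
        sgnIn K ((par k + par b) * (par a + par j)) =
        sgnIn K ((par k + par b) * (par a + par l)) *
          sgnIn K (par a * par b + par a * par l + par b * par l +
            (par a + par j) * (par b + par l)) := by
      rw [← sgnIn_add, ← sgnIn_add]
      congr 1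
      generalize par i = i, par k = k, par a = a, par b = b, par l = l, par j = j
      revert i k a b l j
      decide
    have e2 : sgnIn K (par k + par l) * sgnIn K ((par k + par b) * (par a + par (neg l))) =
        sgnIn K ((par k + par b) * (par a + par l)) * sgnIn K (par b + par l) := by
      rw [← sgnIn_add, ← sgnIn_add, par_neg]
      congr 1
      generalize par k = k, par a = a, par b = b, par l = l
      revert k a b l
      decide
    linear_combination (norm := module) (α * e1) • (P' b l * P a j * (Q' k b * Q i a)) +
      (γ * e2) • (P' b (neg j) * P a (neg l) * (Q' k b * Q i a))
  rw [h1, h3, Finset.sum_congr rfl fun a _ => Finset.sum_congr rfl fun b _ => by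
    rw [hQ i k a b], h2]
  exact Finset.sum_congr rfl fun a _ => Finset.sum_congr rfl fun b _ => by rw [hP a b j l]

end Exchange

/-! ### Generating series -/

/-- Extension of a sequence to the integers by zero; it makes the defining relations uniform in the
orders. -/
def extendZero {M : Type*} [Zero M] (τ : ℕ → M) : ℤ → M
  | .ofNat m => τ m
  | .negSucc _ => 0

section Series

variable {A : Type} [Ring A]

/-- Power series in two central variables `x`, `y` over `A`, where `x = u⁻¹` is the outer and
`y = v⁻¹` is the inner variable. -/
abbrev Series₂ (A : Type) [Ring A] : Type := PowerSeries (PowerSeries A)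

/-- The coefficient of `x^a y^b`, for integers `a` and `b`. -/
def coeff₂ : ℤ → ℤ → Series₂ A →+ A
  | .ofNat a, .ofNat b =>
    (PowerSeries.coeff b).toAddMonoidHom.comp (PowerSeries.coeff a).toAddMonoidHom
  | .ofNat _, .negSucc _ => 0
  | .negSucc _, _ => 0

theorem coeff₂_ext {f g : Series₂ A} (h : ∀ a b, coeff₂ a b f = coeff₂ a b g) : f = g :=
  PowerSeries.ext fun a => PowerSeries.ext fun b => h a b

/-- The variable `x`. -/
def varX : Series₂ A := PowerSeries.X

/-- The variable `y`. -/
def varY : Series₂ A := PowerSeries.C PowerSeries.X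

theorem coeff₂_varX_mul (a b : ℤ) (f : Series₂ A) :
    coeff₂ a b (varX * f) = coeff₂ (a - 1) b f := by
  rcases a with (_ | a) | a
  · rcases b with b | b
    · change PowerSeries.coeff b (PowerSeries.coeff 0 (PowerSeries.X * f)) = 0
      rw [PowerSeries.coeff_zero_X_mul, map_zero]
    · rfl
  · rw [show Int.ofNat (a + 1) - 1 = Int.ofNat a by simp]
    rcases b with b | b
    · change PowerSeries.coeff b (PowerSeries.coeff (a + 1) (PowerSeries.X * f)) = _
      rw [PowerSeries.coeff_succ_X_mul]
      rfl
    · rfl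
  · rfl

theorem coeff₂_varY_mul (a b : ℤ) (f : Series₂ A) :
    coeff₂ a b (varY * f) = coeff₂ a (b - 1) f := by
  rcases a with a | a
  · rcases b with (_ | b) | b
    · change PowerSeries.coeff 0 (PowerSeries.coeff a (PowerSeries.C PowerSeries.X * f)) = 0
      rw [PowerSeries.coeff_C_mul, PowerSeries.coeff_zero_X_mul]
    · rw [show Int.ofNat (b + 1) - 1 = Int.ofNat b by simp]
      change PowerSeries.coeff (b + 1) (PowerSeries.coeff a (PowerSeries.C PowerSeries.X * f)) = _
      rw [PowerSeries.coeff_C_mul, PowerSeries.coeff_succ_X_mul]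
      rfl
    · rfl
  · rfl

theorem varX_mem_center : (varX : Series₂ A) ∈ Subring.center (Series₂ A) :=
  Subring.mem_center_iff.mpr fun f => PowerSeries.commute_X f

theorem varY_mem_center : (varY : Series₂ A) ∈ Subring.center (Series₂ A) := by
  refine Subring.mem_center_iff.mpr fun f => PowerSeries.ext fun a => ?_
  rw [varY, PowerSeries.coeff_C_mul, PowerSeries.coeff_mul_C]
  exact PowerSeries.commute_X _

/-- The generating series of a sequence in the variable `x`. -/
def seriesX (τ : ℕ → A) : Series₂ A := PowerSeries.mk fun m => PowerSeries.C (τ m)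

/-- The generating series of a sequence in the variable `y`. -/
def seriesY (τ : ℕ → A) : Series₂ A := PowerSeries.C (PowerSeries.mk τ)

theorem coeff₂_seriesX_mul_seriesY (a b : ℤ) (σ τ : ℕ → A) :
    coeff₂ a b (seriesX σ * seriesY τ) = extendZero σ a * extendZero τ b := by
  rcases a with a | a
  · rcases b with b | b
    · change PowerSeries.coeff b (PowerSeries.coeff a (seriesX σ * seriesY τ)) = σ a * τ b
      rw [seriesX, seriesY, PowerSeries.coeff_mul_C, PowerSeries.coeff_mk, PowerSeries.coeff_C_mul,
        PowerSeries.coeff_mk]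
    · exact (mul_zero _).symm
  · exact (zero_mul _).symm

theorem coeff₂_seriesY_mul_seriesX (a b : ℤ) (σ τ : ℕ → A) :
    coeff₂ a b (seriesY τ * seriesX σ) = extendZero τ b * extendZero σ a := by
  rcases a with a | a
  · rcases b with b | b
    · change PowerSeries.coeff b (PowerSeries.coeff a (seriesY τ * seriesX σ)) = τ b * σ a
      rw [seriesX, seriesY, PowerSeries.coeff_C_mul, PowerSeries.coeff_mk, PowerSeries.coeff_mul_C,
        PowerSeries.coeff_mk]
    · exact (zero_mul _).symm
  · exact (mul_zero _).symm

variable [Algebra ℂ A]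

theorem coeff₂_smul (a b : ℤ) (c : ℂ) (f : Series₂ A) :
    coeff₂ a b (c • f) = c • coeff₂ a b f := by
  rcases a with a | a
  · rcases b with b | b
    · rfl
    · exact (smul_zero _).symm
  · exact (smul_zero _).symm

/-- The RTT relations between the coefficients of a family of sequences; for the generators of the
free algebra these are the first defining relations of the super-Yangian. -/
def IsRTT (τ : SignedIndex N → SignedIndex N → ℕ → A) : Prop :=
  ∀ (m r : ℤ) (i j k l : SignedIndex N),
    sgn (par i * par k + par i * par l + par k * par l) •
        ((extendZero (τ i j) (m + 1) * extendZero (τ k l) (r - 1) -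
            sgn ((par i + par j) * (par k + par l)) •
              (extendZero (τ k l) (r - 1) * extendZero (τ i j) (m + 1))) -
          (extendZero (τ i j) (m - 1) * extendZero (τ k l) (r + 1) -
            sgn ((par i + par j) * (par k + par l)) •
              (extendZero (τ k l) (r + 1) * extendZero (τ i j) (m - 1)))) =
      extendZero (τ k j) m * extendZero (τ i l) (r - 1)
        + extendZero (τ k j) (m - 1) * extendZero (τ i l) r
        - extendZero (τ k j) (r - 1) * extendZero (τ i l) m
        - extendZero (τ k j) r * extendZero (τ i l) (m - 1)
        + sgn (par k + par l) •
          (-(extendZero (τ (neg k) j) m * extendZero (τ (neg i) l) (r - 1))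
            + extendZero (τ (neg k) j) (m - 1) * extendZero (τ (neg i) l) r
            + extendZero (τ k (neg j)) (r - 1) * extendZero (τ i (neg l)) m
            - extendZero (τ k (neg j)) r * extendZero (τ i (neg l)) (m - 1))

/-- The centre of the ring of power series, as a ring of scalars. -/
def CenterScalars (A : Type) [Ring A] [Algebra ℂ A] : Type :=
  Subalgebra.center ℂ (Series₂ A)

instance : CommRing (CenterScalars A) :=
  inferInstanceAs (CommRing (Subalgebra.center ℂ (Series₂ A)))

instance : Algebra ℂ (CenterScalars A) :=
  inferInstanceAs (Algebra ℂ (Subalgebra.center ℂ (Series₂ A)))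

instance : Algebra (CenterScalars A) (Series₂ A) :=
  (Subalgebra.center ℂ (Series₂ A)).val.toRingHom.toAlgebra' fun c f =>
    (Subalgebra.mem_center_iff.mp c.2 f).symm

theorem sgnIn_smul (a : ZMod 2) (f : Series₂ A) :
    sgnIn (CenterScalars A) a • f = sgn a • f := by
  rcases zmod2_cases a with rfl | rfl
  · rw [sgnIn, sgn_zero, map_one, one_smul, one_smul]
  · rw [sgnIn, sgn_one, map_neg, map_one, neg_smul, neg_smul, one_smul, one_smul]

/-- The variable `x` as a central scalar. -/
def centralX (A : Type) [Ring A] [Algebra ℂ A] : CenterScalars A := ⟨varX, varX_mem_center⟩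

/-- The variable `y` as a central scalar. -/
def centralY (A : Type) [Ring A] [Algebra ℂ A] : CenterScalars A := ⟨varY, varY_mem_center⟩

/-- The central scalar `x² y² (u² - v²)`. -/
def scalarα (A : Type) [Ring A] [Algebra ℂ A] : CenterScalars A :=
  centralY A * centralY A - centralX A * centralX A

/-- The central scalar `x² y² (u + v)`. -/
def scalarβ (A : Type) [Ring A] [Algebra ℂ A] : CenterScalars A :=
  centralX A * centralY A * (centralX A + centralY A)

/-- The central scalar `x² y² (u - v)`. -/
def scalarγ (A : Type) [Ring A] [Algebra ℂ A] : CenterScalars A :=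
  centralX A * centralY A * (centralY A - centralX A)

theorem coeff₂_centralX_smul (a b : ℤ) (f : Series₂ A) :
    coeff₂ a b (centralX A • f) = coeff₂ (a - 1) b f := coeff₂_varX_mul a b f

theorem coeff₂_centralY_smul (a b : ℤ) (f : Series₂ A) :
    coeff₂ a b (centralY A • f) = coeff₂ a (b - 1) f := coeff₂_varY_mul a b f

theorem coeff₂_scalarα_smul (m r : ℤ) (f : Series₂ A) :
    coeff₂ (m + 1) (r + 1) (scalarα A • f) =
      coeff₂ (m + 1) (r - 1) f - coeff₂ (m - 1) (r + 1) f := by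
  simp only [scalarα, sub_smul, mul_smul, map_sub, coeff₂_centralX_smul, coeff₂_centralY_smul]
  rw [show r + 1 - 1 - 1 = r - 1 by ring, show m + 1 - 1 - 1 = m - 1 by ring]

theorem coeff₂_scalarβ_smul (m r : ℤ) (f : Series₂ A) :
    coeff₂ (m + 1) (r + 1) (scalarβ A • f) =
      coeff₂ m (r - 1) f + coeff₂ (m - 1) r f := by
  simp only [scalarβ, add_smul, mul_smul, smul_add, map_add, coeff₂_centralX_smul,
    coeff₂_centralY_smul, add_sub_cancel_right]
  exact add_comm _ _

theorem coeff₂_scalarγ_smul (m r : ℤ) (f : Series₂ A) :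
    coeff₂ (m + 1) (r + 1) (scalarγ A • f) =
      coeff₂ m (r - 1) f - coeff₂ (m - 1) r f := by
  simp only [scalarγ, sub_smul, mul_smul, smul_sub, map_sub, coeff₂_centralX_smul,
    coeff₂_centralY_smul, add_sub_cancel_right]

/-- The RTT relations between the coefficients are equivalent to the exchange relation between the
generating series, multiplied by `x² y² = u⁻² v⁻²`. -/
theorem isRTT_iff_isExchange (τ : SignedIndex N → SignedIndex N → ℕ → A) :
    IsRTT τ ↔ IsExchange (scalarα A) (scalarβ A) (scalarγ A)
      (fun i j => seriesX (τ i j)) (fun i j => seriesY (τ i j)) := by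
  have hl := fun (m r : ℤ) (i j k l : SignedIndex N) => congrArg (coeff₂ (m + 1) (r + 1))
    (exchangeLeft.eq_1 (scalarα A) (scalarβ A) (scalarγ A)
      (fun i j => seriesX (τ i j)) (fun i j => seriesY (τ i j)) i k j l)
  have hr := fun (m r : ℤ) (i j k l : SignedIndex N) => congrArg (coeff₂ (m + 1) (r + 1))
    (exchangeRight.eq_1 (scalarα A) (scalarβ A) (scalarγ A)
      (fun i j => seriesX (τ i j)) (fun i j => seriesY (τ i j)) i k j l)
  simp only [map_add, map_sub, mul_smul, sgnIn_smul, coeff₂_scalarα_smul, coeff₂_scalarβ_smul,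
    coeff₂_scalarγ_smul, coeff₂_smul, coeff₂_seriesX_mul_seriesY,
    coeff₂_seriesY_mul_seriesX] at hl hr
  constructor
  · intro h i k j l
    refine coeff₂_ext fun a b => ?_
    obtain ⟨m, rfl⟩ : ∃ m, a = m + 1 := ⟨a - 1, by ring⟩
    obtain ⟨r, rfl⟩ : ∃ r, b = r + 1 := ⟨b - 1, by ring⟩
    rw [hl, hr, sgn_add _ ((par i + par j) * (par k + par l))]
    linear_combination (norm := module) h m r i j k l
  · intro h m r i j k l
    have e := congrArg (coeff₂ (m + 1) (r + 1)) (h i k j l)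
    rw [hl, hr, sgn_add _ ((par i + par j) * (par k + par l))] at e
    linear_combination (norm := module) e

theorem familySuperCommute_seriesX_seriesY {σ τ : SignedIndex N → SignedIndex N → ℕ → A}
    (h : ∀ i j k l m r, σ i j m * τ k l r =
      sgn ((par i + par j) * (par k + par l)) • (τ k l r * σ i j m)) :
    FamilySuperCommute (CenterScalars A) (fun i j => seriesX (σ i j))
      (fun i j => seriesY (τ i j)) := by
  intro i j k l
  refine coeff₂_ext fun a b => ?_
  rw [sgnIn_smul, coeff₂_smul, coeff₂_seriesX_mul_seriesY, coeff₂_seriesY_mul_seriesX]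
  rcases a with a | a
  · rcases b with b | b
    · exact h i j k l a b
    · simp [extendZero]
  · simp [extendZero]

theorem familySuperCommute_seriesY_seriesX {σ τ : SignedIndex N → SignedIndex N → ℕ → A}
    (h : ∀ i j k l m r, σ i j m * τ k l r =
      sgn ((par i + par j) * (par k + par l)) • (τ k l r * σ i j m)) :
    FamilySuperCommute (CenterScalars A) (fun i j => seriesY (σ i j))
      (fun i j => seriesX (τ i j)) := by
  intro i j k l
  refine coeff₂_ext fun a b => ?_
  rw [sgnIn_smul, coeff₂_smul, coeff₂_seriesX_mul_seriesY, coeff₂_seriesY_mul_seriesX]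
  rcases a with a | a
  · rcases b with b | b
    · exact h i j k l b a
    · simp [extendZero]
  · simp [extendZero]

/-- The coefficients of the opposite product of two generating matrices. -/
def convolution (σ τ : SignedIndex N → SignedIndex N → ℕ → A) (i j : SignedIndex N) (r : ℕ) : A :=
  ∑ s ∈ Finset.HasAntidiagonal.antidiagonal r, ∑ k, σ k j s.1 * τ i k s.2

/-- Opposite products of supercommuting solutions of the RTT relations are solutions. -/
theorem isRTT_convolution {σ τ : SignedIndex N → SignedIndex N → ℕ → A} (hσ : IsRTT σ)
    (hτ : IsRTT τ) (h : ∀ i j k l m r, τ i j m * σ k l r =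
      sgn ((par i + par j) * (par k + par l)) • (σ k l r * τ i j m)) :
    IsRTT (convolution σ τ) := by
  rw [isRTT_iff_isExchange] at hσ hτ ⊢
  have key := isExchange_oppositeMul hσ hτ (familySuperCommute_seriesX_seriesY h)
    (familySuperCommute_seriesY_seriesX h)
  convert key using 1
  · funext i j
    refine PowerSeries.ext fun r => ?_
    rw [oppositeMul, map_sum, seriesX, PowerSeries.coeff_mk, convolution, Finset.sum_comm, map_sum]
    refine Finset.sum_congr rfl fun k _ => ?_
    rw [PowerSeries.coeff_mul, map_sum]
    refine Finset.sum_congr rfl fun s _ => ?_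
    rw [seriesX, seriesX, PowerSeries.coeff_mk, PowerSeries.coeff_mk, map_mul]
  · funext i j
    rw [oppositeMul]
    simp only [seriesY]
    simp only [← map_mul, ← map_sum]
    congr 1
    refine PowerSeries.ext fun r => ?_
    rw [PowerSeries.coeff_mk, map_sum, convolution, Finset.sum_comm]
    refine Finset.sum_congr rfl fun k _ => ?_
    rw [PowerSeries.coeff_mul]
    refine Finset.sum_congr rfl fun s _ => ?_
    rw [PowerSeries.coeff_mk, PowerSeries.coeff_mk]

end Series

/-! ### The universal property of the super-Yangian -/

theorem T_zero (i j : SignedIndex N) : T 0 i j = if i = j then 1 else 0 := by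
  change RingQuot.mkAlgHom ℂ YangianRel (if i = j then 1 else 0) = _
  split_ifs
  · exact map_one _
  · exact map_zero _

theorem T_eq_extendZero (m : ℤ) (i j : SignedIndex N) :
    T m i j = extendZero (fun n : ℕ => T n i j) m := by
  rcases m with m | m
  · rfl
  · exact map_zero _

theorem T_mem (m : ℤ) (i j : SignedIndex N) :
    T m i j ∈ (yangian N).grading (par i + par j) := by
  rw [mem_grading]
  change yangianParity (RingQuot.mkAlgHom ℂ YangianRel (freeT m i j)) = _
  rw [yangianParity, RingQuot.liftAlgHom_mkAlgHom_apply, AlgHom.comp_apply, freeParity_freeT,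
    map_smul]
  rfl

theorem T_neg_neg (m : ℕ) (i j : SignedIndex N) :
    T m (neg i) (neg j) = (-1 : ℂ) ^ m • T m i j := by
  have h := RingQuot.mkAlgHom_rel ℂ (YangianRel.symm m i j)
  rw [map_smul] at h
  exact h

theorem isRTT_T : IsRTT (fun (i j : SignedIndex N) (m : ℕ) => T m i j) := by
  intro m r i j k l
  have h := RingQuot.mkAlgHom_rel ℂ (YangianRel.rtt m r i j k l)
  simp only [freeBracket, map_smul, map_sub, map_add, map_neg, map_mul] at h
  simp only [← T_eq_extendZero]
  exact h

theorem yangian_algHom_ext {R : Type} [Ring R] [Algebra ℂ R] {F G : yangian N →ₐ[ℂ] R}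
    (h : ∀ (m : ℕ) i j, F (T m i j) = G (T m i j)) : F = G := by
  apply RingQuot.ringQuot_ext'
  apply FreeAlgebra.hom_ext
  funext g
  exact h (g.1 + 1) g.2.1 g.2.2

/-- The universal property of the super-Yangian. -/
theorem exists_yangian_lift {A : SuperAlgebra} (τ : SignedIndex N → SignedIndex N → ℕ → A)
    (h0 : ∀ i j, τ i j 0 = if i = j then 1 else 0)
    (hp : ∀ i j m, τ i j m ∈ A.grading (par i + par j)) (hrtt : IsRTT τ)
    (hsymm : ∀ i j m, τ (neg i) (neg j) m = (-1 : ℂ) ^ m • τ i j m) :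
    ∃ F : Hom (yangian N) A, ∀ (m : ℕ) i j, F (T m i j) = τ i j m := by
  let F₀ : FreeYangian N →ₐ[ℂ] A := FreeAlgebra.lift ℂ fun g => τ g.2.1 g.2.2 (g.1 + 1)
  have hF₀ : ∀ m i j, F₀ (freeT m i j) = extendZero (τ i j) m := by
    intro m i j
    rcases m with (_ | m) | m
    · change F₀ (if i = j then 1 else 0) = τ i j 0
      rw [h0]
      split_ifs
      · exact map_one _
      · exact map_zero _
    · exact FreeAlgebra.lift_ι_apply _ _
    · exact map_zero _
  let F₁ : yangian N →ₐ[ℂ] A := RingQuot.liftAlgHom ℂ (s := YangianRel) ⟨F₀, by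
    intro u v h
    cases h with
    | rtt m r i j k l =>
      simp only [freeBracket, map_smul, map_sub, map_add, map_neg, map_mul, hF₀]
      exact hrtt m r i j k l
    | symm m i j =>
      rw [map_smul, hF₀, hF₀]
      exact hsymm i j m⟩
  have hF₁ : ∀ (m : ℕ) i j, F₁ (T m i j) = τ i j m := by
    intro m i j
    refine (RingQuot.liftAlgHom_mkAlgHom_apply ..).trans ?_
    exact hF₀ m i j
  refine ⟨⟨F₁, fun y => ?_⟩, hF₁⟩
  have key : F₁.comp (yangian N).parity = A.parity.comp F₁ := by
    apply yangian_algHom_ext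
    intro m i j
    rw [AlgHom.comp_apply, AlgHom.comp_apply, mem_grading.mp (T_mem m i j), map_smul, hF₁,
      mem_grading.mp (hp i j m)]
  exact DFunLike.congr_fun key y

/-! ### The opposite comultiplication -/

/-- The formula for the opposite comultiplication is an opposite product of generating matrices. -/
theorem sum_range_tmul_eq_convolution (r : ℕ) (i j : SignedIndex N) :
    ∑ s ∈ Finset.range (r + 1), ∑ k : SignedIndex N,
      tmul (T ((r : ℤ) - s) k j) (T s i k : yangian N) =
    convolution (fun i j m => inclLeft (yangian N) (yangian N) (T (m : ℕ) i j))
      (fun i j m => inclRight (yangian N) (yangian N) (T (m : ℕ) i j)) i j r := by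
  rw [convolution, ← Finset.Nat.sum_antidiagonal_swap,
    Finset.Nat.sum_antidiagonal_eq_sum_range_succ_mk]
  refine Finset.sum_congr rfl fun s hs => Finset.sum_congr rfl fun k _ => ?_
  rw [tmul_eq, ← Nat.cast_sub (Nat.lt_succ_iff.mp (Finset.mem_range.mp hs))]
  rfl

theorem existsUnique_oppositeComultiplication (N : ℕ) :
    ∃! Δ : Hom (yangian N) (tensor (yangian N) (yangian N)), IsOppositeComultiplication Δ := by
  let Y := yangian N
  let σ : SignedIndex N → SignedIndex N → ℕ → tensor Y Y :=
    fun i j m => inclLeft Y Y (T (m : ℕ) i j)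
  let τ : SignedIndex N → SignedIndex N → ℕ → tensor Y Y :=
    fun i j m => inclRight Y Y (T (m : ℕ) i j)
  have hmap : ∀ f : Hom Y (tensor Y Y), IsRTT (fun i j (m : ℕ) => f (T m i j)) := by
    intro f m r i j k l
    have h := congrArg f.toAlgHom (isRTT_T m r i j k l)
    have e : ∀ (m : ℤ) i j, extendZero (fun n : ℕ => f (T (n : ℤ) i j)) m =
        f (extendZero (fun n : ℕ => T (n : ℤ) i j) m) := by
      intro m i j
      rcases m with m | m
      · rfl
      · exact (map_zero f.toAlgHom).symm
    simp only [map_smul, map_sub, map_add, _root_.map_neg, map_mul] at h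
    simp only [e]
    exact h
  obtain ⟨Δ, hΔ⟩ := exists_yangian_lift (A := tensor Y Y) (convolution σ τ)
    (by
      intro i j
      rw [convolution, Finset.Nat.antidiagonal_zero, Finset.sum_singleton]
      simp only [σ, τ, Nat.cast_zero, T_zero]
      rw [Finset.sum_eq_single i]
      · rw [if_pos rfl, map_one, mul_one]
        split_ifs
        · exact map_one _
        · exact map_zero _
      · intro k _ hk
        rw [if_neg hk.symm, map_zero, mul_zero]
      · simp)
    (by
      intro i j m
      refine Submodule.sum_mem _ fun s _ => Submodule.sum_mem _ fun k _ => ?_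
      have h := mul_mem_grading ((inclLeft Y Y).map_mem (T_mem s.1 k j))
        ((inclRight Y Y).map_mem (T_mem s.2 i k))
      have e : par k + par j + (par i + par k) = par i + par j := by
        generalize par i = a, par j = b, par k = c
        revert a b c
        decide
      rwa [e] at h)
    (isRTT_convolution (hmap _) (hmap _) (fun i j k l m r =>
      superCommute_inclLeft_inclRight.symm _ _ _ _ (T_mem m i j) (T_mem r k l)))
    (by
      intro i j m
      rw [convolution, convolution, Finset.smul_sum]
      refine Finset.sum_congr rfl fun s hs => ?_
      rw [← sum_neg, Finset.smul_sum]
      refine Finset.sum_congr rfl fun k _ => ?_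
      simp only [σ, τ, T_neg_neg, map_smul]
      rw [smul_mul_smul_comm, ← pow_add, Finset.HasAntidiagonal.mem_antidiagonal.mp hs])
  refine ⟨Δ, fun r i j => (hΔ r i j).trans (sum_range_tmul_eq_convolution r i j).symm, ?_⟩
  intro Δ' hΔ'
  refine Hom.ext (yangian_algHom_ext fun m i j => ?_)
  exact (hΔ' m i j).trans ((sum_range_tmul_eq_convolution m i j).trans (hΔ m i j).symm)

/-! ### Geometric series solve the RTT relations -/

section Geometric

variable {A : Type} [Ring A]

/-- The powers of a matrix for the opposite matrix product. -/
def oppositePow (M : SignedIndex N → SignedIndex N → A) :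
    SignedIndex N → SignedIndex N → ℕ → A
  | i, j, 0 => if i = j then 1 else 0
  | i, j, r + 1 => ∑ k, M k j * oppositePow M i k r

variable {M : SignedIndex N → SignedIndex N → A}

theorem oppositePow_add (i l : SignedIndex N) (r m : ℕ) :
    oppositePow M i l (r + m) = ∑ a, oppositePow M a l r * oppositePow M i a m := by
  induction r generalizing l with
  | zero => simp [oppositePow]
  | succ r ih =>
    rw [Nat.succ_add, oppositePow]
    simp only [ih, oppositePow, Finset.mul_sum, Finset.sum_mul]
    rw [Finset.sum_comm]
    simp only [mul_assoc]

theorem oppositePow_one (i j : SignedIndex N) : oppositePow M i j 1 = M i j := by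
  simp [oppositePow]

theorem oppositePow_succ_eq (r : ℕ) :
    (fun i j => oppositePow M i j (r + 1)) = oppositeMul M fun i j => oppositePow M i j r := rfl

variable [Algebra ℂ A]

/-- The supercommutator `[P_{i,j}, Q_{k,l}]` with the sign of the defining relations of the
super-Yangian. -/
def signedBracket (P Q : SignedIndex N → SignedIndex N → A) (i j k l : SignedIndex N) : A :=
  sgn (par i * par k + par i * par l + par k * par l) •
    (P i j * Q k l - sgn ((par i + par j) * (par k + par l)) • (Q k l * P i j))

/-- The supercommutation relations of the generators of first order with a family `P`. -/
def FirstOrderRelation (M P : SignedIndex N → SignedIndex N → A) : Prop :=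
  ∀ i j k l, signedBracket M P i j k l =
    (if k = j then P i l else 0) - (if i = l then P k j else 0) +
      sgn (par k + par l) • (-(if neg k = j then P (neg i) l else 0) +
        (if i = neg l then P k (neg j) else 0))

theorem neg_eq_iff {i j : SignedIndex N} : neg i = j ↔ i = neg j :=
  ⟨fun h => by rw [← h, neg_neg], fun h => by rw [h, neg_neg]⟩

theorem neg_inj {i j : SignedIndex N} : neg i = neg j ↔ i = j := by
  rw [neg_eq_iff, neg_neg]

theorem oppositePow_neg_neg (hM : ∀ i j, M (neg i) (neg j) = -M i j) (i j : SignedIndex N) (m : ℕ) :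
    oppositePow M (neg i) (neg j) m = (-1 : ℂ) ^ m • oppositePow M i j m := by
  induction m generalizing j with
  | zero => simp [oppositePow, neg_inj]
  | succ m ih =>
    rw [oppositePow, oppositePow, ← sum_neg, Finset.smul_sum]
    refine Finset.sum_congr rfl fun k _ => ?_
    rw [ih, hM, mul_smul_comm, pow_succ, mul_smul, neg_one_smul, neg_mul]

/-- The supercommutator is a derivation in its second argument. -/
theorem signedBracket_oppositeMul_right {P Q : SignedIndex N → SignedIndex N → A}
    (i j k l : SignedIndex N) :
    signedBracket M (oppositeMul P Q) i j k l = ∑ a,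
      (sgn ((par i + par l) * (par k + par a)) • (signedBracket M P i j a l * Q k a) +
        sgn ((par k + par j) * (par a + par l)) • (P a l * signedBracket M Q i j k a)) := by
  rw [signedBracket, oppositeMul, Finset.mul_sum, Finset.sum_mul, Finset.smul_sum,
    ← Finset.sum_sub_distrib, Finset.smul_sum]
  refine Finset.sum_congr rfl fun a _ => ?_
  simp only [signedBracket, smul_mul_assoc, mul_smul_comm, sub_mul, mul_sub, smul_sub, smul_smul,
    ← sgn_add, mul_assoc]
  have e1 : (par i + par l) * (par k + par a) + (par i * par a + par i * par l + par a * par l) =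
      par i * par k + par i * par l + par k * par l := by
    generalize par i = i, par k = k, par a = a, par l = l
    revert i k a l
    decide
  have e2 : par i * par k + par i * par l + par k * par l + (par i + par j) * (par a + par l) =
      (par k + par j) * (par a + par l) + (par i * par k + par i * par a + par k * par a) := by
    generalize par i = i, par k = k, par a = a, par l = l, par j = j
    revert i k a l j
    decide
  have e3 : par i * par k + par i * par l + par k * par l + (par i + par j) * (par k + par l) =
      (par k + par j) * (par a + par l) + (par i * par k + par i * par a + par k * par a +
      (par i + par j) * (par k + par a)) := by
    generalize par i = i, par k = k, par a = a, par l = l, par j = j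
    revert i k a l j
    decide
  simp only [← add_assoc] at e1 e2 e3 ⊢
  rw [e1, e2, e3]
  abel

/-- The supercommutator is a derivation in its first argument. -/
theorem signedBracket_oppositeMul_left {P Q : SignedIndex N → SignedIndex N → A}
    (i j k l : SignedIndex N) :
    signedBracket (oppositeMul P Q) M i j k l = ∑ a,
      (P a j * signedBracket Q M i a k l + signedBracket P M a j k l * Q i a) := by
  rw [signedBracket, oppositeMul, Finset.mul_sum, Finset.sum_mul, Finset.smul_sum,
    ← Finset.sum_sub_distrib, Finset.smul_sum]
  refine Finset.sum_congr rfl fun a _ => ?_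
  simp only [signedBracket, smul_mul_assoc, mul_smul_comm, sub_mul, mul_sub, smul_sub, smul_smul,
    ← sgn_add, mul_assoc]
  have e1 : par i * par k + par i * par l + par k * par l + (par i + par a) * (par k + par l) =
      par a * par k + par a * par l + par k * par l := by
    generalize par i = i, par k = k, par a = a, par l = l
    revert i k a l
    decide
  have e2 : par i * par k + par i * par l + par k * par l + (par i + par j) * (par k + par l) =
      par a * par k + par a * par l + par k * par l + (par a + par j) * (par k + par l) := by
    generalize par i = i, par k = k, par a = a, par l = l, par j = j
    revert i k a l j
    decide
  rw [e1, e2]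
  abel

theorem smul_ite_congr {c : Prop} [Decidable c] {s t : ℂ} (v : A) (h : c → s = t) :
    s • (if c then v else 0) = t • if c then v else 0 := by
  split_ifs with hc
  · rw [h hc]
  · rw [smul_zero, smul_zero]

theorem signedBracket_oppositePow_zero (P : SignedIndex N → SignedIndex N → A)
    (i j k l : SignedIndex N) : signedBracket (fun i j => oppositePow M i j 0) P i j k l = 0 := by
  simp only [signedBracket, oppositePow]
  by_cases h : i = j
  · subst h
    simp [CharTwo.add_self_eq_zero, sgn_zero]
  · simp [h]

theorem signedBracket_oppositePow_zero_right (P : SignedIndex N → SignedIndex N → A)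
    (i j k l : SignedIndex N) : signedBracket P (fun i j => oppositePow M i j 0) i j k l = 0 := by
  simp only [signedBracket, oppositePow]
  by_cases h : k = l
  · subst h
    simp [CharTwo.add_self_eq_zero, sgn_zero]
  · simp [h]

/-- By the derivation property, the relations of first order extend from the matrix to its
powers. -/
theorem firstOrderRelation_oppositePow (hM : FirstOrderRelation M M) (r : ℕ) :
    FirstOrderRelation M fun i j => oppositePow M i j r := by
  induction r with
  | zero =>
    intro i j k l
    rw [signedBracket_oppositePow_zero_right]
    simp only [oppositePow, neg_eq_iff]
    split_ifs <;> simp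
  | succ r ih =>
    intro i j k l
    rw [oppositePow_succ_eq, signedBracket_oppositeMul_right]
    let τ := fun i j => oppositePow M i j r
    -- of the eight sums produced by the two relations, `t1` cancels `t6` and `t3` cancels `t8`;
    -- the other four assemble to the powers of order `r + 1`
    have t1 : ∑ a, sgn ((par i + par l) * (par k + par a)) •
        ((if a = j then M i l else 0) * τ k a) =
        sgn ((par i + par l) * (par k + par j)) • (M i l * τ k j) := by
      rw [Finset.sum_eq_single j] <;> simp +contextual
    have t2 : ∑ a, sgn ((par i + par l) * (par k + par a)) •
        ((if i = l then M a j else 0) * τ k a) =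
        if i = l then oppositeMul M τ k j else 0 := by
      split_ifs with h
      · subst h
        refine Finset.sum_congr rfl fun a _ => ?_
        rw [CharTwo.add_self_eq_zero, zero_mul, sgn_zero, one_smul]
      · simp
    have t3 : ∑ a, sgn ((par i + par l) * (par k + par a)) • sgn (par a + par l) •
        ((if neg a = j then M (neg i) l else 0) * τ k a) =
        sgn ((par k + par j) * (par i + par l) + par i + par j + 1) •
          (M (neg i) l * τ k (neg j)) := by
      rw [Finset.sum_eq_single (neg j)]
      · rw [if_pos (neg_neg j), smul_smul, ← sgn_add, par_neg]
        congr 2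
        generalize par i = i, par k = k, par l = l, par j = j
        revert i k l j
        decide
      · intro a _ ha
        rw [if_neg fun h => ha (neg_eq_iff.mp h), zero_mul, smul_zero, smul_zero]
      · simp
    have t4 : ∑ a, sgn ((par i + par l) * (par k + par a)) • sgn (par a + par l) •
        ((if i = neg l then M a (neg j) else 0) * τ k a) =
        sgn (par k + par l) • if i = neg l then oppositeMul M τ k (neg j) else 0 := by
      split_ifs with h
      · subst h
        rw [oppositeMul, Finset.smul_sum]
        refine Finset.sum_congr rfl fun a _ => ?_
        rw [smul_smul, ← sgn_add, par_neg]
        congr 2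
        generalize par k = k, par l = l, par a = a
        revert k l a
        decide
      · simp
    have t5 : ∑ a, sgn ((par k + par j) * (par a + par l)) •
        (M a l * (if k = j then τ i a else 0)) = if k = j then oppositeMul M τ i l else 0 := by
      split_ifs with h
      · subst h
        refine Finset.sum_congr rfl fun a _ => ?_
        rw [CharTwo.add_self_eq_zero, zero_mul, sgn_zero, one_smul]
      · simp
    have t6 : ∑ a, sgn ((par k + par j) * (par a + par l)) •
        (M a l * (if i = a then τ k j else 0)) =
        sgn ((par i + par l) * (par k + par j)) • (M i l * τ k j) := by
      rw [Finset.sum_eq_single i]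
      · rw [if_pos rfl, mul_comm (par k + par j)]
      · intro a _ ha
        rw [if_neg ha.symm, mul_zero, smul_zero]
      · simp
    have t7 : ∑ a, sgn ((par k + par j) * (par a + par l)) • sgn (par k + par a) •
        (M a l * (if neg k = j then τ (neg i) a else 0)) =
        sgn (par k + par l) • if neg k = j then oppositeMul M τ (neg i) l else 0 := by
      split_ifs with h
      · subst h
        rw [oppositeMul, Finset.smul_sum]
        refine Finset.sum_congr rfl fun a _ => ?_
        rw [smul_smul, ← sgn_add, par_neg]
        congr 2
        generalize par k = k, par l = l, par a = a
        revert k l a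
        decide
      · simp
    have t8 : ∑ a, sgn ((par k + par j) * (par a + par l)) • sgn (par k + par a) •
        (M a l * (if i = neg a then τ k (neg j) else 0)) =
        sgn ((par k + par j) * (par i + par l) + par i + par j + 1) •
          (M (neg i) l * τ k (neg j)) := by
      rw [Finset.sum_eq_single (neg i)]
      · rw [if_pos (neg_neg i).symm, smul_smul, ← sgn_add, par_neg]
        congr 2
        generalize par i = i, par k = k, par l = l, par j = j
        revert i k l j
        decide
      · intro a _ ha
        rw [if_neg fun h => ha (neg_eq_iff.mpr h).symm, mul_zero, smul_zero, smul_zero]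
      · simp
    have key : ∀ a, sgn ((par i + par l) * (par k + par a)) • (signedBracket M M i j a l * τ k a) +
        sgn ((par k + par j) * (par a + par l)) • (M a l * signedBracket M τ i j k a) =
        sgn ((par i + par l) * (par k + par a)) • ((if a = j then M i l else 0) * τ k a) -
        sgn ((par i + par l) * (par k + par a)) • ((if i = l then M a j else 0) * τ k a) -
        sgn ((par i + par l) * (par k + par a)) • sgn (par a + par l) •
          ((if neg a = j then M (neg i) l else 0) * τ k a) +
        sgn ((par i + par l) * (par k + par a)) • sgn (par a + par l) •
          ((if i = neg l then M a (neg j) else 0) * τ k a) +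
        sgn ((par k + par j) * (par a + par l)) • (M a l * (if k = j then τ i a else 0)) -
        sgn ((par k + par j) * (par a + par l)) • (M a l * (if i = a then τ k j else 0)) -
        sgn ((par k + par j) * (par a + par l)) • sgn (par k + par a) •
          (M a l * (if neg k = j then τ (neg i) a else 0)) +
        sgn ((par k + par j) * (par a + par l)) • sgn (par k + par a) •
          (M a l * (if i = neg a then τ k (neg j) else 0)) := by
      intro a
      rw [hM i j a l, ih i j k a]
      simp only [add_mul _ _ (τ k a), sub_mul _ _ (τ k a), mul_add (M a l), mul_sub (M a l),
        smul_mul_assoc, mul_smul_comm, neg_mul, mul_neg, τ]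
      module
    rw [Finset.sum_congr rfl fun a _ => key a]
    simp only [Finset.sum_add_distrib, Finset.sum_sub_distrib]
    rw [t1, t2, t3, t4, t5, t6, t7, t8]
    change _ = (if k = j then oppositeMul M τ i l else 0) -
      (if i = l then oppositeMul M τ k j else 0) + sgn (par k + par l) •
        (-(if neg k = j then oppositeMul M τ (neg i) l else 0) +
          (if i = neg l then oppositeMul M τ k (neg j) else 0))
    module

/-- The recursion in the order of the first argument: it splits off one factor by the derivation
property and applies the relations of first order to it. -/
theorem signedBracket_oppositePow_succ (hM : FirstOrderRelation M M)
    (hneg : ∀ i j, M (neg i) (neg j) = -M i j) (m r : ℕ) (i j k l : SignedIndex N) :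
    signedBracket (fun i j => oppositePow M i j (m + 1)) (fun i j => oppositePow M i j r) i j k l =
      (∑ a, M a j * signedBracket (fun i j => oppositePow M i j m)
        (fun i j => oppositePow M i j r) i a k l) +
      (if k = j then oppositePow M i l (r + m) else 0) -
      oppositePow M k j r * oppositePow M i l m +
      sgn (par k + par l) •
        (-(if neg k = j then (-1 : ℂ) ^ m • oppositePow M (neg i) l (r + m) else 0) +
          oppositePow M k (neg j) r * oppositePow M i (neg l) m) := by
  rw [oppositePow_succ_eq, signedBracket_oppositeMul_left, Finset.sum_add_distrib]
  simp only [firstOrderRelation_oppositePow hM r _ j k l, add_sub_assoc, add_assoc]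
  congr 1
  have s1 : ∑ a, (if k = j then oppositePow M a l r else 0) * oppositePow M i a m =
      if k = j then oppositePow M i l (r + m) else 0 := by
    split_ifs
    · exact (oppositePow_add i l r m).symm
    · simp
  have s2 : ∑ a, (if a = l then oppositePow M k j r else 0) * oppositePow M i a m =
      oppositePow M k j r * oppositePow M i l m := by
    simp
  have s3 : ∑ a, (if neg k = j then oppositePow M (neg a) l r else 0) * oppositePow M i a m =
      if neg k = j then (-1 : ℂ) ^ m • oppositePow M (neg i) l (r + m) else 0 := by
    split_ifs
    · rw [oppositePow_add, ← sum_neg, Finset.smul_sum]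
      refine Finset.sum_congr rfl fun a _ => ?_
      have h := oppositePow_neg_neg hneg (neg i) a m
      rw [neg_neg] at h
      rw [neg_neg, h, mul_smul_comm]
    · simp
  have s4 : ∑ a, (if a = neg l then oppositePow M k (neg j) r else 0) * oppositePow M i a m =
      oppositePow M k (neg j) r * oppositePow M i (neg l) m := by
    simp
  have key : ∀ a, ((if k = j then oppositePow M a l r else 0) +
      (-(if a = l then oppositePow M k j r else 0) + sgn (par k + par l) •
        (-(if neg k = j then oppositePow M (neg a) l r else 0) +
          (if a = neg l then oppositePow M k (neg j) r else 0)))) * oppositePow M i a m =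
      (if k = j then oppositePow M a l r else 0) * oppositePow M i a m -
      (if a = l then oppositePow M k j r else 0) * oppositePow M i a m + sgn (par k + par l) •
        (-((if neg k = j then oppositePow M (neg a) l r else 0) * oppositePow M i a m) +
          (if a = neg l then oppositePow M k (neg j) r else 0) * oppositePow M i a m) := by
    intro a
    simp only [add_mul, neg_mul, smul_mul_assoc]
    abel
  simp only [sub_eq_add_neg, add_assoc] at key ⊢
  rw [Finset.sum_congr rfl fun a _ => key a]
  simp only [Finset.sum_add_distrib, Finset.sum_neg_distrib, ← Finset.smul_sum]
  rw [s1, s2, s3, s4]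

/-- The relations of first order with the roles of the two arguments exchanged. -/
theorem signedBracket_oppositePow_one_right (hM : FirstOrderRelation M M)
    (hneg : ∀ i j, M (neg i) (neg j) = -M i j) (m : ℕ) (i j k l : SignedIndex N) :
    signedBracket (fun i j => oppositePow M i j m) (fun i j => oppositePow M i j 1) i j k l =
      (if k = j then oppositePow M i l m else 0) - (if i = l then oppositePow M k j m else 0) +
      sgn (par k + par l) • ((if k = neg j then oppositePow M i (neg l) m else 0) -
        (if neg i = l then oppositePow M (neg k) j m else 0)) := by
  induction m generalizing j with
  | zero =>
    rw [signedBracket_oppositePow_zero]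
    simp only [oppositePow, neg_eq_iff]
    split_ifs <;> simp
  | succ m ih =>
    rw [signedBracket_oppositePow_succ hM hneg]
    simp only [ih]
    have s1 : ∑ a, M a j * (if k = a then oppositePow M i l m else 0) =
        M k j * oppositePow M i l m := by simp
    have s2 : ∑ a, M a j * (if i = l then oppositePow M k a m else 0) =
        if i = l then oppositePow M k j (m + 1) else 0 := by
      split_ifs
      · rfl
      · simp
    have s3 : ∑ a, M a j * (if k = neg a then oppositePow M i (neg l) m else 0) =
        -(M k (neg j) * oppositePow M i (neg l) m) := by
      rw [Finset.sum_eq_single (neg k)]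
      · have h := hneg k (neg j)
        rw [neg_neg] at h
        rw [if_pos (neg_neg k).symm, h, neg_mul]
      · intro a _ ha
        rw [if_neg fun h => ha (neg_eq_iff.mpr h).symm, mul_zero]
      · simp
    have s4 : ∑ a, M a j * (if neg i = l then oppositePow M (neg k) a m else 0) =
        if neg i = l then oppositePow M (neg k) j (m + 1) else 0 := by
      split_ifs
      · rfl
      · simp
    have e : (if neg k = j then (-1 : ℂ) ^ m • oppositePow M (neg i) l (1 + m) else 0) =
        -(if k = neg j then oppositePow M i (neg l) (m + 1) else 0) := by
      have h := oppositePow_neg_neg hneg i (neg l) (m + 1)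
      rw [neg_neg] at h
      simp only [neg_eq_iff]
      split_ifs
      · rw [add_comm 1 m, h, smul_smul, pow_succ, ← mul_assoc, ← pow_add, ← two_mul, pow_mul]
        simp
      · simp
    rw [e, add_comm 1 m]
    simp only [mul_add, mul_sub, mul_smul_comm, Finset.sum_add_distrib, Finset.sum_sub_distrib,
      ← Finset.smul_sum]
    rw [s1, s2, s3, s4, oppositePow_one, oppositePow_one]
    module

/-- The powers of a matrix of first order generators satisfy the RTT relations: both sides obey the
same recursion in the order of the first argument. -/
theorem isRTT_oppositePow (hM : FirstOrderRelation M M)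
    (hneg : ∀ i j, M (neg i) (neg j) = -M i j) : IsRTT (oppositePow M) := by
  let B := fun (m r : ℕ) => signedBracket (fun i j => oppositePow M i j m)
    (fun i j => oppositePow M i j r)
  have hone : ∀ (r : ℕ) (i j k l : SignedIndex N), B 1 r i j k l =
      oppositePow M k j 0 * oppositePow M i l r - oppositePow M k j r * oppositePow M i l 0
      + sgn (par k + par l) • (-(oppositePow M (neg k) j 0 * oppositePow M (neg i) l r)
          + oppositePow M k (neg j) r * oppositePow M i (neg l) 0) := by
    intro r i j k l
    have h := firstOrderRelation_oppositePow hM r i j k l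
    simp only [B, oppositePow_one]
    rw [h]
    simp [oppositePow]
  -- the relations for positive orders, by induction on the order of the first factor
  have main : ∀ (m r : ℕ) (i j k l : SignedIndex N),
      B (m + 2) r i j k l - B m (r + 2) i j k l =
        oppositePow M k j (m + 1) * oppositePow M i l r
        + oppositePow M k j m * oppositePow M i l (r + 1)
        - oppositePow M k j r * oppositePow M i l (m + 1)
        - oppositePow M k j (r + 1) * oppositePow M i l m
        + sgn (par k + par l) •
          (-(oppositePow M (neg k) j (m + 1) * oppositePow M (neg i) l r)
            + oppositePow M (neg k) j m * oppositePow M (neg i) l (r + 1)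
            + oppositePow M k (neg j) r * oppositePow M i (neg l) (m + 1)
            - oppositePow M k (neg j) (r + 1) * oppositePow M i (neg l) m) := by
    have shift : ∀ (n : ℕ) (k j : SignedIndex N) (v : A),
        ∑ a, M a j * (oppositePow M k a n * v) = oppositePow M k j (n + 1) * v := by
      intro n k j v
      simp only [oppositePow, Finset.sum_mul, mul_assoc]
    have shift' : ∀ (n : ℕ) (k j : SignedIndex N) (v : A),
        ∑ a, M a j * (oppositePow M k (neg a) n * v) = -(oppositePow M k (neg j) (n + 1) * v) := by
      intro n k j v
      rw [← sum_neg]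
      simp only [oppositePow, Finset.sum_mul, neg_neg, ← Finset.sum_neg_distrib]
      refine Finset.sum_congr rfl fun a _ => ?_
      have h := hneg a (neg j)
      rw [neg_neg] at h
      rw [h]
      noncomm_ring
    intro m r
    induction m with
    | zero =>
      intro i j k l
      have h := signedBracket_oppositePow_succ hM hneg 1 r i j k l
      have h0 := signedBracket_oppositePow_zero (M := M) (fun i j => oppositePow M i j (r + 2))
        i j k l
      have d1 : (if k = j then oppositePow M i l (r + 1) else 0) =
          oppositePow M k j 0 * oppositePow M i l (r + 1) := by
        simp [oppositePow]
      have d2 : (if neg k = j then (-1 : ℂ) ^ 1 • oppositePow M (neg i) l (r + 1) else 0) =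
          (-1 : ℂ) ^ 1 • (oppositePow M (neg k) j 0 * oppositePow M (neg i) l (r + 1)) := by
        simp [oppositePow]
      change B 2 r i j k l = (∑ a, M a j * B 1 r i a k l) + _ - _ + _ at h
      change B 0 (r + 2) i j k l = 0 at h0
      simp only [hone, mul_add, mul_sub, mul_smul_comm, mul_neg, Finset.sum_add_distrib,
        Finset.sum_sub_distrib, Finset.sum_neg_distrib, ← Finset.smul_sum, shift, shift'] at h
      rw [d1, d2] at h
      rw [Nat.zero_add, h, h0]
      module
    | succ m ih =>
      intro i j k l
      have h1 := signedBracket_oppositePow_succ hM hneg (m + 2) r i j k l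
      have h2 := signedBracket_oppositePow_succ hM hneg m (r + 2) i j k l
      change B (m + 1 + 2) r i j k l = (∑ a, M a j * B (m + 2) r i a k l) + _ - _ + _ at h1
      change B (m + 1) (r + 2) i j k l = (∑ a, M a j * B m (r + 2) i a k l) + _ - _ + _ at h2
      have h3 : (∑ a, M a j * B (m + 2) r i a k l) - ∑ a, M a j * B m (r + 2) i a k l =
          ∑ a, M a j * (B (m + 2) r i a k l - B m (r + 2) i a k l) := by
        simp only [mul_sub, Finset.sum_sub_distrib]
      simp only [ih, mul_add, mul_sub, mul_smul_comm, mul_neg, Finset.sum_add_distrib,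
        Finset.sum_sub_distrib, Finset.sum_neg_distrib, ← Finset.smul_sum, shift, shift'] at h3
      have e : (-1 : ℂ) ^ (m + 2) = (-1) ^ m := by rw [pow_add]; simp
      rw [show r + 2 + m = r + (m + 2) by ring] at h2
      rw [e] at h1
      rw [h1, h2, sub_eq_iff_eq_add.mp h3]
      module
  -- the relations that involve a coefficient of non-positive order are trivial or of first order
  have hz : ∀ (i j : SignedIndex N) (z : ℤ), z < 0 → extendZero (oppositePow M i j) z = 0 := by
    intro i j z hz
    obtain ⟨n, rfl⟩ := Int.eq_negSucc_of_lt_zero hz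
    rfl
  have hn : ∀ (i j : SignedIndex N) (z : ℤ) (n : ℕ), z = n →
      extendZero (oppositePow M i j) z = oppositePow M i j n := by
    rintro i j _ n rfl
    rfl
  intro m r i j k l
  rcases lt_or_ge m (-1) with hm | hm
  · simp [hz _ _ (m + 1) (by omega), hz _ _ m (by omega), hz _ _ (m - 1) (by omega)]
  rcases lt_or_ge r (-1) with hr | hr
  · simp [hz _ _ (r + 1) (by omega), hz _ _ r (by omega), hz _ _ (r - 1) (by omega)]
  rw [smul_sub]
  change signedBracket (fun i j => extendZero (oppositePow M i j) (m + 1))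
    (fun i j => extendZero (oppositePow M i j) (r - 1)) i j k l -
    signedBracket (fun i j => extendZero (oppositePow M i j) (m - 1))
    (fun i j => extendZero (oppositePow M i j) (r + 1)) i j k l = _
  rcases hm.eq_or_lt with rfl | hm
  · simp only [hz _ _ (-1) (by omega), hz _ _ (-1 - 1) (by omega), hn _ _ (-1 + 1) 0 (by omega),
      signedBracket_oppositePow_zero]
    simp [signedBracket]
  rcases hr.eq_or_lt with rfl | hr
  · simp only [hz _ _ (-1) (by omega), hz _ _ (-1 - 1) (by omega), hn _ _ (-1 + 1) 0 (by omega),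
      signedBracket_oppositePow_zero_right]
    simp [signedBracket]
  rcases (show 0 ≤ m by omega).eq_or_lt with rfl | hm
  · rcases (show 0 ≤ r by omega).eq_or_lt with rfl | hr
    · simp [hz _ _ (-1) (by omega), signedBracket]
    · obtain ⟨n, rfl⟩ : ∃ n : ℕ, r = n + 1 := ⟨(r - 1).toNat, by omega⟩
      have h := hone n i j k l
      simp only [hz _ _ (0 - 1) (by omega), hn _ _ (0 + 1) 1 (by omega), hn _ _ 0 0 (by omega),
        hn _ _ ((n : ℤ) + 1 - 1) n (by omega)]
      change B 1 n i j k l - _ = _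
      rw [h]
      simp [signedBracket]
  obtain ⟨p, rfl⟩ : ∃ p : ℕ, m = p + 1 := ⟨(m - 1).toNat, by omega⟩
  rcases (show 0 ≤ r by omega).eq_or_lt with rfl | hr
  · have h := signedBracket_oppositePow_one_right hM hneg p i j k l
    simp only [hz _ _ (0 - 1) (by omega), hn _ _ (0 + 1) 1 (by omega), hn _ _ 0 0 (by omega),
      hn _ _ ((p : ℤ) + 1 - 1) p (by omega)]
    rw [h]
    simp [signedBracket, oppositePow]
    module
  · obtain ⟨n, rfl⟩ : ∃ n : ℕ, r = n + 1 := ⟨(r - 1).toNat, by omega⟩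
    simp only [hn _ _ ((p : ℤ) + 1 + 1) (p + 2) (by push_cast; ring),
      hn _ _ ((p : ℤ) + 1) (p + 1) (by push_cast; ring), hn _ _ ((p : ℤ) + 1 - 1) p (by ring),
      hn _ _ ((n : ℤ) + 1 + 1) (n + 2) (by push_cast; ring),
      hn _ _ ((n : ℤ) + 1) (n + 1) (by push_cast; ring), hn _ _ ((n : ℤ) + 1 - 1) n (by ring)]
    exact main p n i j k l

end Geometric

/-! ### The homomorphism to the enveloping superalgebra of `Q(N)` -/

/-- The element `E_{i,j} + E_{-i,-j}` of `Q(N)`, for signed indices `i` and `j`. -/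
def queerUnit : SignedIndex N → SignedIndex N → (queer (Fin N)).toSubmodule
  | .inl i, .inl j => ⟨eMat i j, _, _, rfl⟩
  | .inr i, .inr j => ⟨eMat i j, _, _, rfl⟩
  | .inl i, .inr j => ⟨fMat i j, _, _, rfl⟩
  | .inr i, .inl j => ⟨fMat i j, _, _, rfl⟩

theorem coe_queerUnit_mul (a b c d : SignedIndex N) :
    (queerUnit a b).1 * (queerUnit c d).1 = (if b = c then (queerUnit a d).1 else 0) +
      (if b = neg c then (queerUnit a (neg d)).1 else 0) := by
  have h : ∀ (i j k l : Fin N), Matrix.single i j (1 : ℂ) * Matrix.single k l 1 =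
      if j = k then Matrix.single i l 1 else 0 := by
    intro i j k l
    split_ifs with hjk
    · subst hjk
      rw [Matrix.single_mul_single_same, mul_one]
    · exact Matrix.single_mul_single_of_ne _ _ _ _ hjk _
  have h0 : ∀ (P : Prop) [Decidable P] (A : Matrix (Fin N) (Fin N) ℂ) ,
      (if P then qMat A 0 else 0) = qMat (if P then A else 0) 0 := by
    intro P _ A
    split_ifs
    · rfl
    · exact qMat_zero.symm
  have h1 : ∀ (P : Prop) [Decidable P] (A : Matrix (Fin N) (Fin N) ℂ) ,
      (if P then qMat 0 A else 0) = qMat 0 (if P then A else 0) := by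
    intro P _ A
    split_ifs
    · rfl
    · exact qMat_zero.symm
  rcases a with a | a <;> rcases b with b | b <;> rcases c with c | c <;> rcases d with d | d <;>
    simp [queerUnit, eMat, fMat, qMat_mul, h, h0, h1, neg]

theorem eMat_mem {I : Type} [Fintype I] [DecidableEq I] (i j : I) :
    eMat i j ∈ (matSuper I).grading 0 := by
  rw [mem_grading, eMat, parity_qMat, sgn_zero, one_smul, _root_.neg_zero]

theorem fMat_mem {I : Type} [Fintype I] [DecidableEq I] (i j : I) :
    fMat i j ∈ (matSuper I).grading 1 := by
  rw [mem_grading, fMat, parity_qMat, sgn_one, qMat_smul, smul_zero, neg_smul, one_smul]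

theorem queerUnit_mem (a b : SignedIndex N) :
    (queerUnit a b).1 ∈ (matSuper (Fin N)).grading (par a + par b) := by
  rcases a with a | a <;> rcases b with b | b
  · exact eMat_mem a b
  · exact fMat_mem a b
  · exact fMat_mem a b
  · exact eMat_mem a b

theorem queerUnit_neg_neg (a b : SignedIndex N) : queerUnit (neg a) (neg b) = queerUnit a b := by
  rcases a with a | a <;> rcases b with b | b <;> rfl

/-- The images of the generators of first order: `T_{i,j}^{(1)} ↦ -(-1)^{p(j)} (E_{j,i} +
E_{-j,-i})`. -/
def firstOrder (i j : SignedIndex N) : envelope (queer (Fin N)) :=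
  -(sgn (par j) • envι (queer (Fin N)) (queerUnit j i))

theorem firstOrder_neg_neg (i j : SignedIndex N) :
    firstOrder (neg i) (neg j) = -firstOrder i j := by
  rw [firstOrder, firstOrder, queerUnit_neg_neg, par_neg, sgn_add, sgn_one]
  module

theorem envι_queerUnit_bracket (a b c d : SignedIndex N) :
    envι (queer (Fin N)) (queerUnit a b) * envι (queer (Fin N)) (queerUnit c d) -
      sgn ((par a + par b) * (par c + par d)) •
        (envι (queer (Fin N)) (queerUnit c d) * envι (queer (Fin N)) (queerUnit a b)) =
    (if b = c then envι (queer (Fin N)) (queerUnit a d) else 0) +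
      (if b = neg c then envι (queer (Fin N)) (queerUnit a (neg d)) else 0) -
      sgn ((par a + par b) * (par c + par d)) •
        ((if d = a then envι (queer (Fin N)) (queerUnit c b) else 0) +
          (if d = neg a then envι (queer (Fin N)) (queerUnit c (neg b)) else 0)) := by
  rw [envι_mul_sub (queer (Fin N)) (queerUnit a b) (queerUnit c d)
    ((if b = c then queerUnit a d else 0) + (if b = neg c then queerUnit a (neg d) else 0) -
      sgn ((par a + par b) * (par c + par d)) • ((if d = a then queerUnit c b else 0) +
        (if d = neg a then queerUnit c (neg b) else 0)))
    (queerUnit_mem a b) (queerUnit_mem c d)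
    (by
      rw [coe_queerUnit_mul, coe_queerUnit_mul]
      simp only [Submodule.coe_sub, Submodule.coe_add, Submodule.coe_smul,
        apply_ite (Subtype.val), Submodule.coe_zero])]
  simp only [map_sub, map_add, map_smul, apply_ite (envι (queer (Fin N))), map_zero]

theorem firstOrderRelation_firstOrder :
    FirstOrderRelation (firstOrder (N := N)) firstOrder := by
  intro i j k l
  have h := envι_queerUnit_bracket j i l k
  have e : signedBracket (firstOrder (N := N)) firstOrder i j k l =
      (sgn (par i * par k + par i * par l + par k * par l) * (sgn (par j) * sgn (par l))) •
      (envι (queer (Fin N)) (queerUnit j i) * envι (queer (Fin N)) (queerUnit l k) -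
      sgn ((par j + par i) * (par l + par k)) •
        (envι (queer (Fin N)) (queerUnit l k) * envι (queer (Fin N)) (queerUnit j i))) := by
    rw [signedBracket, firstOrder, firstOrder, neg_mul_neg, neg_mul_neg, smul_mul_smul_comm,
      smul_mul_smul_comm, add_comm (par j), add_comm (par l)]
    module
  rw [e, h]
  have r1 : (if k = j then firstOrder i l else 0) =
      -(sgn (par l) • if k = j then envι (queer (Fin N)) (queerUnit l i) else 0) := by
    split_ifs <;> simp [firstOrder]
  have r2 : (if i = l then firstOrder k j else 0) =
      -(sgn (par j) • if i = l then envι (queer (Fin N)) (queerUnit j k) else 0) := by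
    split_ifs <;> simp [firstOrder]
  have r3 : (if neg k = j then firstOrder (neg i) l else 0) =
      -(sgn (par l) • if k = neg j then envι (queer (Fin N)) (queerUnit l (neg i)) else 0) := by
    simp only [neg_eq_iff]
    split_ifs <;> simp [firstOrder]
  have r4 : (if i = neg l then firstOrder k (neg j) else 0) =
      sgn (par j) • if i = neg l then envι (queer (Fin N)) (queerUnit j (neg k)) else 0 := by
    have hq : queerUnit (neg j) k = queerUnit j (neg k) := by
      rw [← queerUnit_neg_neg, neg_neg]
    split_ifs
    · rw [firstOrder, hq, par_neg, sgn_add, sgn_one]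
      module
    · rw [smul_zero]
  have e1 := smul_ite_congr (c := i = l) (s := sgn (par i * par k + par i * par l + par k * par l +
      (par j + par l))) (t := sgn (par j)) (envι (queer (Fin N)) (queerUnit j k)) (by
    rintro rfl
    congr 1
    generalize par i = i, par k = k, par j = j
    revert i k j
    decide)
  have e2 := smul_ite_congr (c := i = neg l) (s := sgn (par i * par k + par i * par l +
      par k * par l + (par j + par l))) (t := sgn (par k + par l + par j))
    (envι (queer (Fin N)) (queerUnit j (neg k))) (by
    rintro rfl
    rw [par_neg]
    congr 1
    generalize par l = l, par k = k, par j = j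
    revert l k j
    decide)
  have e3 := smul_ite_congr (c := k = j) (s := sgn (par i * par k + par i * par l +
      par k * par l + (par j + par l) + (par j + par i) * (par l + par k))) (t := sgn (par l))
    (envι (queer (Fin N)) (queerUnit l i)) (by
    rintro rfl
    congr 1
    generalize par l = l, par k = k, par i = i
    revert l k i
    decide)
  have e4 := smul_ite_congr (c := k = neg j) (s := sgn (par i * par k + par i * par l +
      par k * par l + (par j + par l) + (par j + par i) * (par l + par k)))
    (t := -sgn (par k + par l + par l)) (envι (queer (Fin N)) (queerUnit l (neg i))) (by
    rintro rfl
    rw [par_neg, ← neg_one_mul, ← sgn_one, ← sgn_add]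
    congr 1
    generalize par l = l, par j = j, par i = i
    revert l j i
    decide)
  rw [r1, r2, r3, r4]
  rw [sgn_add _ (par j + par l), sgn_add (par j)] at e1 e2
  rw [sgn_add _ ((par j + par i) * (par l + par k)), sgn_add _ (par j + par l),
    sgn_add (par j)] at e3 e4
  rw [sgn_add _ (par j)] at e2
  rw [sgn_add _ (par l)] at e4
  linear_combination (norm := module) e1 + e2 - e3 - e4

/-- Up to signs, Sergeev's elements are entries of the powers of the matrix of first order
generators. -/
theorem oppositePow_firstOrder (m : ℕ) (i j : Fin N) :
    oppositePow firstOrder (Sum.inl i) (Sum.inl j) m = (-1 : ℂ) ^ m • (sergeev m j i).1 ∧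
    oppositePow firstOrder (Sum.inr i) (Sum.inl j) m = (-1 : ℂ) ^ m • (sergeev m j i).2 := by
  induction m generalizing j with
  | zero => simp [oppositePow, sergeev, eq_comm]
  | succ m ih =>
    have h1 : ∀ k, oppositePow firstOrder (Sum.inl i) (Sum.inr k) m = (sergeev m k i).2 := by
      intro k
      have h := oppositePow_neg_neg firstOrder_neg_neg (Sum.inr i : SignedIndex N) (Sum.inl k) m
      rw [(ih k).2, smul_smul, ← mul_pow, neg_one_mul, _root_.neg_neg, one_pow, one_smul] at h
      exact h
    have h2 : ∀ k, oppositePow firstOrder (Sum.inr i) (Sum.inr k) m = (sergeev m k i).1 := by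
      intro k
      have h := oppositePow_neg_neg firstOrder_neg_neg (Sum.inl i : SignedIndex N) (Sum.inl k) m
      rw [(ih k).1, smul_smul, ← mul_pow, neg_one_mul, _root_.neg_neg, one_pow, one_smul] at h
      exact h
    have f1 : ∀ k, firstOrder (Sum.inl k) (Sum.inl j) = -e j k := by
      intro k
      simp [firstOrder, par, sgn_zero, queerUnit, e]
    have f2 : ∀ k, firstOrder (Sum.inr k) (Sum.inl j) = -f j k := by
      intro k
      simp [firstOrder, par, sgn_zero, queerUnit, f]
    have c1 : (-1 : ℂ) ^ (m + 1) * (-1) ^ (m + 2) = -1 := by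
      rw [← pow_add, show m + 1 + (m + 2) = 2 * (m + 1) + 1 by ring, pow_succ, pow_mul]
      simp
    constructor
    · rw [oppositePow, Fintype.sum_sum_type]
      simp only [h1, (ih _).1, f1, f2, sergeev, mul_smul_comm, neg_mul, smul_add, smul_smul, c1,
        Finset.sum_neg_distrib, ← Finset.smul_sum, smul_neg]
      rw [pow_succ]
      module
    · rw [oppositePow, Fintype.sum_sum_type]
      simp only [h2, (ih _).2, f1, f2, sergeev, mul_smul_comm, neg_mul, smul_add, smul_smul, c1,
        Finset.sum_neg_distrib, ← Finset.smul_sum, smul_neg]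
      rw [pow_succ]
      module

theorem firstOrder_mem (i j : SignedIndex N) :
    firstOrder i j ∈ (envelope (queer (Fin N))).grading (par i + par j) := by
  rw [firstOrder, add_comm]
  exact neg_mem (Submodule.smul_mem _ _ (envι_mem _ (queerUnit_mem j i)))

theorem oppositePow_mem {A : SuperAlgebra} {M : SignedIndex N → SignedIndex N → A}
    (hM : ∀ i j, M i j ∈ A.grading (par i + par j)) (i j : SignedIndex N) (m : ℕ) :
    oppositePow M i j m ∈ A.grading (par i + par j) := by
  induction m generalizing j with
  | zero =>
    rw [oppositePow]
    split_ifs with h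
    · subst h
      rw [CharTwo.add_self_eq_zero]
      exact SetLike.GradedOne.one_mem
    · exact Submodule.zero_mem _
  | succ m ih =>
    refine Submodule.sum_mem _ fun k _ => ?_
    have h := mul_mem_grading (hM k j) (ih k)
    have e : par k + par j + (par i + par k) = par i + par j := by
      generalize par i = a, par j = b, par k = c
      revert a b c
      decide
    rwa [e] at h

/-- The defining formulas prescribe the images only for positive second index; the relation
`T_{-i,-j}(u) = T_{i,j}(-u)` determines the others. -/
theorem IsSergeevHom.apply_T {U : Hom (yangian N) (envelope (queer (Fin N)))}
    (hU : IsSergeevHom U) (m : ℕ) (i j : SignedIndex N) :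
    U (T m i j) = oppositePow firstOrder i j m := by
  have hpos : ∀ (i : SignedIndex N) (j : Fin N),
      U (T (m : ℕ) i (Sum.inl j)) = oppositePow firstOrder i (Sum.inl j) m := by
    intro i j
    rcases Nat.eq_zero_or_pos m with rfl | hm
    · rw [Nat.cast_zero, T_zero, oppositePow]
      split_ifs <;> simp
    · rcases i with i | i
      · rw [(hU m i j hm).1, (oppositePow_firstOrder m i j).1]
      · rw [(hU m i j hm).2, (oppositePow_firstOrder m i j).2]
  rcases j with j | j
  · exact hpos i j
  · have h1 := T_neg_neg m (neg i) (Sum.inl j : SignedIndex N)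
    have h2 := oppositePow_neg_neg firstOrder_neg_neg (neg i) (Sum.inl j : SignedIndex N) m
    rw [neg_neg] at h1 h2
    change T m i (Sum.inr j) = _ at h1
    change oppositePow firstOrder i (Sum.inr j) m = _ at h2
    rw [h1, h2, map_smul, hpos]

theorem existsUnique_sergeevHom (N : ℕ) :
    ∃! U : Hom (yangian N) (envelope (queer (Fin N))), IsSergeevHom U := by
  obtain ⟨U, hU⟩ := exists_yangian_lift (A := envelope (queer (Fin N)))
    (oppositePow (firstOrder (N := N))) (fun _ _ => rfl) (oppositePow_mem firstOrder_mem)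
    (isRTT_oppositePow firstOrderRelation_firstOrder firstOrder_neg_neg)
    (oppositePow_neg_neg firstOrder_neg_neg)
  refine ⟨U, fun r i j _ => ?_, fun V hV => Hom.ext (yangian_algHom_ext fun m i j => ?_)⟩
  · rw [hU, hU]
    exact oppositePow_firstOrder r i j
  · rw [hU]
    exact hV.apply_T m i j

/-! ### Ordered sums of products -/

section OrderedSum

variable {A : Type} [Ring A]

/-- The entries of the ordered sum of the products `L_{b_1} ⋯ L_{b_r}` over `b > b_1 ≥ ⋯ ≥ b_r`,
for a sequence of matrices `L` and the opposite matrix product: a sequence either starts with its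
largest possible value, or it does not contain this value. -/
def orderedPow (L : ℕ → SignedIndex N → SignedIndex N → A) :
    ℕ → SignedIndex N → SignedIndex N → ℕ → A
  | _, i, j, 0 => if i = j then 1 else 0
  | 0, _, _, _ + 1 => 0
  | b + 1, i, j, r + 1 => orderedPow L b i j (r + 1) + ∑ k, L b k j * orderedPow L (b + 1) i k r

theorem orderedPow_zero (L : ℕ → SignedIndex N → SignedIndex N → A) (b : ℕ)
    (i j : SignedIndex N) : orderedPow L b i j 0 = if i = j then 1 else 0 := by
  cases b <;> rw [orderedPow]

theorem orderedPow_one (L : ℕ → SignedIndex N → SignedIndex N → A) (i j : SignedIndex N) (r : ℕ) :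
    orderedPow L 1 i j r = oppositePow (L 0) i j r := by
  induction r generalizing j with
  | zero => rw [orderedPow, oppositePow]
  | succ r ih => simp only [orderedPow, oppositePow, zero_add, ih]

/-- The matrix of first order generators built from the images of the `e_{i,j}` and `f_{i,j}`. -/
def signedLetter (X Ξ : Fin N → Fin N → A) : SignedIndex N → SignedIndex N → A
  | .inl k, .inl j => -X j k
  | .inr k, .inl j => -Ξ j k
  | .inl k, .inr j => Ξ j k
  | .inr k, .inr j => X j k

theorem signedLetter_neg_neg (X Ξ : Fin N → Fin N → A) (i j : SignedIndex N) :
    signedLetter X Ξ (neg i) (neg j) = -signedLetter X Ξ i j := by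
  rcases i with i | i <;> rcases j with j | j <;> simp [signedLetter, neg]

/-- Multiplying by the geometric series of one more matrix adds this matrix as the largest term of
the ordered sums. -/
theorem convolution_oppositePow_orderedPow {M : SignedIndex N → SignedIndex N → A}
    {L : ℕ → SignedIndex N → SignedIndex N → A} {b : ℕ} (hM : L b = M) (i j : SignedIndex N)
    (r : ℕ) :
    convolution (oppositePow M) (orderedPow L b) i j r = orderedPow L (b + 1) i j r := by
  subst hM
  have h0 : ∀ j r, ∑ k, oppositePow (L b) k j 0 * orderedPow L b i k r = orderedPow L b i j r := by
    intro j r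
    simp [oppositePow]
  induction r generalizing j with
  | zero =>
    rw [convolution, Finset.Nat.antidiagonal_zero, Finset.sum_singleton, h0, orderedPow_zero,
      orderedPow_zero]
  | succ r ih =>
    rw [convolution, Finset.Nat.sum_antidiagonal_succ, h0, orderedPow]
    congr 1
    simp only [← ih, convolution, oppositePow, Finset.sum_mul, Finset.mul_sum, mul_assoc]
    refine Eq.trans ?_ Finset.sum_comm
    exact Finset.sum_congr rfl fun s _ => Finset.sum_comm

variable [Algebra ℂ A]

theorem map_orderedPow {B : Type} [Ring B] [Algebra ℂ B] (φ : A →ₐ[ℂ] B)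
    {L : ℕ → SignedIndex N → SignedIndex N → A} {L' : ℕ → SignedIndex N → SignedIndex N → B}
    {b : ℕ} (h : ∀ c < b, ∀ i j, φ (L c i j) = L' c i j) (i j : SignedIndex N) (r : ℕ) :
    φ (orderedPow L b i j r) = orderedPow L' b i j r := by
  induction b generalizing j r with
  | zero =>
    cases r with
    | zero =>
      rw [orderedPow, orderedPow]
      split_ifs <;> simp
    | succ r => rw [orderedPow, orderedPow, map_zero]
  | succ b ihb =>
    induction r generalizing j with
    | zero =>
      rw [orderedPow, orderedPow]
      split_ifs <;> simp
    | succ r ihr =>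
      rw [orderedPow, orderedPow, map_add, map_sum, ihb fun c hc => h c (hc.trans b.lt_succ_self)]
      simp only [map_mul, h b b.lt_succ_self, ihr]

theorem orderedPow_neg_neg {L : ℕ → SignedIndex N → SignedIndex N → A}
    (hL : ∀ b i j, L b (neg i) (neg j) = -L b i j) (b : ℕ) (i j : SignedIndex N) (r : ℕ) :
    orderedPow L b (neg i) (neg j) r = (-1 : ℂ) ^ r • orderedPow L b i j r := by
  induction b generalizing j r with
  | zero =>
    cases r with
    | zero => simp [orderedPow, neg_inj]
    | succ r => rw [orderedPow, orderedPow, smul_zero]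
  | succ b ihb =>
    induction r generalizing j with
    | zero => simp [orderedPow, neg_inj]
    | succ r ihr =>
      rw [orderedPow, orderedPow, smul_add, ihb, ← sum_neg, Finset.smul_sum]
      congr 1
      refine Finset.sum_congr rfl fun k _ => ?_
      rw [ihr, hL, mul_smul_comm, pow_succ, mul_smul, neg_one_smul, neg_mul]

theorem orderedPow_mem {A : SuperAlgebra} {L : ℕ → SignedIndex N → SignedIndex N → A}
    (hL : ∀ b i j, L b i j ∈ A.grading (par i + par j)) (b : ℕ) (i j : SignedIndex N) (r : ℕ) :
    orderedPow L b i j r ∈ A.grading (par i + par j) := by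
  have hδ : ∀ b j, orderedPow L b i j 0 ∈ A.grading (par i + par j) := fun b j => by
    rw [orderedPow_zero]
    exact oppositePow_mem (hL 0) i j 0
  induction b generalizing j r with
  | zero =>
    cases r with
    | zero => exact hδ 0 j
    | succ r =>
      rw [orderedPow]
      exact Submodule.zero_mem _
  | succ b ihb =>
    induction r generalizing j with
    | zero => exact hδ (b + 1) j
    | succ r ihr =>
      rw [orderedPow]
      refine add_mem (ihb j (r + 1)) (Submodule.sum_mem _ fun k _ => ?_)
      have h := mul_mem_grading (hL b k j) (ihr k)
      have e : par k + par j + (par i + par k) = par i + par j := by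
        generalize par i = a, par j = b, par k = c
        revert a b c
        decide
      rwa [e] at h

theorem firstOrder_eq_signedLetter : firstOrder (N := N) = signedLetter e f := by
  funext i j
  rcases i with i | i <;> rcases j with j | j <;>
    simp [firstOrder, signedLetter, par, sgn_zero, sgn_one, queerUnit, e, f]

end OrderedSum

/-! ### The iterated comultiplication -/

/-- The matrices of first order generators in the tensor factors, counted from the last one. -/
def factorLetter (N m b : ℕ) (i j : SignedIndex N) : tensorPow (envelope (queer (Fin N))) m :=
  if h : b < m + 1 then factor _ m (Fin.rev ⟨b, h⟩) (firstOrder i j) else 0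

/-- The iterated comultiplication, followed by the homomorphisms to the enveloping superalgebras in
the tensor factors, gives ordered sums: each further tensor factor contributes a geometric
series. -/
theorem mapPow_iterate_T {Δ : Hom (yangian N) (tensor (yangian N) (yangian N))}
    {U : Hom (yangian N) (envelope (queer (Fin N)))} (hΔ : IsOppositeComultiplication Δ)
    (hU : IsSergeevHom U) (m r : ℕ) (i j : SignedIndex N) :
    mapPow U m (iterate Δ m (T r i j)) = orderedPow (factorLetter N m) (m + 1) i j r := by
  induction m generalizing i j r with
  | zero =>
    have hL : factorLetter N 0 0 = firstOrder := by
      funext k l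
      exact dif_pos Nat.one_pos
    exact (hU.apply_T r i j).trans (hL ▸ (orderedPow_one (factorLetter N 0) i j r).symm)
  | succ m ih =>
    let 𝒰 := envelope (queer (Fin N))
    let M : SignedIndex N → SignedIndex N → tensorPow 𝒰 (m + 1) :=
      fun i j => inclLeft 𝒰 (tensorPow 𝒰 m) (firstOrder i j)
    have hM : factorLetter N (m + 1) (m + 1) = M := by
      funext k l
      rw [factorLetter, dif_pos (Nat.lt_succ_self _)]
      rw [show Fin.rev (⟨m + 1, Nat.lt_succ_self _⟩ : Fin (m + 1 + 1)) = 0 by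
        ext; simp [Fin.val_rev]]
      rfl
    have hl : ∀ r i j, inclLeft 𝒰 (tensorPow 𝒰 m) (oppositePow firstOrder i j r) =
        oppositePow M i j r := by
      intro r i j
      induction r generalizing j with
      | zero =>
        rw [oppositePow, oppositePow]
        split_ifs
        · exact map_one _
        · exact map_zero _
      | succ r ihr =>
        rw [oppositePow, oppositePow, map_sum]
        refine Finset.sum_congr rfl fun k _ => ?_
        rw [map_mul, ihr]
        rfl
    have hr : ∀ r i j, inclRight 𝒰 (tensorPow 𝒰 m)
        (orderedPow (factorLetter N m) (m + 1) i j r) =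
        orderedPow (factorLetter N (m + 1)) (m + 1) i j r := by
      intro r i j
      refine map_orderedPow (inclRight 𝒰 (tensorPow 𝒰 m)).toAlgHom ?_ i j r
      intro c hc k l
      rw [factorLetter, dif_pos hc, factorLetter, dif_pos (hc.trans (Nat.lt_succ_self _))]
      rw [show Fin.rev (⟨c, hc.trans (Nat.lt_succ_self _)⟩ : Fin (m + 1 + 1)) =
        Fin.succ (Fin.rev ⟨c, hc⟩) from Fin.rev_castSucc ⟨c, hc⟩]
      rfl
    rw [← convolution_oppositePow_orderedPow hM]
    have h : mapPow U (m + 1) (iterate Δ (m + 1) (T r i j)) =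
        map U (mapPow U m) (map (Hom.id _) (iterate Δ m) (Δ (T r i j))) := rfl
    rw [h, hΔ r i j, sum_range_tmul_eq_convolution, convolution, convolution, map_sum, map_sum]
    refine Finset.sum_congr rfl fun s _ => ?_
    rw [map_sum, map_sum]
    refine Finset.sum_congr rfl fun k _ => ?_
    rw [map_mul, map_mul, map_inclLeft, map_inclRight, map_inclLeft, map_inclRight, ih]
    change inclLeft 𝒰 (tensorPow 𝒰 m) (U (T s.1 k j)) * _ = _
    rw [hU.apply_T, hl, hr]
    rfl

/-! ### The ordered sum in the enveloping superalgebra of the Levi subalgebra -/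

/-- The matrix of first order generators built from `x^i_{p,q}` and `ξ^i_{p,q}`. -/
def leviLetter (N l b : ℕ) : SignedIndex N → SignedIndex N → envelope (levi N l) :=
  if h : b < l then signedLetter (x ⟨b, h⟩) (ξ ⟨b, h⟩) else 0

theorem leviLetter_neg_neg (b : ℕ) (i j : SignedIndex N) :
    leviLetter N l b (neg i) (neg j) = -leviLetter N l b i j := by
  rw [leviLetter]
  split_ifs
  · exact signedLetter_neg_neg _ _ i j
  · simp

theorem leviLetter_mem (b : ℕ) (i j : SignedIndex N) :
    leviLetter N l b i j ∈ (envelope (levi N l)).grading (par i + par j) := by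
  rw [leviLetter]
  split_ifs with h
  · have hx : ∀ p q, x (N := N) ⟨b, h⟩ p q ∈ (envelope (levi N l)).grading 0 := fun p q =>
      envι_mem _ (eMat_mem _ _)
    have hξ : ∀ p q, ξ (N := N) ⟨b, h⟩ p q ∈ (envelope (levi N l)).grading 1 := fun p q =>
      Submodule.smul_mem _ _ (envι_mem _ (fMat_mem _ _))
    rcases i with i | i <;> rcases j with j | j
    · exact neg_mem (hx j i)
    · exact hξ j i
    · exact neg_mem (hξ j i)
    · exact hx j i
  · exact Submodule.zero_mem _

/-- The part of the ordered sum with `i_1, …, i_r ≤ b`, where `b` is counted from `1`. -/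
def partialOrderedSum (l b r : ℕ) (p q : Fin N) : envelope (levi N l) :=
  ∑ P : Fin (r + 1) → Fin N with P 0 = p ∧ P (Fin.last r) = q,
    ∑ i : Fin r → Fin l with (∀ s t, s ≤ t → i t ≤ i s) ∧ ∀ t, (i t : ℕ) < b,
      (List.ofFn fun t : Fin r =>
        x (i t) (P t.castSucc) (P t.succ) +
          (-1 : ℂ) ^ (r + 1 - (t : ℕ)) • ξ (i t) (P t.castSucc) (P t.succ)).prod

theorem partialOrderedSum_self (r : ℕ) (p q : Fin N) :
    partialOrderedSum l l r p q = orderedSum r p q := by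
  simp [partialOrderedSum, orderedSum]

theorem partialOrderedSum_zero_right (b : ℕ) (p q : Fin N) :
    partialOrderedSum l b 0 p q = if q = p then 1 else 0 := by
  rw [partialOrderedSum, Finset.sum_filter, ← (Equiv.funUnique (Fin 1) (Fin N)).symm.sum_comp]
  simp [ite_and, Finset.sum_ite_eq, eq_comm]

/-- A sequence is weakly decreasing with values below `b` if and only if its first term is below `b`
and the rest is weakly decreasing and bounded by the first term. -/
theorem cons_antitone_iff {r b : ℕ} (i₀ : Fin l) (i : Fin r → Fin l) :
    ((∀ s t : Fin (r + 1), s ≤ t →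
        (Fin.cons i₀ i : Fin (r + 1) → Fin l) t ≤ (Fin.cons i₀ i : Fin (r + 1) → Fin l) s) ∧
      ∀ t : Fin (r + 1), ((Fin.cons i₀ i : Fin (r + 1) → Fin l) t : ℕ) < b) ↔
    (i₀ : ℕ) < b ∧ ((∀ s t, s ≤ t → i t ≤ i s) ∧ ∀ t, (i t : ℕ) < i₀ + 1) := by
  constructor
  · rintro ⟨h1, h2⟩
    refine ⟨h2 0, fun s t hst => h1 s.succ t.succ (Fin.succ_le_succ_iff.mpr hst), fun t => ?_⟩
    exact Nat.lt_succ_of_le (h1 0 t.succ (Fin.zero_le _))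
  · rintro ⟨h1, h2, h3⟩
    constructor
    · intro s t hst
      induction s using Fin.cases with
      | zero =>
        induction t using Fin.cases with
        | zero => exact le_rfl
        | succ t => exact Nat.le_of_lt_succ (h3 t)
      | succ s =>
        induction t using Fin.cases with
        | zero => exact absurd hst (by simp)
        | succ t => exact h2 s t (Fin.succ_le_succ_iff.mp hst)
    · intro t
      induction t using Fin.cases with
      | zero => exact h1
      | succ t => exact (Nat.le_of_lt_succ (h3 t)).trans_lt h1

/-- Splitting off the first factor of the products. -/
theorem partialOrderedSum_succ_right (b r : ℕ) (p q : Fin N) :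
    partialOrderedSum l b (r + 1) p q = 
      ∑ i₀ ∈ Finset.univ.filter (fun i₀ : Fin l => (i₀ : ℕ) < b), ∑ k,
       
      (x i₀ p k + (-1 : ℂ) ^ r • ξ i₀ p k) * partialOrderedSum l (i₀ + 1) r k q := by
  let C : Fin l → (Fin r → Fin l) → Prop := fun i₀ i =>
    (∀ s t, s ≤ t → i t ≤ i s) ∧ ∀ t, (i t : ℕ) < i₀ + 1
  let G : (Fin (r + 1) → Fin N) → Fin l → (Fin r → Fin l) → envelope (levi N l) := fun P i₀ i =>
    (x i₀ p (P 0) + (-1 : ℂ) ^ r • ξ i₀ p (P 0)) *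
      (List.ofFn fun t : Fin r =>
        x (i t) (P t.castSucc) (P t.succ) +
          (-1 : ℂ) ^ (r + 1 - (t : ℕ)) • ξ (i t) (P t.castSucc) (P t.succ)).prod
  trans ∑ i₀ : Fin l, ∑ P : Fin (r + 1) → Fin N, ∑ i : Fin r → Fin l,
    if (i₀ : ℕ) < b ∧ P (Fin.last r) = q ∧ C i₀ i then G P i₀ i else 0
  · rw [partialOrderedSum, Finset.sum_filter, ← (Fin.consEquiv fun _ => Fin N).sum_comp,
      Fintype.sum_prod_type, Finset.sum_eq_single p]
    · rw [Finset.sum_comm]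
      refine Finset.sum_congr rfl fun P _ => ?_
      rw [Finset.sum_filter, ← (Fin.consEquiv fun _ => Fin l).sum_comp, Fintype.sum_prod_type]
      have hP : (Fin.consEquiv fun _ => Fin N) (p, P) 0 = p := rfl
      have hP' : (Fin.consEquiv fun _ => Fin N) (p, P) (Fin.last (r + 1)) = P (Fin.last r) := rfl
      rw [hP, hP']
      by_cases hq : P (Fin.last r) = q
      · rw [if_pos ⟨rfl, hq⟩]
        refine Finset.sum_congr rfl fun i₀ _ => Finset.sum_congr rfl fun i _ => ?_
        refine if_congr ((cons_antitone_iff i₀ i).trans (by simp only [hq, true_and, C])) ?_ rfl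
        rw [List.ofFn_succ, List.prod_cons]
        refine congr (congrArg _ ?_) (congrArg _ (congrArg _ (funext fun t => ?_)))
        · rw [show (-1 : ℂ) ^ r = (-1) ^ (r + 1 + 1 - ((0 : Fin (r + 1)) : ℕ)) by
            simp [pow_succ]]
          rfl
        · rw [show r + 1 - (t : ℕ) = r + 1 + 1 - (t.succ : ℕ) by simp]
          rfl
      · rw [if_neg fun h => hq h.2]
        exact (Finset.sum_eq_zero fun i₀ _ => Finset.sum_eq_zero fun i _ =>
          if_neg fun h => hq h.2.1).symm
    · intro p' _ hp'
      exact Finset.sum_eq_zero fun P _ => if_neg fun h => hp' h.1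
    · exact fun h => absurd (Finset.mem_univ p) h
  · rw [Finset.sum_filter]
    refine Finset.sum_congr rfl fun i₀ _ => ?_
    split_ifs with hb
    · simp only [partialOrderedSum, Finset.sum_filter, Finset.mul_sum, hb, true_and]
      refine Eq.trans ?_ Finset.sum_comm
      refine Finset.sum_congr rfl fun P _ => ?_
      rw [Finset.sum_eq_single (P 0)]
      · by_cases hq : P (Fin.last r) = q
        · simp only [hq, true_and, if_true, Finset.mul_sum, mul_ite, mul_zero, C, G]
        · simp [hq]
      · intro k _ hk
        rw [if_neg fun h => hk h.1.symm, mul_zero]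
      · exact fun h => absurd (Finset.mem_univ _) h
    · exact Finset.sum_eq_zero fun P _ => Finset.sum_eq_zero fun i _ => if_neg fun h => hb h.1

theorem partialOrderedSum_succ_succ {b : ℕ} (hb : b < l) (r : ℕ) (p q : Fin N) :
    partialOrderedSum l (b + 1) (r + 1) p q = partialOrderedSum l b (r + 1) p q +
      ∑ k, (x ⟨b, hb⟩ p k + (-1 : ℂ) ^ r • ξ ⟨b, hb⟩ p k) * partialOrderedSum l (b + 1) r k q := by
  rw [partialOrderedSum_succ_right, partialOrderedSum_succ_right]
  have h : Finset.univ.filter (fun i₀ : Fin l => (i₀ : ℕ) < b + 1) =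
      insert ⟨b, hb⟩ (Finset.univ.filter fun i₀ : Fin l => (i₀ : ℕ) < b) := by
    ext i₀
    simp only [Finset.mem_filter, Finset.mem_univ, true_and, Finset.mem_insert, Fin.ext_iff]
    omega
  rw [h, Finset.sum_insert (by simp), add_comm]

/-- The ordered sum is the sum of the two entries of the ordered powers of the matrices of first
order generators that correspond to `T_{q,p}` and `T_{-q,p}`. -/
theorem partialOrderedSum_eq {b : ℕ} (hb : b ≤ l) (r : ℕ) (p q : Fin N) :
    partialOrderedSum l b r p q = (-1 : ℂ) ^ r •
      (orderedPow (leviLetter N l) b (Sum.inl q) (Sum.inl p) r +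
        orderedPow (leviLetter N l) b (Sum.inr q) (Sum.inl p) r) := by
  induction b generalizing r p with
  | zero =>
    cases r with
    | zero => simp [partialOrderedSum_zero_right, orderedPow]
    | succ r => simp [partialOrderedSum_succ_right, orderedPow]
  | succ b ihb =>
    induction r generalizing p with
    | zero => simp [partialOrderedSum_zero_right, orderedPow]
    | succ r ihr =>
      have h1 : ∀ k, orderedPow (leviLetter N l) (b + 1) (Sum.inl q) (Sum.inr k) r =
          (-1 : ℂ) ^ r • orderedPow (leviLetter N l) (b + 1) (Sum.inr q) (Sum.inl k) r := fun k =>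
        orderedPow_neg_neg leviLetter_neg_neg (b + 1) (Sum.inr q) (Sum.inl k) r
      have h2 : ∀ k, orderedPow (leviLetter N l) (b + 1) (Sum.inr q) (Sum.inr k) r =
          (-1 : ℂ) ^ r • orderedPow (leviLetter N l) (b + 1) (Sum.inl q) (Sum.inl k) r := fun k =>
        orderedPow_neg_neg leviLetter_neg_neg (b + 1) (Sum.inl q) (Sum.inl k) r
      have hb' : b < l := hb
      have e1 : ∀ k, leviLetter N l b (Sum.inl k) (Sum.inl p) = -x ⟨b, hb'⟩ p k := by
        intro k
        rw [leviLetter, dif_pos hb', signedLetter]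
      have e2 : ∀ k, leviLetter N l b (Sum.inr k) (Sum.inl p) = -ξ ⟨b, hb'⟩ p k := by
        intro k
        rw [leviLetter, dif_pos hb', signedLetter]
      rw [partialOrderedSum_succ_succ hb', ihb (Nat.le_of_succ_le hb), orderedPow, orderedPow,
        Fintype.sum_sum_type, Fintype.sum_sum_type]
      simp only [ihr, h1, h2, e1, e2, neg_mul, mul_smul_comm, add_mul, mul_add, smul_mul_assoc,
        Finset.sum_add_distrib, Finset.sum_neg_distrib, ← Finset.smul_sum, smul_add]
      rw [pow_succ]
      module

theorem evenPart_add_of_mem {A : SuperAlgebra} {u v : A} (hu : u ∈ A.grading 0)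
    (hv : v ∈ A.grading 1) : evenPart (u + v) = u ∧ oddPart (u + v) = v := by
  rw [mem_grading, sgn_zero, one_smul] at hu
  rw [mem_grading, sgn_one] at hv
  rw [evenPart, oddPart, map_add, hu, hv]
  constructor <;> module

/-- The parities of the entries of the ordered powers separate the two summands. -/
theorem orderedSum_parts (r : ℕ) (p q : Fin N) :
    evenPart (orderedSum (l := l) r p q) =
        (-1 : ℂ) ^ r • orderedPow (leviLetter N l) l (Sum.inl q) (Sum.inl p) r ∧
      oddPart (orderedSum (l := l) r p q) =
        (-1 : ℂ) ^ r • orderedPow (leviLetter N l) l (Sum.inr q) (Sum.inl p) r := by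
  rw [← partialOrderedSum_self, partialOrderedSum_eq le_rfl, smul_add]
  exact evenPart_add_of_mem
    (Submodule.smul_mem _ _ (orderedPow_mem leviLetter_mem l (Sum.inl q) (Sum.inl p) r))
    (Submodule.smul_mem _ _ (orderedPow_mem leviLetter_mem l (Sum.inr q) (Sum.inl p) r))

theorem IsLeviIdentification.apply_orderedPow {m : ℕ}
    {Φ : envelope (levi N (m + 1)) ≃ₐ[ℂ] tensorPow (envelope (queer (Fin N))) m}
    (hΦ : IsLeviIdentification Φ) (i j : SignedIndex N) (r : ℕ) :
    Φ (orderedPow (leviLetter N (m + 1)) (m + 1) i j r) =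
      orderedPow (factorLetter N m) (m + 1) i j r := by
  refine map_orderedPow Φ.toAlgHom ?_ i j r
  intro c hc i j
  change Φ _ = _
  rw [leviLetter, dif_pos hc, factorLetter, dif_pos hc, firstOrder_eq_signedLetter]
  rcases i with i | i <;> rcases j with j | j
  · exact (map_neg Φ _).trans ((congrArg _ (hΦ.2 ⟨c, hc⟩ j i).1).trans (map_neg _ _).symm)
  · exact (hΦ.2 ⟨c, hc⟩ j i).2
  · exact (map_neg Φ _).trans ((congrArg _ (hΦ.2 ⟨c, hc⟩ j i).2).trans (map_neg _ _).symm)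
  · exact (hΦ.2 ⟨c, hc⟩ j i).1

end QueerYangian

end

open QueerYangian QueerYangian.SuperAlgebra in
/-- `l = m + 1 ≥ 1` is the number of tensor factors, and `n = N l`. -/
theorem mainTheorem6 (N m : ℕ) :
    (∃! Δ : Hom (yangian N) (tensor (yangian N) (yangian N)), IsOppositeComultiplication Δ) ∧
    (∃! U : Hom (yangian N) (envelope (queer (Fin N))), IsSergeevHom U) ∧
    (∃! Φ : envelope (levi N (m + 1)) ≃ₐ[ℂ] tensorPow (envelope (queer (Fin N))) m,
      IsLeviIdentification Φ) ∧
    ∀ (Δ : Hom (yangian N) (tensor (yangian N) (yangian N)))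
      (U : Hom (yangian N) (envelope (queer (Fin N))))
      (Φ : envelope (levi N (m + 1)) ≃ₐ[ℂ] tensorPow (envelope (queer (Fin N))) m),
      IsOppositeComultiplication Δ → IsSergeevHom U → IsLeviIdentification Φ →
      ∀ (r : ℕ) (p q : Fin N), 1 ≤ r →
        mapPow U m (iterate Δ m (T r (Sum.inl q) (Sum.inl p))) =
            Φ ((-1 : ℂ) ^ r • evenPart (orderedSum r p q)) ∧
        mapPow U m (iterate Δ m (T r (Sum.inr q) (Sum.inl p))) =
            Φ ((-1 : ℂ) ^ r • oddPart (orderedSum r p q)) := by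
  refine ⟨existsUnique_oppositeComultiplication N, existsUnique_sergeevHom N,
    existsUnique_leviIdentification N m, ?_⟩
  intro Δ U Φ hΔ hU hΦ r p q _
  have e : ∀ y : envelope (levi N (m + 1)), (-1 : ℂ) ^ r • (-1 : ℂ) ^ r • y = y := by
    intro y
    rw [smul_smul, ← mul_pow, neg_one_mul, _root_.neg_neg, one_pow, one_smul]
  rw [(orderedSum_parts r p q).1, (orderedSum_parts r p q).2, e, e, hΦ.apply_orderedPow,
    hΦ.apply_orderedPow]
  exact ⟨mapPow_iterate_T hΔ hU m r _ _, mapPow_iterate_T hΔ hU m r _ _⟩
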